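/- Let $\kappa(t)=2/(4-3\cos^2 t)^{3/2}$ be the curvature of the ellipse $(2\cos t,\sin t,0)$, with derivative $\dot\kappa(t)=-18\cos t\,\sin t/(4-3\cos^2 t)^{5/2}$. For real $\varepsilon,\rho,\mu$ let $\mathbf c_\varepsilon(t)=(2\cos t,\sin t,\varepsilon\dot\kappa(t))$, with Frenet frame $(\mathbf t,\mathbf n,\mathbf b)$ and speed $\dot s=|\dot{\mathbf c}_\varepsilon|$, and let $r(t)=\rho+\mu\dot\kappa(t)$. Let $S_{\varepsilon,\rho,\mu}$ be the canal surface $$\alpha(t,\varphi)=\mathbf c_\varepsilon(t)+r\cos\theta\,\mathbf t+r\sin\theta\,(\cos\varphi\,\mathbf n+\sin\varphi\,\mathbf b),\qquad \cos\theta=-\dot r/\dot s,\quad \sin\theta=\sqrt{1-\cos^2\theta},$$ on the torus $(\mathbb R/2\pi\mathbb Z)^2$, with unit normal in the direction of $\alpha_t\wedge\alpha_\varphi$ (pointing inwards). Principal cycles are the closed leaves, in this torus, of the foliation by the lines of curvature of the minimal principal curvature (the lines of the maximal principal curvature are the circles $t=$ const., all closed). A principal cycle is hyperbolic if the derivative of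 its Poincaré return map $h$ at the fixed point is different from $1$. It is double if at the fixed point $h'=1$ and $h''\neq 0$. There are $\rho_0,\mu_0>0$ and functions $\varepsilon_1,\varepsilon_2$, smooth on $]-\mu_0,\mu_0[$, with $\varepsilon_1(\mu)=-\mu+O(\mu^2)$ and $\varepsilon_2(\mu)=\mu+O(\mu^2)$ as $\mu\to0$, such that for all $\rho\in\,]0,\rho_0[$ and $\mu\in\,]0,\mu_0[$ for which the radial function $r$ is everywhere positive the following holds. One has $\varepsilon_1(\mu)<\varepsilon_2(\mu)$, and for every $\varepsilon\in[\varepsilon_1(\mu),\varepsilon_2(\mu)]$ the map $\alpha$ is a smooth immersion without umbilic points. If $\varepsilon\in\,]\varepsilon_1(\mu),\varepsilon_2(\mu)[$, then $S_{\varepsilon,\rho,\mu}$ has exactly two principal cycles, and both are hyperbolic. If $\varepsilon=\varepsilon_1(\mu)$ or $\varepsilon=\varepsilon_2(\mu)$, then $S_{\varepsilon,\rho,\mu}$ has exactly one principal cycle, and it is double. -/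

import Mathlib

open Set Filter Topology Asymptotics
open scoped ContDiff

noncomputable section

namespace Canal

/-- Euclidean three-space. -/
abbrev E3 : Type := EuclideanSpace ℝ (Fin 3)

/-- The wedge (cross) product of `ℝ³`. -/
def cross (a b : E3) : E3 := WithLp.toLp 2 (crossProduct (WithLp.ofLp a) (WithLp.ofLp b))

/-! ### Curves with an arbitrary regular parameter, and canal surfaces -/

/-- The speed `ṡ = |ċ|`. -/
def speed (c : ℝ → E3) (t : ℝ) : ℝ := ‖deriv c t‖

/-- The unit tangent. -/
def frenetT (c : ℝ → E3) (t : ℝ) : E3 := (speed c t)⁻¹ • deriv c t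

/-- The binormal, the unit vector in the direction of `ċ ∧ c̈`. -/
def frenetB (c : ℝ → E3) (t : ℝ) : E3 :=
  ‖cross (deriv c t) (deriv (deriv c) t)‖⁻¹ • cross (deriv c t) (deriv (deriv c) t)

/-- The principal normal; `(T, N, B)` is a positive orthonormal frame. -/
def frenetN (c : ℝ → E3) (t : ℝ) : E3 := cross (frenetB c t) (frenetT c t)

/-- `cos θ = - dr/ds`, where `s` is the arc length of `c`. -/
def canalCos (c : ℝ → E3) (r : ℝ → ℝ) (t : ℝ) : ℝ := -(deriv r t / speed c t)

/-- `sin θ`, for `θ ∈ ]0, π[`. -/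
def canalSin (c : ℝ → E3) (r : ℝ → ℝ) (t : ℝ) : ℝ := Real.sqrt (1 - canalCos c r t ^ 2)

/-- The canal surface with center along `c` and radial function `r`, as a map of `(t, φ)`:
`c + r cos θ T + r sin θ (cos φ N + sin φ B)`, with `cos θ = -dr/ds`. -/
def canalSurface (c : ℝ → E3) (r : ℝ → ℝ) (p : ℝ × ℝ) : E3 :=
  c p.1 + (r p.1 * canalCos c r p.1) • frenetT c p.1
    + (r p.1 * canalSin c r p.1) • (Real.cos p.2 • frenetN c p.1 + Real.sin p.2 • frenetB c p.1)

/-! ### Principal curvature lines of a parametrized surface -/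

/-- A smooth immersion of the parameter plane. -/
def IsSmoothImmersion (α : ℝ × ℝ → E3) : Prop :=
  ContDiff ℝ ∞ α ∧ ∀ p, Function.Injective (fderiv ℝ α p)

/-- The positive unit normal, in the direction of `∂α/∂t ∧ ∂α/∂φ`. -/
def unitNormal (α : ℝ × ℝ → E3) (p : ℝ × ℝ) : E3 :=
  ‖cross (fderiv ℝ α p (1, 0)) (fderiv ℝ α p (0, 1))‖⁻¹ •
    cross (fderiv ℝ α p (1, 0)) (fderiv ℝ α p (0, 1))

/-- `v` is a principal direction at `p` with principal curvature `k`
(equation of Rodrigues: `dN(v) + k dα(v) = 0`). -/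
def IsPrincipalDirection (α : ℝ × ℝ → E3) (p v : ℝ × ℝ) (k : ℝ) : Prop :=
  v ≠ 0 ∧ fderiv ℝ (unitNormal α) p v + k • fderiv ℝ α p v = 0

/-- `k` is a principal curvature at `p`. -/
def IsPrincipalCurvature (α : ℝ × ℝ → E3) (p : ℝ × ℝ) (k : ℝ) : Prop :=
  ∃ v, IsPrincipalDirection α p v k

/-- `p` is umbilic: every direction is principal, with one and the same curvature. -/
def IsUmbilic (α : ℝ × ℝ → E3) (p : ℝ × ℝ) : Prop :=
  ∃ k : ℝ, ∀ v, v ≠ 0 → IsPrincipalDirection α p v k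

/-- `v` is a principal direction at `p` for the minimal principal curvature. -/
def IsMinimalDirection (α : ℝ × ℝ → E3) (p v : ℝ × ℝ) : Prop :=
  ∃ k, IsPrincipalDirection α p v k ∧ ∀ k', IsPrincipalCurvature α p k' → k ≤ k'

/-- The projection of the parameter plane onto the torus `(ℝ / 2πℤ)²`. -/
def toTorus (p : ℝ × ℝ) : Real.Angle × Real.Angle := ((p.1 : Real.Angle), (p.2 : Real.Angle))

/-- The deck translation by `(2πm, 2πn)`. -/
def deck (m n : ℤ) : ℝ × ℝ := (2 * Real.pi * m, 2 * Real.pi * n)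

/-- `C` is a principal cycle (periodic principal line on the torus) of the minimal principal
foliation of the surface `α`, where `α` is `2π`-periodic in both variables. -/
def IsPrincipalCycle (α : ℝ × ℝ → E3) (C : Set (Real.Angle × Real.Angle)) : Prop :=
  ∃ (γ : ℝ → ℝ × ℝ) (T : ℝ) (m n : ℤ), 0 < T ∧ ContDiff ℝ ∞ γ ∧
    (∀ u, IsMinimalDirection α (γ u) (deriv γ u)) ∧
    (∀ u, γ (u + T) = γ u + deck m n) ∧
    C = range (fun u => toTorus (γ u))

/-- `h` is a (germ at `0` of a) Poincaré return map of the minimal principal foliation along the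
closed principal line `C`. The family `H x`, `|x| < δ`, is a smooth family of principal lines
`u ↦ H (x, u)`, `0 ≤ u ≤ T`, which for `x = 0` runs along `C` and closes up; the arc
`x ↦ H (x, 0)` is transversal to `C`, and the line that leaves this arc at the parameter `x`
returns to it, on the torus, at the parameter `h x`. -/
def IsReturnMap (α : ℝ × ℝ → E3) (C : Set (Real.Angle × Real.Angle)) (h : ℝ → ℝ) : Prop :=
  h 0 = 0 ∧ ContDiffAt ℝ ∞ h 0 ∧
  ∃ (H : ℝ × ℝ → ℝ × ℝ) (δ T : ℝ) (m n : ℤ), 0 < δ ∧ 0 < T ∧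
    ContDiffOn ℝ ∞ H (Ioo (-δ) δ ×ˢ univ) ∧
    (∀ x ∈ Ioo (-δ) δ, ∀ u ∈ Icc 0 T,
      IsMinimalDirection α (H (x, u)) (deriv (fun w => H (x, w)) u)) ∧
    C = (fun u => toTorus (H (0, u))) '' Icc 0 T ∧
    LinearIndependent ℝ ![deriv (fun x => H (x, 0)) 0, deriv (fun u => H (0, u)) 0] ∧
    ∀ᶠ x in 𝓝 (0 : ℝ), H (x, T) = H (h x, 0) + deck m n

/-- A hyperbolic (simple) principal cycle: the return map has derivative different from `1`. -/
def IsHyperbolicPrincipalCycle (α : ℝ × ℝ → E3) (C : Set (Real.Angle × Real.Angle)) : Prop :=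
  IsPrincipalCycle α C ∧ ∃ h, IsReturnMap α C h ∧ deriv h 0 ≠ 1

/-- A double (semi-stable) principal cycle: the fixed point of the return map is of
multiplicity two, that is `h' = 1` and `h'' ≠ 0` there. -/
def IsDoublePrincipalCycle (α : ℝ × ℝ → E3) (C : Set (Real.Angle × Real.Angle)) : Prop :=
  IsPrincipalCycle α C ∧ ∃ h, IsReturnMap α C h ∧ deriv h 0 = 1 ∧ deriv (deriv h) 0 ≠ 0

/-! ### The three parameter family -/

/-- The curvature `κ` of the ellipse `(2 cos t, sin t, 0)`. -/
def ellipseCurvature (t : ℝ) : ℝ := 2 / (4 - 3 * Real.cos t ^ 2) ^ (3 / 2 : ℝ)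

/-- The derivative `κ̇` of `κ`. -/
def ellipseCurvatureDot (t : ℝ) : ℝ :=
  -18 * Real.cos t * Real.sin t / (4 - 3 * Real.cos t ^ 2) ^ (5 / 2 : ℝ)

theorem hasDerivAt_ellipseCurvature (t : ℝ) :
    HasDerivAt ellipseCurvature (ellipseCurvatureDot t) t := by
  have hq : 0 < 4 - 3 * Real.cos t ^ 2 := by nlinarith [Real.cos_sq_le_one t]
  have h1 : HasDerivAt (fun t => 4 - 3 * Real.cos t ^ 2) (6 * Real.cos t * Real.sin t) t := by
    refine ((((Real.hasDerivAt_cos t).pow 2).const_mul 3).const_sub 4).congr_deriv ?_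
    norm_num
    ring
  have h2 := (h1.rpow_const (p := -(3 / 2 : ℝ)) (Or.inl hq.ne')).const_mul 2
  have h3 : ellipseCurvature =ᶠ[𝓝 t] fun t => 2 * (4 - 3 * Real.cos t ^ 2) ^ (-(3 / 2 : ℝ)) := by
    refine Eventually.of_forall fun x => ?_
    have hx : 0 < 4 - 3 * Real.cos x ^ 2 := by nlinarith [Real.cos_sq_le_one x]
    simp only [ellipseCurvature, Real.rpow_neg hx.le, div_eq_mul_inv]
  refine (h2.congr_of_eventuallyEq h3).congr_deriv ?_
  have h4 : (-(3 / 2 : ℝ) - 1) = -(5 / 2) := by norm_num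
  rw [ellipseCurvatureDot, h4, Real.rpow_neg hq.le, div_eq_mul_inv]
  ring

/-- The curve `c_ε(t) = (2 cos t, sin t, ε κ̇(t))`. -/
def centerCurve (ε : ℝ) (t : ℝ) : E3 :=
  !₂[2 * Real.cos t, Real.sin t, ε * ellipseCurvatureDot t]

/-- The radial function `r(t, μ) = ρ + μ κ̇(t)`. -/
def radius (ρ μ : ℝ) (t : ℝ) : ℝ := ρ + μ * ellipseCurvatureDot t

/-- The canal surface `S_{ε,ρ,μ}`. -/
def surface (ε ρ μ : ℝ) : ℝ × ℝ → E3 := canalSurface (centerCurve ε) (radius ρ μ)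

end Canal

end

namespace Canal

/-! ### Scalar linear equations and periodicity -/

/-! Geometry. Write a canal surface as center plus `r` times the unit vector `sphereNormal`. In the
tangent frame (meridian, characteristic circle) the equation of Rodrigues decouples: the circles
carry the curvature `1/r`, and the other curvature is strictly smaller. Hence the minimal lines are
the graphs of solutions of `φ' = A + B sin φ` with `A = -ṡτ`, `B = ṡ k cot θ`
(`IsRegularCanal.hasMinimalFoliation`). Neither coefficient involves `ρ`; smallness of `ρ` only
keeps the surface regular (`exists_isRegularCanal`).

Dynamics. With `φ = 2 arg y` this equation is the projection of a trace-free linear system in the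
plane, so its return map is a Möbius map coming from a monodromy matrix in `SL₂(ℝ)`. Once one closed
solution is known, everything is explicit. Take as coordinate `x` the tangent of half the angle to
it, at `t = 0`; with `I = logDer` and `J = quadTerm` evaluated at `2π`, the return map is `x ↦
exp(I) x / (1 + J x)`. If `I ≠ 0` there is exactly one further cycle, with inverse multiplier, and
both are hyperbolic (`IsClosedSolution.two_hyperbolic_cycles`). If `I = 0` and `J ≠ 0` the cycle is
unique and double (`IsClosedSolution.one_double_cycle`). Cycles that wind several times around the
torus are covered too.

Perturbation. Put `ε = ημ`. Then `A = μ a`, `B = μ b` with `a`, `b` smooth in `(μ, η, t)`, and the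
monodromy is `1 + μ Q` with `Q` smooth in `(μ, η)` (`exists_monodromy`). Determinant one gives `tr Q
= -μ det Q`, so the sign of `det Q` decides: negative means two hyperbolic cycles, zero with `Q ≠ 0`
means one double cycle (`exists_isClosedSolution_of_det_nonpos`). At `μ = 0`, `-det Q = ((∫b)² -
(∫a)²)/4`. Integration by parts and the identity `σ̈ + σ = 2κ` for the speed `σ` of the ellipse give
`∫b = K` and `∫a = ηK` with `K = ∫κ̇² > 0`. Thus `-det Q = K²(1 - η²)/4` has simple zeros at `η =
±1`. By the implicit function theorem they continue to `η = -e₁(μ)` and `η = e₂(μ)` with `e₁(0) =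
e₂(0) = 1` (`exists_smooth_root`), and `ε₁ = -μe₁`, `ε₂ = μe₂`. -/

theorem hasDerivAt_primitive {f : ℝ → ℝ} (hf : Continuous f) (a t : ℝ) :
    HasDerivAt (fun t => ∫ s in a..t, f s) (f t) t :=
  intervalIntegral.integral_hasDerivAt_right (hf.intervalIntegrable _ _)
    hf.stronglyMeasurable.stronglyMeasurableAtFilter hf.continuousAt

theorem eq_of_hasDerivAt_eq {f g f' : ℝ → ℝ} (hf : ∀ t, HasDerivAt f (f' t) t)
    (hg : ∀ t, HasDerivAt g (f' t) t) (a : ℝ) (h : f a = g a) : f = g := by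
  have h0 : ∀ t, HasDerivAt (fun t => f t - g t) 0 t := fun t =>
    ((hf t).sub (hg t)).congr_deriv (sub_self _)
  funext t
  have := is_const_of_deriv_eq_zero (fun t => (h0 t).differentiableAt) (fun t => (h0 t).deriv) t a
  linarith

/-- The integrating factor `exp(-∫g)` makes `w` constant. -/
theorem eq_zero_of_hasDerivAt_mul_self {w g : ℝ → ℝ} (hg : Continuous g)
    (hw : ∀ u, HasDerivAt w (g u * w u) u) {a : ℝ} (ha : w a = 0) (u : ℝ) : w u = 0 := by
  have h0 : ∀ u, HasDerivAt (fun u => w u * Real.exp (-∫ s in a..u, g s)) 0 u := fun u =>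
    ((hw u).mul (hasDerivAt_primitive hg a u).neg.exp).congr_deriv (by ring)
  have h1 := eq_of_hasDerivAt_eq h0 (g := fun _ => (0 : ℝ)) (fun t => hasDerivAt_const t 0) a
    (by simp [ha])
  have h2 := congrFun h1 u
  simpa [Real.exp_ne_zero] using h2

/-- Two solutions of one scalar linear equation are proportional. -/
theorem mul_eq_mul_of_hasDerivAt_mul_self {X Y g : ℝ → ℝ} (hg : Continuous g)
    (hX : ∀ u, HasDerivAt X (g u * X u) u) (hY : ∀ u, HasDerivAt Y (g u * Y u) u) (a u : ℝ) :
    X u * Y a = X a * Y u := by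
  have := eq_zero_of_hasDerivAt_mul_self hg (w := fun u => X u * Y a - X a * Y u) (a := a)
    (fun u => (((hX u).mul_const (Y a)).sub ((hY u).const_mul (X a))).congr_deriv (by ring))
    (by ring) u
  linarith

/-- Bootstrap for differential equations: each order of smoothness of `f` passes to `f'` and raises
that of `f` by one. -/
theorem contDiff_infty_of_hasDerivAt {f f' : ℝ → ℝ} (hf : ∀ t, HasDerivAt f (f' t) t)
    (hf' : ∀ n : ℕ, ContDiff ℝ n f → ContDiff ℝ n f') : ContDiff ℝ ∞ f := by
  have hd : deriv f = f' := funext fun t => (hf t).deriv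
  have hdiff : Differentiable ℝ f := fun t => (hf t).differentiableAt
  refine contDiff_infty.2 fun n => ?_
  induction n with
  | zero => exact contDiff_zero.2 hdiff.continuous
  | succ n ih =>
    push_cast
    refine contDiff_succ_iff_deriv.2 ⟨hdiff, by simp, ?_⟩
    rw [hd]
    exact hf' n ih

theorem contDiff_primitive {f : ℝ → ℝ} (hf : ContDiff ℝ ∞ f) (a : ℝ) :
    ContDiff ℝ ∞ fun t => ∫ s in a..t, f s :=
  contDiff_infty_of_hasDerivAt (hasDerivAt_primitive hf.continuous a)
    fun n _ => hf.of_le (by exact_mod_cast le_top)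

theorem primitive_add_period {f : ℝ → ℝ} (hf : Continuous f)
    (hp : ∀ t, f (t + 2 * Real.pi) = f t) (t : ℝ) :
    ∫ s in (0 : ℝ)..(t + 2 * Real.pi), f s
      = (∫ s in (0 : ℝ)..t, f s) + ∫ s in (0 : ℝ)..(2 * Real.pi), f s := by
  have h := eq_of_hasDerivAt_eq (f := fun t => ∫ s in (0 : ℝ)..(t + 2 * Real.pi), f s)
    (g := fun t => (∫ s in (0 : ℝ)..t, f s) + ∫ s in (0 : ℝ)..(2 * Real.pi), f s) (f' := f)
    (fun t => by
      have := (hasDerivAt_primitive hf 0 (t + 2 * Real.pi)).comp_add_const t (2 * Real.pi)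
      rwa [hp] at this)
    (fun t => (hasDerivAt_primitive hf 0 t).add_const _) 0 (by simp)
  exact congrFun h t

theorem add_int_mul_period {f : ℝ → ℝ} {c : ℝ} {p : ℝ}
    (h : ∀ t, f (t + p) = f t + c) (m : ℤ) (t : ℝ) : f (t + p * m) = f t + c * m := by
  induction m using Int.induction_on with
  | zero => simp
  | succ i ih =>
    have := h (t + p * i)
    push_cast at *
    rw [show t + p * (i + 1) = t + p * i + p by ring, this, ih]; ring
  | pred i ih =>
    have := h (t + p * (-(i:ℝ) - 1))
    push_cast at *
    rw [show t + p * (-(i:ℝ) - 1) + p = t + p * -(i:ℝ) by ring, ih] at this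
    linarith

/-! ### The equation `φ' = A + B sin φ` on the torus -/

/-- A solution of `φ' = A + B sin φ` that closes up after one turn in `t`. -/
structure IsClosedSolution (A B φ : ℝ → ℝ) : Prop where
  smooth : ContDiff ℝ ∞ φ
  hasDerivAt : ∀ t, HasDerivAt φ (A t + B t * Real.sin (φ t)) t
  periodic : ∃ k : ℤ, ∀ t, φ (t + 2 * Real.pi) = φ t + 2 * Real.pi * k

/-- The leaf of a closed solution on the torus. -/
def leaf (φ : ℝ → ℝ) : Set (Real.Angle × Real.Angle) := range fun t => toTorus (t, φ t)

/-- The minimal principal foliation of `α` is the foliation of `φ' = A + B sin φ`. -/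
def HasMinimalFoliation (α : ℝ × ℝ → E3) (A B : ℝ → ℝ) : Prop :=
  ∀ p v, IsMinimalDirection α p v ↔
    v.1 ≠ 0 ∧ v.2 = (A p.1 + B p.1 * Real.sin p.2) * v.1

/-- The logarithm of the linearized flow along `φ`. -/
noncomputable def logDer (B φ : ℝ → ℝ) (t : ℝ) : ℝ :=
  ∫ s in (0 : ℝ)..t, B s * Real.cos (φ s)

/-- The quadratic term of the flow along `φ`. -/
noncomputable def quadTerm (B φ : ℝ → ℝ) (t : ℝ) : ℝ :=
  ∫ s in (0 : ℝ)..t, Real.exp (logDer B φ s) * (B s * Real.sin (φ s))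

section

variable {α : ℝ × ℝ → E3} {A B φ : ℝ → ℝ}

theorem IsClosedSolution.sin_periodic (h : IsClosedSolution A B φ) (t : ℝ) :
    Real.sin (φ (t + 2 * Real.pi)) = Real.sin (φ t) := by
  obtain ⟨k, hk⟩ := h.periodic
  rw [hk, mul_comm]; exact Real.sin_add_int_mul_two_pi _ _

theorem IsClosedSolution.cos_periodic (h : IsClosedSolution A B φ) (t : ℝ) :
    Real.cos (φ (t + 2 * Real.pi)) = Real.cos (φ t) := by
  obtain ⟨k, hk⟩ := h.periodic
  rw [hk, mul_comm]; exact Real.cos_add_int_mul_two_pi _ _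

theorem IsClosedSolution.contDiff_logDer (h : IsClosedSolution A B φ) (hB : ContDiff ℝ ∞ B) :
    ContDiff ℝ ∞ (logDer B φ) :=
  contDiff_primitive (hB.mul (Real.contDiff_cos.comp h.smooth)) 0

theorem IsClosedSolution.hasDerivAt_logDer (h : IsClosedSolution A B φ) (hB : ContDiff ℝ ∞ B)
    (t : ℝ) : HasDerivAt (logDer B φ) (B t * Real.cos (φ t)) t :=
  hasDerivAt_primitive (hB.mul (Real.contDiff_cos.comp h.smooth)).continuous 0 t

theorem IsClosedSolution.contDiff_quadTerm (h : IsClosedSolution A B φ) (hB : ContDiff ℝ ∞ B) :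
    ContDiff ℝ ∞ (quadTerm B φ) :=
  contDiff_primitive ((h.contDiff_logDer hB).exp.mul (hB.mul (Real.contDiff_sin.comp h.smooth))) 0

theorem IsClosedSolution.hasDerivAt_quadTerm (h : IsClosedSolution A B φ) (hB : ContDiff ℝ ∞ B)
    (t : ℝ) :
    HasDerivAt (quadTerm B φ) (Real.exp (logDer B φ t) * (B t * Real.sin (φ t))) t :=
  hasDerivAt_primitive ((h.contDiff_logDer hB).exp.mul
    (hB.mul (Real.contDiff_sin.comp h.smooth))).continuous 0 t

theorem logDer_zero : logDer B φ 0 = 0 := intervalIntegral.integral_same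

theorem quadTerm_zero : quadTerm B φ 0 = 0 := intervalIntegral.integral_same

theorem IsClosedSolution.logDer_add (h : IsClosedSolution A B φ) (hB : ContDiff ℝ ∞ B)
    (hBp : ∀ t, B (t + 2 * Real.pi) = B t) (t : ℝ) :
    logDer B φ (t + 2 * Real.pi) = logDer B φ t + logDer B φ (2 * Real.pi) :=
  primitive_add_period (hB.mul (Real.contDiff_cos.comp h.smooth)).continuous
    (fun t => by simp only [hBp, Function.comp_apply, h.cos_periodic]) t

/-- Cocycle rule: over each further turn the integrand of `quadTerm` is multiplied by the multiplier
`exp I` of one turn. -/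
theorem IsClosedSolution.quadTerm_add (h : IsClosedSolution A B φ) (hB : ContDiff ℝ ∞ B)
    (hBp : ∀ t, B (t + 2 * Real.pi) = B t) (t : ℝ) :
    quadTerm B φ (t + 2 * Real.pi)
      = quadTerm B φ (2 * Real.pi) + Real.exp (logDer B φ (2 * Real.pi)) * quadTerm B φ t := by
  refine congrFun (eq_of_hasDerivAt_eq
    (fun t => (h.hasDerivAt_quadTerm hB (t + 2 * Real.pi)).comp_add_const t _)
    (fun t => (((h.hasDerivAt_quadTerm hB t).const_mul _).const_add _).congr_deriv ?_) 0
    (by simp [quadTerm_zero])) t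
  rw [hBp, h.sin_periodic, h.logDer_add hB hBp, Real.exp_add]; ring

theorem IsClosedSolution.isPrincipalCycle (h : IsClosedSolution A B φ)
    (hα : HasMinimalFoliation α A B) : IsPrincipalCycle α (leaf φ) := by
  obtain ⟨k, hk⟩ := h.periodic
  refine ⟨fun t => (t, φ t), 2 * Real.pi, 1, k, Real.two_pi_pos, contDiff_id.prodMk h.smooth,
    fun u => ?_, fun u => ?_, rfl⟩
  · have : HasDerivAt (fun t => (t, φ t)) (1, A u + B u * Real.sin (φ u)) u :=
      (hasDerivAt_id u).prodMk (h.hasDerivAt u)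
    rw [this.deriv, hα]
    simp
  · simp [deck, hk]

theorem toTorus_eq_of_sin_half_eq_zero {x y z : ℝ} (h : Real.sin ((y - z) / 2) = 0) :
    toTorus (x, y) = toTorus (x, z) := by
  obtain ⟨n, hn⟩ := Real.sin_eq_zero_iff.1 h
  simp only [toTorus, Prod.mk.injEq, true_and]
  refine Real.Angle.angle_eq_iff_two_pi_dvd_sub.2 ⟨n, by linarith⟩

theorem toTorus_add_deck (p : ℝ × ℝ) (m n : ℤ) : toTorus (p + deck m n) = toTorus p := by
  simp only [toTorus, deck, Prod.fst_add, Prod.snd_add, Prod.mk.injEq]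
  exact ⟨Real.Angle.angle_eq_iff_two_pi_dvd_sub.2 ⟨m, by ring⟩,
    Real.Angle.angle_eq_iff_two_pi_dvd_sub.2 ⟨n, by ring⟩⟩

/-- The data of a principal cycle, spelled out in coordinates. -/
theorem IsPrincipalCycle.exists_coordinates {C} (hC : IsPrincipalCycle α C)
    (hα : HasMinimalFoliation α A B) : ∃ (x y x' : ℝ → ℝ) (T : ℝ) (m n : ℤ),
      Continuous x' ∧ (∀ u, HasDerivAt x (x' u) u) ∧
      (∀ u, HasDerivAt y ((A (x u) + B (x u) * Real.sin (y u)) * x' u) u) ∧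
      (∀ u, x (u + T) = x u + 2 * Real.pi * m) ∧ (∀ u, y (u + T) = y u + 2 * Real.pi * n) ∧
      m ≠ 0 ∧ Function.Surjective x ∧ C = range fun u => toTorus (x u, y u) := by
  obtain ⟨γ, T, m, n, hT, hγ, hmin, hper, rfl⟩ := hC
  have hγd : ∀ u, HasDerivAt γ (deriv γ u) u := fun u =>
    (hγ.differentiable (by simp)).differentiableAt.hasDerivAt
  have hx : ∀ u, HasDerivAt (fun u => (γ u).1) (deriv γ u).1 u := fun u =>
    (ContinuousLinearMap.fst ℝ ℝ ℝ).hasFDerivAt.comp_hasDerivAt u (hγd u)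
  have hy : ∀ u, HasDerivAt (fun u => (γ u).2) (deriv γ u).2 u := fun u =>
    (ContinuousLinearMap.snd ℝ ℝ ℝ).hasFDerivAt.comp_hasDerivAt u (hγd u)
  have hxper : ∀ u, (γ (u + T)).1 = (γ u).1 + 2 * Real.pi * m := fun u => by rw [hper]; rfl
  -- By Rolle, a cycle with `m = 0` would be tangent to a circle `t = const` somewhere, and a
  -- minimal direction never is.
  have hm : m ≠ 0 := by
    rintro rfl
    have h1 := hxper 0
    obtain ⟨c, -, hc⟩ := exists_deriv_eq_zero (f := fun u => (γ u).1) hT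
      (fun u _ => (hx u).continuousAt.continuousWithinAt) (by simpa using h1.symm)
    rw [(hx c).deriv] at hc
    exact ((hα _ _).1 (hmin c)).1 hc
  refine ⟨fun u => (γ u).1, fun u => (γ u).2, fun u => (deriv γ u).1, T, m, n,
    continuous_fst.comp (hγ.continuous_deriv (by simp)), hx, fun u => ?_, hxper,
    fun u => by simp only [hper]; rfl, hm, ?_, rfl⟩
  · exact (hy u).congr_deriv ((hα _ _).1 (hmin u)).2
  · have hxc : Continuous fun u => (γ u).1 :=
      continuous_iff_continuousAt.2 fun u => (hx u).continuousAt
    intro t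
    have hz := add_int_mul_period (f := fun u => (γ u).1) hxper
    have hunb : ∀ t : ℝ, ∃ u, (γ u).1 ≤ t := fun t => by
      obtain ⟨j, hj⟩ := exists_int_lt ((t - (γ 0).1) / (2 * Real.pi))
      have hj' : 2 * Real.pi * j ≤ t - (γ 0).1 := by
        rw [lt_div_iff₀ Real.two_pi_pos] at hj; linarith
      -- Taking `i = -m|j|` makes `m i = -m²|j|`, which works for either sign of `m`.
      have key : ∃ i : ℤ, (m : ℝ) * i ≤ j := by
        refine ⟨-(m * |j|), ?_⟩
        have h1 : (1 : ℤ) ≤ m * m := by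
          have := mul_self_pos.2 hm
          omega
        have h2 : m * -(m * |j|) ≤ j := by nlinarith [neg_abs_le j, abs_nonneg j]
        exact_mod_cast h2
      obtain ⟨i, hi⟩ := key
      refine ⟨0 + T * i, ?_⟩
      rw [hz]
      nlinarith [Real.two_pi_pos]
    have hunb' : ∀ t : ℝ, ∃ u, t ≤ (γ u).1 := fun t => by
      obtain ⟨j, hj⟩ := exists_int_gt ((t - (γ 0).1) / (2 * Real.pi))
      have hj' : t - (γ 0).1 ≤ 2 * Real.pi * j := by
        rw [div_lt_iff₀ Real.two_pi_pos] at hj; linarith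
      have key : ∃ i : ℤ, (j : ℝ) ≤ m * i := by
        refine ⟨m * |j|, ?_⟩
        have h1 : (1 : ℤ) ≤ m * m := by
          have := mul_self_pos.2 hm
          omega
        have h2 : j ≤ m * (m * |j|) := by nlinarith [le_abs_self j, abs_nonneg j]
        exact_mod_cast h2
      obtain ⟨i, hi⟩ := key
      refine ⟨0 + T * i, ?_⟩
      rw [hz]
      nlinarith [Real.two_pi_pos]
    obtain ⟨a, ha⟩ := hunb t
    obtain ⟨b, hb⟩ := hunb' t
    exact mem_range_of_exists_le_of_exists_ge hxc ⟨a, ha⟩ ⟨b, hb⟩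

/-- The two lifts then differ by multiples of `2π`, and surjectivity of `x` ensures that the whole
leaf is run through. -/
theorem eq_leaf_of_sin_half_eq_zero {x y : ℝ → ℝ} (hx : Function.Surjective x)
    (h : ∀ u, Real.sin ((y u - φ (x u)) / 2) = 0) :
    (range fun u => toTorus (x u, y u)) = leaf φ := by
  have h1 : (fun u => toTorus (x u, y u)) = (fun t => toTorus (t, φ t)) ∘ x :=
    funext fun u => toTorus_eq_of_sin_half_eq_zero (h u)
  rw [h1, hx.range_comp, leaf]

/-- Half the angle between a principal line and a closed one, and the linear equation it obeys. -/
theorem IsClosedSolution.hasDerivAt_half_sub (h : IsClosedSolution A B φ) {x y x' : ℝ → ℝ}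
    (hx : ∀ u, HasDerivAt x (x' u) u)
    (hy : ∀ u, HasDerivAt y ((A (x u) + B (x u) * Real.sin (y u)) * x' u) u) (u : ℝ) :
    HasDerivAt (fun u => (y u - φ (x u)) / 2)
      (x' u * B (x u) * Real.cos (φ (x u) + (y u - φ (x u)) / 2)
        * Real.sin ((y u - φ (x u)) / 2)) u := by
  refine (((hy u).sub ((h.hasDerivAt (x u)).comp u (hx u))).div_const 2).congr_deriv ?_
  have : Real.sin (y u) - Real.sin (φ (x u)) = 2 * Real.sin ((y u - φ (x u)) / 2) *
      Real.cos (φ (x u) + (y u - φ (x u)) / 2) := by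
    rw [Real.sin_sub_sin]; congr 2; ring
  linear_combination (x' u * B (x u) / 2) * this

end

/-! ### Counting the principal cycles with a projective first integral -/

section

variable {α : ℝ × ℝ → E3} {A B φ : ℝ → ℝ}

/-- The projective coordinate of a principal line relative to a closed one is constant. -/
theorem IsClosedSolution.mul_sin_half_eq (h : IsClosedSolution A B φ) (hB : ContDiff ℝ ∞ B)
    {x y x' : ℝ → ℝ} (hx' : Continuous x') (hx : ∀ u, HasDerivAt x (x' u) u)
    (hy : ∀ u, HasDerivAt y ((A (x u) + B (x u) * Real.sin (y u)) * x' u) u) {d : ℝ → ℝ}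
    (hd : d = fun u => (y u - φ (x u)) / 2) (a u : ℝ) :
    (Real.exp (logDer B φ (x u)) * Real.cos (d u) - quadTerm B φ (x u) * Real.sin (d u))
        * Real.sin (d a) =
      (Real.exp (logDer B φ (x a)) * Real.cos (d a) - quadTerm B φ (x a) * Real.sin (d a))
        * Real.sin (d u) := by
  have hdd : ∀ u, HasDerivAt d (x' u * B (x u) * Real.cos (φ (x u) + d u) * Real.sin (d u)) u := by
    subst hd; exact h.hasDerivAt_half_sub hx hy
  have hxc : Continuous x := continuous_iff_continuousAt.2 fun u => (hx u).continuousAt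
  have hdc : Continuous d := continuous_iff_continuousAt.2 fun u => (hdd u).continuousAt
  have hBc := hB.continuous
  have hφc := h.smooth.continuous
  -- Numerator `X = exp(I) cos d - J sin d` and denominator `Y = sin d` solve the same scalar linear
  -- equation, so their ratio `exp(I) cot d - J` is conserved. Keeping the two apart allows `sin d =
  -- 0`.
  refine mul_eq_mul_of_hasDerivAt_mul_self
    (X := fun u => Real.exp (logDer B φ (x u)) * Real.cos (d u) -
      quadTerm B φ (x u) * Real.sin (d u)) (Y := fun u => Real.sin (d u))
    (g := fun u => x' u * B (x u) * Real.cos (d u) * Real.cos (φ (x u) + d u))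
    (by fun_prop) (fun u => ?_) (fun u => ?_) a u
  · refine ((((h.hasDerivAt_logDer hB (x u)).comp u (hx u)).exp.mul (hdd u).cos).sub
      (((h.hasDerivAt_quadTerm hB (x u)).comp u (hx u)).mul (hdd u).sin)).congr_deriv ?_
    simp only [Function.comp_apply]
    rw [Real.cos_add]
    linear_combination (-Real.exp (logDer B φ (x u)) * x' u * B (x u) * (Real.cos (φ (x u)) *
      Real.cos (d u) - Real.sin (φ (x u)) * Real.sin (d u))) * Real.sin_sq_add_cos_sq (d u)
  · exact (hdd u).sin.congr_deriv (by ring)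

/-- The half angle changes by a multiple of `π`, possibly odd. Then sine and cosine change sign
together, which does not affect the conserved ratio. -/
theorem IsClosedSolution.half_sub_add (h : IsClosedSolution A B φ) {x y : ℝ → ℝ} {T : ℝ} {m n : ℤ}
    (hxT : ∀ u, x (u + T) = x u + 2 * Real.pi * m) (hyT : ∀ u, y (u + T) = y u + 2 * Real.pi * n)
    (u : ℝ) : ∃ j : ℤ, (y (u + T) - φ (x (u + T))) / 2 = (y u - φ (x u)) / 2 + j * Real.pi := by
  obtain ⟨k, hk⟩ := h.periodic
  refine ⟨n - k * m, ?_⟩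
  rw [hxT, hyT, add_int_mul_period hk]
  push_cast; ring

/-- The cotangent of half the angle between the second closed solution and the first one. -/
noncomputable def secondCot (B φ : ℝ → ℝ) (t : ℝ) : ℝ :=
  Real.exp (-logDer B φ t) * (quadTerm B φ (2 * Real.pi) /
    (Real.exp (logDer B φ (2 * Real.pi)) - 1) + quadTerm B φ t)

/-- The first integral `exp(I) cot d - J` is given the value `C = J(2π)/(exp I(2π) - 1)`.
Periodicity of `cot d` amounts to `C + J(2π) = exp(I(2π)) C`, which has this one solution. -/
theorem IsClosedSolution.secondCot_add (h : IsClosedSolution A B φ) (hB : ContDiff ℝ ∞ B)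
    (hBp : ∀ t, B (t + 2 * Real.pi) = B t) (h1 : logDer B φ (2 * Real.pi) ≠ 0) (t : ℝ) :
    secondCot B φ (t + 2 * Real.pi) = secondCot B φ t := by
  have h2 : Real.exp (logDer B φ (2 * Real.pi)) - 1 ≠ 0 := fun h0 =>
    h1 (Real.exp_eq_one_iff _ |>.1 (by linarith))
  rw [secondCot, secondCot, h.logDer_add hB hBp, h.quadTerm_add hB hBp, neg_add, Real.exp_add,
    Real.exp_neg (logDer B φ (2 * Real.pi))]
  have := Real.exp_ne_zero (logDer B φ (2 * Real.pi))
  field_simp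
  ring

theorem IsClosedSolution.contDiff_secondCot (h : IsClosedSolution A B φ) (hB : ContDiff ℝ ∞ B) :
    ContDiff ℝ ∞ (secondCot B φ) :=
  (h.contDiff_logDer hB).neg.exp.mul (contDiff_const.add (h.contDiff_quadTerm hB))

theorem IsClosedSolution.hasDerivAt_secondCot (h : IsClosedSolution A B φ) (hB : ContDiff ℝ ∞ B)
    (t : ℝ) : HasDerivAt (secondCot B φ)
      (B t * (Real.sin (φ t) - Real.cos (φ t) * secondCot B φ t)) t := by
  refine ((h.hasDerivAt_logDer hB t).neg.exp.mul
    ((h.hasDerivAt_quadTerm hB t).const_add _)).congr_deriv ?_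
  have : Real.exp (-logDer B φ t) * Real.exp (logDer B φ t) = 1 := by
    rw [← Real.exp_add]; simp
  rw [secondCot]
  simp only [Pi.neg_apply]
  linear_combination (B t * Real.sin (φ t)) * this

/-- The second closed solution. -/
noncomputable def secondSolution (B φ : ℝ → ℝ) (t : ℝ) : ℝ :=
  φ t + Real.pi - 2 * Real.arctan (secondCot B φ t)

theorem cos_two_mul_arctan (v : ℝ) : Real.cos (2 * Real.arctan v) = (1 - v ^ 2) / (1 + v ^ 2) := by
  rw [Real.cos_two_mul, Real.cos_sq_arctan]
  have : 1 + v ^ 2 ≠ 0 := by positivity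
  field_simp; ring

theorem sin_two_mul_arctan (v : ℝ) : Real.sin (2 * Real.arctan v) = 2 * v / (1 + v ^ 2) := by
  rw [Real.sin_two_mul, ← Real.tan_mul_cos (Real.cos_arctan_pos v).ne', Real.tan_arctan]
  rw [show 2 * (v * Real.cos (Real.arctan v)) * Real.cos (Real.arctan v)
    = 2 * v * Real.cos (Real.arctan v) ^ 2 by ring, Real.cos_sq_arctan]
  ring

theorem sin_secondSolution (t : ℝ) : Real.sin (secondSolution B φ t) =
    -(Real.sin (φ t) * (1 - secondCot B φ t ^ 2) - 2 * Real.cos (φ t) * secondCot B φ t) /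
      (1 + secondCot B φ t ^ 2) := by
  rw [secondSolution, show ∀ a b : ℝ, a + Real.pi - b = a - b + Real.pi from fun a b => by ring,
    Real.sin_add_pi, Real.sin_sub, cos_two_mul_arctan, sin_two_mul_arctan]
  ring

theorem cos_secondSolution (t : ℝ) : Real.cos (secondSolution B φ t) =
    -(Real.cos (φ t) * (1 - secondCot B φ t ^ 2) + 2 * Real.sin (φ t) * secondCot B φ t) /
      (1 + secondCot B φ t ^ 2) := by
  rw [secondSolution, show ∀ a b : ℝ, a + Real.pi - b = a - b + Real.pi from fun a b => by ring,
    Real.cos_add_pi, Real.cos_sub, cos_two_mul_arctan, sin_two_mul_arctan]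
  ring

theorem IsClosedSolution.secondSolution (h : IsClosedSolution A B φ) (hB : ContDiff ℝ ∞ B)
    (hBp : ∀ t, B (t + 2 * Real.pi) = B t) (h1 : logDer B φ (2 * Real.pi) ≠ 0) :
    IsClosedSolution A B (secondSolution B φ) where
  smooth := (h.smooth.add contDiff_const).sub
    (contDiff_const.mul (Real.contDiff_arctan.comp (h.contDiff_secondCot hB)))
  hasDerivAt t := by
    refine (((h.hasDerivAt t).add_const _).sub
      ((h.hasDerivAt_secondCot hB t).arctan.const_mul 2)).congr_deriv ?_
    rw [sin_secondSolution]
    have : 1 + Canal.secondCot B φ t ^ 2 ≠ 0 := by positivity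
    field_simp
    ring
  periodic := by
    obtain ⟨k, hk⟩ := h.periodic
    refine ⟨k, fun t => ?_⟩
    rw [Canal.secondSolution, Canal.secondSolution, hk, h.secondCot_add hB hBp h1]
    ring

/-- The multipliers of a Möbius map at its two fixed points are inverse to each other. Concretely,
the sum of the two logarithms differs by a constant from `-log(1 + v²)`, where the cotangent `v =
secondCot` is periodic. -/
theorem IsClosedSolution.logDer_secondSolution (h : IsClosedSolution A B φ) (hB : ContDiff ℝ ∞ B)
    (hBp : ∀ t, B (t + 2 * Real.pi) = B t) (h1 : logDer B φ (2 * Real.pi) ≠ 0) :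
    logDer B (Canal.secondSolution B φ) (2 * Real.pi) = -logDer B φ (2 * Real.pi) := by
  have h2 := h.secondSolution hB hBp h1
  have hpos : ∀ t, 1 + secondCot B φ t ^ 2 ≠ 0 := fun t => by positivity
  have key := congrFun (eq_of_hasDerivAt_eq
    (f := fun t => logDer B (Canal.secondSolution B φ) t)
    (g := fun t => -logDer B φ t - Real.log (1 + secondCot B φ t ^ 2)
      + Real.log (1 + secondCot B φ 0 ^ 2))
    (fun t => h2.hasDerivAt_logDer hB t)
    (fun t => (((h.hasDerivAt_logDer hB t).neg.sub
      ((((h.hasDerivAt_secondCot hB t).pow 2).const_add 1).log (hpos t))).add_const _).congr_deriv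
        (by
          rw [cos_secondSolution]
          have := hpos t
          simp only [Pi.pow_apply]
          field_simp
          push_cast
          ring)) 0 (by simp [logDer_zero])) (2 * Real.pi)
  have h3 := h.secondCot_add hB hBp h1 0
  rw [zero_add] at h3
  simp only [h3] at key
  linarith

/-- The angle `π - 2 arctan v` between the two solutions lies strictly between `0` and `2π`, so it
is no multiple of `2π`. -/
theorem IsClosedSolution.leaf_secondSolution_ne (h : IsClosedSolution A B φ) :
    leaf φ ≠ leaf (Canal.secondSolution B φ) := by
  intro heq
  obtain ⟨k, hk⟩ := h.periodic
  have h0 : toTorus (0, Canal.secondSolution B φ 0) ∈ leaf φ := by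
    rw [heq]; exact ⟨0, rfl⟩
  obtain ⟨t, ht⟩ := h0
  simp only [toTorus, Prod.mk.injEq] at ht
  obtain ⟨j, hj⟩ := Real.Angle.angle_eq_iff_two_pi_dvd_sub.1 ht.1
  obtain ⟨i, hi⟩ := Real.Angle.angle_eq_iff_two_pi_dvd_sub.1 ht.2
  rw [sub_zero] at hj
  have h1 := add_int_mul_period hk j 0
  rw [zero_add, ← hj] at h1
  rw [h1, Canal.secondSolution] at hi
  have h2 := Real.neg_pi_div_two_lt_arctan (secondCot B φ 0)
  have h3 := Real.arctan_lt_pi_div_two (secondCot B φ 0)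
  have hpi := Real.pi_pos
  have h4 : 2 * Real.pi * ((k * j - i : ℤ) : ℝ) =
      Real.pi - 2 * Real.arctan (secondCot B φ 0) := by push_cast; linarith
  have h5 : (0 : ℝ) < ((k * j - i : ℤ) : ℝ) := by
    by_contra! h; nlinarith
  have h6 : ((k * j - i : ℤ) : ℝ) < 1 := by
    by_contra! h; nlinarith
  norm_cast at h5 h6
  omega

/-- Along a line `exp(I)(cot d - v)` is constant. When a cycle closes after `m` turns, `cot d` and
`v` return, while `exp(I)` is multiplied by `exp(m I(2π)) ≠ 1`. So the constant is `0` or infinite: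
the line is one of the two leaves. -/
theorem IsClosedSolution.eq_or_eq_of_isPrincipalCycle (h : IsClosedSolution A B φ)
    (hα : HasMinimalFoliation α A B) (hB : ContDiff ℝ ∞ B)
    (hBp : ∀ t, B (t + 2 * Real.pi) = B t) (h1 : logDer B φ (2 * Real.pi) ≠ 0) {C}
    (hC : IsPrincipalCycle α C) : C = leaf φ ∨ C = leaf (Canal.secondSolution B φ) := by
  obtain ⟨x, y, x', T, m, n, hx', hx, hy, hxT, hyT, hm, hsurj, rfl⟩ := hC.exists_coordinates hα
  obtain ⟨d, hd⟩ : ∃ d : ℝ → ℝ, d = fun u => (y u - φ (x u)) / 2 := ⟨_, rfl⟩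
  have hX : ∀ a u, (Real.exp (logDer B φ (x u)) * (Real.cos (d u) -
        secondCot B φ (x u) * Real.sin (d u))) * Real.sin (d a) =
      (Real.exp (logDer B φ (x a)) * (Real.cos (d a) -
        secondCot B φ (x a) * Real.sin (d a))) * Real.sin (d u) := fun a u => by
    have h2 : ∀ t, Real.exp (logDer B φ t) * secondCot B φ t = quadTerm B φ (2 * Real.pi) /
      (Real.exp (logDer B φ (2 * Real.pi)) - 1) + quadTerm B φ t := fun t => by
      rw [secondCot, ← mul_assoc, ← Real.exp_add, add_neg_cancel, Real.exp_zero, one_mul]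
    have := h.mul_sin_half_eq hB hx' hx hy hd a u
    linear_combination this - Real.sin (d u) * Real.sin (d a) * h2 (x u)
      + Real.sin (d a) * Real.sin (d u) * h2 (x a)
  obtain ⟨j, hj⟩ := h.half_sub_add hxT hyT 0
  have hdj : d (0 + T) = d 0 + j * Real.pi := by rw [hd]; exact hj
  have hv : secondCot B φ (x (0 + T)) = secondCot B φ (x 0) := by
    rw [hxT, add_int_mul_period (f := secondCot B φ) (p := 2 * Real.pi) (c := 0)
      (fun t => by rw [h.secondCot_add hB hBp h1, add_zero])]
    ring
  have hI : logDer B φ (x (0 + T)) = logDer B φ (x 0) + logDer B φ (2 * Real.pi) * m := by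
    rw [hxT, add_int_mul_period (h.logDer_add hB hBp)]
  have h0 := hX 0 (0 + T)
  rw [hv, hI, hdj, Real.sin_add_int_mul_pi, Real.cos_add_int_mul_pi, Real.exp_add] at h0
  have hs : ((-1 : ℝ) ^ j) ≠ 0 := zpow_ne_zero _ (by norm_num)
  have he : Real.exp (logDer B φ (2 * Real.pi) * m) - 1 ≠ 0 := fun h0 => by
    have := Real.exp_eq_one_iff _ |>.1 (sub_eq_zero.1 h0)
    simp [h1, hm] at this
  have h3 : ((-1 : ℝ) ^ j) * Real.exp (logDer B φ (x 0)) *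
      (Real.exp (logDer B φ (2 * Real.pi) * m) - 1) *
      ((Real.cos (d 0) - secondCot B φ (x 0) * Real.sin (d 0)) * Real.sin (d 0)) = 0 := by
    linear_combination h0
  have h4 : (Real.cos (d 0) - secondCot B φ (x 0) * Real.sin (d 0)) * Real.sin (d 0) = 0 :=
    (mul_eq_zero.1 h3).resolve_left (by positivity)
  by_cases hsin : Real.sin (d 0) = 0
  · left
    refine eq_leaf_of_sin_half_eq_zero hsurj fun u => ?_
    have hu := hX 0 u
    have hc : Real.cos (d 0) ≠ 0 := fun hc => by
      have := Real.sin_sq_add_cos_sq (d 0); simp [hsin, hc] at this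
    rw [hsin, mul_zero, mul_zero, sub_zero] at hu
    have : Real.sin (d u) = 0 := by
      simpa [hc, Real.exp_ne_zero] using hu.symm
    rwa [hd] at this
  · right
    refine eq_leaf_of_sin_half_eq_zero hsurj fun u => ?_
    have hu := hX 0 u
    rw [(mul_eq_zero.1 h4).resolve_right hsin, mul_zero, zero_mul] at hu
    have h5 : Real.cos (d u) - secondCot B φ (x u) * Real.sin (d u) = 0 := by
      simpa [hsin, Real.exp_ne_zero] using hu
    have h6 : (y u - Canal.secondSolution B φ (x u)) / 2
        = d u + Real.arctan (secondCot B φ (x u)) - Real.pi / 2 := by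
      rw [hd, Canal.secondSolution]; ring
    have h7 : Real.sin (Real.arctan (secondCot B φ (x u)))
        = secondCot B φ (x u) * Real.cos (Real.arctan (secondCot B φ (x u))) := by
      conv_rhs => rw [← Real.tan_arctan (secondCot B φ (x u)), Real.arctan_tan
        (Real.neg_pi_div_two_lt_arctan _) (Real.arctan_lt_pi_div_two _)]
      exact (Real.tan_mul_cos (Real.cos_arctan_pos _).ne').symm
    rw [h6, Real.sin_sub_pi_div_two, Real.cos_add, h7]
    linear_combination (-Real.cos (Real.arctan (secondCot B φ (x u)))) * h5

/-- The parabolic case: `exp(I) cot d - J` is constant, but over `m` turns `J` grows by `m J(2π) ≠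
0` while `exp(I)` and `cot d` return. Only `cot d = ∞`, the given leaf, is left. -/
theorem IsClosedSolution.eq_of_isPrincipalCycle (h : IsClosedSolution A B φ)
    (hα : HasMinimalFoliation α A B) (hB : ContDiff ℝ ∞ B)
    (hBp : ∀ t, B (t + 2 * Real.pi) = B t) (h1 : logDer B φ (2 * Real.pi) = 0)
    (h2 : quadTerm B φ (2 * Real.pi) ≠ 0) {C} (hC : IsPrincipalCycle α C) : C = leaf φ := by
  obtain ⟨x, y, x', T, m, n, hx', hx, hy, hxT, hyT, hm, hsurj, rfl⟩ := hC.exists_coordinates hα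
  obtain ⟨d, hd⟩ : ∃ d : ℝ → ℝ, d = fun u => (y u - φ (x u)) / 2 := ⟨_, rfl⟩
  have hX := h.mul_sin_half_eq hB hx' hx hy hd
  obtain ⟨j, hj⟩ := h.half_sub_add hxT hyT 0
  have hdj : d (0 + T) = d 0 + j * Real.pi := by rw [hd]; exact hj
  have hI : logDer B φ (x (0 + T)) = logDer B φ (x 0) := by
    rw [hxT, add_int_mul_period (h.logDer_add hB hBp), h1, zero_mul, add_zero]
  have hJ : quadTerm B φ (x (0 + T)) = quadTerm B φ (x 0) + quadTerm B φ (2 * Real.pi) * m := by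
    rw [hxT, add_int_mul_period (f := quadTerm B φ) (p := 2 * Real.pi)
      (c := quadTerm B φ (2 * Real.pi)) (fun t => by
      rw [h.quadTerm_add hB hBp, h1, Real.exp_zero, one_mul, add_comm])]
  have h0 := hX 0 (0 + T)
  rw [hJ, hI, hdj, Real.sin_add_int_mul_pi, Real.cos_add_int_mul_pi] at h0
  have hs : ((-1 : ℝ) ^ j) ≠ 0 := zpow_ne_zero _ (by norm_num)
  have h3 : ((-1 : ℝ) ^ j) * quadTerm B φ (2 * Real.pi) * m * Real.sin (d 0) ^ 2 = 0 := by
    linear_combination -h0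
  have hsin : Real.sin (d 0) = 0 := by
    have hm' : (m : ℝ) ≠ 0 := by exact_mod_cast hm
    simpa [hs, h2, hm'] using h3
  refine eq_leaf_of_sin_half_eq_zero hsurj fun u => ?_
  have hu := hX 0 u
  have hc : Real.cos (d 0) ≠ 0 := fun hc => by
    have := Real.sin_sq_add_cos_sq (d 0); simp [hsin, hc] at this
  rw [hsin, mul_zero, mul_zero, sub_zero] at hu
  have : Real.sin (d u) = 0 := by
    simpa [hc, Real.exp_ne_zero] using hu.symm
  rwa [hd] at this

end

/-! ### The return map and the type of the cycles -/

section

variable {α : ℝ × ℝ → E3} {A B φ : ℝ → ℝ}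

/-- All solutions of `φ' = A + B sin φ` near a given one. -/
theorem IsClosedSolution.hasDerivAt_family (h : IsClosedSolution A B φ) (hB : ContDiff ℝ ∞ B)
    (x t : ℝ) (hx : 1 + x * quadTerm B φ t ≠ 0) :
    HasDerivAt (fun t => φ t + 2 * Real.arctan (Real.exp (logDer B φ t) * x /
        (1 + x * quadTerm B φ t)))
      (A t + B t * Real.sin (φ t + 2 * Real.arctan (Real.exp (logDer B φ t) * x /
        (1 + x * quadTerm B φ t)))) t := by
  refine ((h.hasDerivAt t).add (((((h.hasDerivAt_logDer hB t).exp.mul_const x).div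
    (((h.hasDerivAt_quadTerm hB t).const_mul x).const_add 1) hx).arctan).const_mul 2)).congr_deriv ?_
  rw [Real.sin_add, cos_two_mul_arctan, sin_two_mul_arctan]
  simp only [Pi.div_apply]
  have h1 : 1 + (Real.exp (logDer B φ t) * x / (1 + x * quadTerm B φ t)) ^ 2 ≠ 0 := by positivity
  have h2 : (1 + x * quadTerm B φ t) ^ 2 + (Real.exp (logDer B φ t) * x) ^ 2 ≠ 0 := by positivity
  field_simp
  ring

theorem leaf_eq_image {σ : ℝ → ℝ} (hσ : Continuous σ) (h0 : σ 0 = 0) (h1 : σ 1 = 2 * Real.pi)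
    {k : ℤ} (hk : ∀ t, φ (t + 2 * Real.pi) = φ t + 2 * Real.pi * k) :
    leaf φ = (fun u => toTorus (σ u, φ (σ u))) '' Icc 0 1 := by
  apply Subset.antisymm
  · rintro _ ⟨t, rfl⟩
    obtain ⟨j, hj, -⟩ := existsUnique_add_zsmul_mem_Ico Real.two_pi_pos t 0
    have hmem : t + j • (2 * Real.pi) ∈ Icc (σ 0) (σ 1) := by
      rw [h0, h1]; rw [zero_add] at hj; exact Ico_subset_Icc_self hj
    obtain ⟨u, hu, hut⟩ := intermediate_value_Icc zero_le_one hσ.continuousOn hmem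
    refine ⟨u, hu, ?_⟩
    simp only
    have h2 := add_int_mul_period hk j t
    rw [hut, zsmul_eq_mul, mul_comm, h2,
      show (t + 2 * Real.pi * j, φ t + 2 * Real.pi * k * j) = (t, φ t) + deck j (k * j) by
        simp [deck]; ring]
    exact toTorus_add_deck _ _ _
  · rintro _ ⟨u, -, rfl⟩
    exact ⟨σ u, rfl⟩

theorem IsClosedSolution.isReturnMap (h : IsClosedSolution A B φ) (hB : ContDiff ℝ ∞ B)
    (hα : HasMinimalFoliation α A B) :
    IsReturnMap α (leaf φ) fun x => Real.exp (logDer B φ (2 * Real.pi)) * x /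
      (1 + x * quadTerm B φ (2 * Real.pi)) := by
  obtain ⟨k, hk⟩ := h.periodic
  have hIs := h.contDiff_logDer hB
  have hJs := h.contDiff_quadTerm hB
  obtain ⟨M, hM⟩ := (isCompact_Icc (a := -(4 * Real.pi)) (b := 4 * Real.pi)).exists_bound_of_continuousOn
    hJs.continuous.continuousOn
  have hM0 : 0 ≤ M := (norm_nonneg _).trans (hM 0 ⟨by linarith [Real.pi_pos], by
    linarith [Real.pi_pos]⟩)
  -- The family has to be smooth for all real `u`. A bounded reparametrization of time keeps `J`
  -- bounded, so a single `δ` keeps the denominators away from `0`. The factor `8` gives `σ(1) =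
  -- 2π`.
  let σ : ℝ → ℝ := fun u => 8 * Real.arctan u
  have hσs : ContDiff ℝ ∞ σ := contDiff_const.mul Real.contDiff_arctan
  have hσr : ∀ u, σ u ∈ Icc (-(4 * Real.pi)) (4 * Real.pi) := fun u => by
    have h2 := Real.neg_pi_div_two_lt_arctan u
    have h3 := Real.arctan_lt_pi_div_two u
    exact ⟨by simp only [σ]; linarith, by simp only [σ]; linarith⟩
  have hσd : ∀ u, HasDerivAt σ (8 * (1 / (1 + u ^ 2))) u := fun u =>
    (Real.hasDerivAt_arctan u).const_mul 8
  have hσ0 : σ 0 = 0 := by simp [σ]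
  have hσ1 : σ 1 = 2 * Real.pi := by simp only [σ, Real.arctan_one]; ring
  have hpos : ∀ x ∈ Ioo (-(1 / (M + 1))) (1 / (M + 1)), ∀ u, 1 + x * quadTerm B φ (σ u) ≠ 0 := by
    intro x hx u h0
    have h2 := hM _ (hσr u)
    rw [Real.norm_eq_abs] at h2
    have h3 : |x| < 1 / (M + 1) := abs_lt.2 hx
    have h4 : |x * quadTerm B φ (σ u)| < 1 := by
      rw [abs_mul]
      calc |x| * |quadTerm B φ (σ u)| ≤ |x| * (M + 1) := by gcongr; linarith
        _ < 1 / (M + 1) * (M + 1) := by gcongr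
        _ = 1 := by field_simp
    have := (abs_lt.1 h4).1
    linarith
  -- At `u = 0` the angular offset from `φ` is `2 arctan x`; at `u = 1` it is `2 arctan` of the
  -- Möbius expression. This identifies the return parameter.
  let H : ℝ × ℝ → ℝ × ℝ := fun p => (σ p.2, φ (σ p.2) + 2 * Real.arctan
    (Real.exp (logDer B φ (σ p.2)) * p.1 / (1 + p.1 * quadTerm B φ (σ p.2))))
  have hHd : ∀ x ∈ Ioo (-(1 / (M + 1))) (1 / (M + 1)), ∀ u,
      HasDerivAt (fun w => H (x, w)) (8 * (1 / (1 + u ^ 2)),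
        (A (σ u) + B (σ u) * Real.sin (H (x, u)).2) * (8 * (1 / (1 + u ^ 2)))) u := fun x hx u =>
    (hσd u).prodMk ((h.hasDerivAt_family hB x (σ u) (hpos x hx u)).comp u (hσd u))
  have h0mem : (0 : ℝ) ∈ Ioo (-(1 / (M + 1))) (1 / (M + 1)) := by
    have : 0 < 1 / (M + 1) := by positivity
    exact ⟨by linarith, this⟩
  have hnear : ∀ᶠ x in 𝓝 (0 : ℝ), x ∈ Ioo (-(1 / (M + 1))) (1 / (M + 1)) :=
    isOpen_Ioo.mem_nhds h0mem
  have h2 := hk 0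
  rw [zero_add] at h2
  refine ⟨by simp, ?_, H, 1 / (M + 1), 1, 1, k, by positivity, one_pos, ?_, ?_, ?_, ?_, ?_⟩
  · exact (contDiffAt_const.mul contDiffAt_id).div
      (contDiffAt_const.add (contDiffAt_id.mul contDiffAt_const)) (by simp)
  · have hs2 : ContDiff ℝ ∞ fun p : ℝ × ℝ => σ p.2 := hσs.comp contDiff_snd
    refine hs2.contDiffOn.prodMk ((h.smooth.comp hs2).contDiffOn.add (contDiffOn_const.mul
      (Real.contDiff_arctan.comp_contDiffOn (((hIs.comp hs2).exp.mul contDiff_fst).contDiffOn.div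
        (contDiff_const.add (contDiff_fst.mul (hJs.comp hs2))).contDiffOn ?_))))
    rintro ⟨x, u⟩ hp
    exact hpos x hp.1 u
  · intro x hx u _
    rw [(hHd x hx u).deriv, hα]
    refine ⟨?_, rfl⟩
    simp only
    positivity
  · rw [leaf_eq_image hσs.continuous hσ0 hσ1 hk]
    simp [H]
  · have e1 : HasDerivAt (fun x => H (x, 0)) (0, 2) 0 := by
      have : (fun x => H (x, 0)) = fun x => ((0 : ℝ), φ 0 + 2 * Real.arctan x) := by
        funext x; simp [H, hσ0, logDer_zero, quadTerm_zero]
      rw [this]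
      refine (hasDerivAt_const _ _).prodMk
        (((Real.hasDerivAt_arctan 0).const_mul 2).const_add _ |>.congr_deriv (by norm_num))
    rw [e1.deriv, (hHd 0 h0mem 0).deriv, LinearIndependent.pair_iff]
    intro s t hst
    simp only [Prod.smul_mk, Prod.mk_add_mk, smul_eq_mul, Prod.mk_eq_zero] at hst
    have ht : t = 0 := by
      have := hst.1; norm_num at this; exact this
    subst ht
    have := hst.2
    norm_num at this
    exact ⟨this, rfl⟩
  · filter_upwards with x
    simp only [H, hσ1, hσ0, deck, Prod.mk_add_mk, h2, logDer_zero, quadTerm_zero, Real.exp_zero,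
      mul_zero, add_zero, one_mul, div_one, Int.cast_one, mul_one, zero_add, Prod.mk.injEq, true_and]
    ring

theorem deriv_moebius (l J : ℝ) :
    deriv (fun x : ℝ => l * x / (1 + x * J)) 0 = l ∧
    deriv (deriv fun x : ℝ => l * x / (1 + x * J)) 0 = -2 * l * J := by
  have hc : ∀ᶠ x in 𝓝 (0 : ℝ), 1 + x * J ≠ 0 :=
    (by fun_prop : Continuous fun x : ℝ => 1 + x * J).continuousAt.eventually_ne (by simp)
  have hd : ∀ x : ℝ, 1 + x * J ≠ 0 →
      HasDerivAt (fun x : ℝ => l * x / (1 + x * J)) (l / (1 + x * J) ^ 2) x := fun x hx =>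
    (((hasDerivAt_id x).const_mul l).div (((hasDerivAt_id x).mul_const J).const_add 1)
      hx).congr_deriv (by simp only [id]; ring)
  refine ⟨by rw [(hd 0 (by simp)).deriv]; simp, ?_⟩
  have he : deriv (fun x : ℝ => l * x / (1 + x * J)) =ᶠ[𝓝 0] fun x => l / (1 + x * J) ^ 2 := by
    filter_upwards [hc] with x hx using (hd x hx).deriv
  rw [he.deriv_eq]
  have : HasDerivAt (fun x : ℝ => l / (1 + x * J) ^ 2) (-2 * l * J) 0 :=
    ((hasDerivAt_const 0 l).div ((((hasDerivAt_id 0).mul_const J).const_add 1).pow 2)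
      (by simp)).congr_deriv (by simp; ring)
  exact this.deriv

theorem IsClosedSolution.isHyperbolicPrincipalCycle (h : IsClosedSolution A B φ)
    (hB : ContDiff ℝ ∞ B) (hα : HasMinimalFoliation α A B) (h1 : logDer B φ (2 * Real.pi) ≠ 0) :
    IsHyperbolicPrincipalCycle α (leaf φ) := by
  refine ⟨h.isPrincipalCycle hα, _, h.isReturnMap hB hα, ?_⟩
  rw [(deriv_moebius _ _).1]
  simpa using h1

theorem IsClosedSolution.isDoublePrincipalCycle (h : IsClosedSolution A B φ)
    (hB : ContDiff ℝ ∞ B) (hα : HasMinimalFoliation α A B) (h1 : logDer B φ (2 * Real.pi) = 0)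
    (h2 : quadTerm B φ (2 * Real.pi) ≠ 0) :
    IsDoublePrincipalCycle α (leaf φ) := by
  refine ⟨h.isPrincipalCycle hα, _, h.isReturnMap hB hα, ?_⟩
  rw [(deriv_moebius _ _).1, (deriv_moebius _ _).2]
  simpa [h1] using h2

theorem IsClosedSolution.two_hyperbolic_cycles (h : IsClosedSolution A B φ)
    (hB : ContDiff ℝ ∞ B) (hBp : ∀ t, B (t + 2 * Real.pi) = B t)
    (hα : HasMinimalFoliation α A B) (h1 : logDer B φ (2 * Real.pi) ≠ 0) :
    {C | IsPrincipalCycle α C}.ncard = 2 ∧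
      ∀ C, IsPrincipalCycle α C → IsHyperbolicPrincipalCycle α C := by
  have h2 := h.secondSolution hB hBp h1
  have key := fun C => h.eq_or_eq_of_isPrincipalCycle (C := C) hα hB hBp h1
  constructor
  · have : {C | IsPrincipalCycle α C} = {leaf φ, leaf (Canal.secondSolution B φ)} := by
      ext C
      refine ⟨key C, ?_⟩
      rintro (rfl | rfl)
      · exact h.isPrincipalCycle hα
      · exact h2.isPrincipalCycle hα
    rw [this, ncard_pair h.leaf_secondSolution_ne]
  · intro C hC
    rcases key C hC with rfl | rfl
    · exact h.isHyperbolicPrincipalCycle hB hα h1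
    · refine h2.isHyperbolicPrincipalCycle hB hα ?_
      rw [h.logDer_secondSolution hB hBp h1]
      simpa using h1

theorem IsClosedSolution.one_double_cycle (h : IsClosedSolution A B φ)
    (hB : ContDiff ℝ ∞ B) (hBp : ∀ t, B (t + 2 * Real.pi) = B t)
    (hα : HasMinimalFoliation α A B) (h1 : logDer B φ (2 * Real.pi) = 0)
    (h2 : quadTerm B φ (2 * Real.pi) ≠ 0) :
    {C | IsPrincipalCycle α C}.ncard = 1 ∧
      ∀ C, IsPrincipalCycle α C → IsDoublePrincipalCycle α C := by
  have key := fun C => h.eq_of_isPrincipalCycle (C := C) hα hB hBp h1 h2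
  constructor
  · have : {C | IsPrincipalCycle α C} = {leaf φ} := by
      ext C
      refine ⟨key C, ?_⟩
      rintro rfl
      exact h.isPrincipalCycle hα
    rw [this, ncard_singleton]
  · intro C hC
    rw [key C hC]
    exact h.isDoublePrincipalCycle hB hα h1 h2

end

/-! ### Vector algebra of three-space -/

theorem inner_eq (a b : E3) : inner ℝ a b = a 0 * b 0 + a 1 * b 1 + a 2 * b 2 := by
  simp [PiLp.inner_apply, Fin.sum_univ_three]; ring

theorem cross_zero_apply (a b : E3) : cross a b 0 = a 1 * b 2 - a 2 * b 1 := by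
  simp [cross, cross_apply]

theorem cross_one_apply (a b : E3) : cross a b 1 = a 2 * b 0 - a 0 * b 2 := by
  simp [cross, cross_apply]

theorem cross_two_apply (a b : E3) : cross a b 2 = a 0 * b 1 - a 1 * b 0 := by
  simp [cross, cross_apply]

theorem ext_three {a b : E3} (h0 : a 0 = b 0) (h1 : a 1 = b 1) (h2 : a 2 = b 2) : a = b := by
  ext i; fin_cases i <;> assumption

/-- The cross product as a continuous bilinear map. -/
noncomputable def crossL : E3 →L[ℝ] E3 →L[ℝ] E3 :=
  LinearMap.toContinuousBilinearMap (LinearMap.mk₂ ℝ cross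
    (fun a b c => by simp [cross]) (fun a b c => by simp [cross])
    (fun a b c => by simp [cross]) (fun a b c => by simp [cross]))

theorem crossL_apply (a b : E3) : crossL a b = cross a b := rfl

theorem cross_add_left (a b c : E3) : cross (a + b) c = cross a c + cross b c := by
  simp [← crossL_apply]

theorem cross_add_right (a b c : E3) : cross a (b + c) = cross a b + cross a c := by
  simp [← crossL_apply]

theorem cross_smul_left (k : ℝ) (a b : E3) : cross (k • a) b = k • cross a b := by
  simp [← crossL_apply]

theorem cross_smul_right (k : ℝ) (a b : E3) : cross a (k • b) = k • cross a b := by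
  simp [← crossL_apply]

theorem cross_self_eq_zero (a : E3) : cross a a = 0 := by simp [cross]

theorem cross_anticomm' (a b : E3) : cross a b = -cross b a := by
  refine ext_three ?_ ?_ ?_ <;>
    simp only [PiLp.neg_apply, cross_zero_apply, cross_one_apply, cross_two_apply] <;> ring

theorem cross_cross_left (a b c : E3) :
    cross (cross a b) c = (inner ℝ a c) • b - (inner ℝ b c) • a := by
  refine ext_three ?_ ?_ ?_ <;>
    simp only [PiLp.sub_apply, PiLp.smul_apply, smul_eq_mul, inner_eq,
      cross_zero_apply, cross_one_apply, cross_two_apply] <;> ring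

theorem inner_cross_self_left (a b : E3) : inner ℝ (cross a b) a = 0 := by
  simp only [inner_eq, cross_zero_apply, cross_one_apply, cross_two_apply]; ring

theorem inner_cross_self_right (a b : E3) : inner ℝ (cross a b) b = 0 := by
  simp only [inner_eq, cross_zero_apply, cross_one_apply, cross_two_apply]; ring

theorem inner_cross_cross (a b : E3) :
    inner ℝ (cross a b) (cross a b) = inner ℝ a a * inner ℝ b b - inner ℝ a b ^ 2 := by
  simp only [inner_eq, cross_zero_apply, cross_one_apply, cross_two_apply]; ring

/-- With `W = a ∧ b` and `W' = a ∧ d`, this is the numerator of the derivative of `W/|W|`; it shows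
that the binormal turns only in the direction of the principal normal. -/
theorem cross_projection (a b d : E3) :
    (inner ℝ (cross a b) (cross a b)) • cross a d
      - (inner ℝ (cross a b) (cross a d)) • cross a b
      = -((inner ℝ (cross a b) d) • cross (cross a b) a) := by
  refine ext_three ?_ ?_ ?_ <;>
    simp only [PiLp.sub_apply, PiLp.smul_apply, PiLp.neg_apply, smul_eq_mul, inner_eq,
      cross_zero_apply, cross_one_apply, cross_two_apply] <;> ring

theorem HasDerivAt.cross {a b : ℝ → E3} {a' b' : E3} {t : ℝ} (ha : HasDerivAt a a' t)
    (hb : HasDerivAt b b' t) :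
    HasDerivAt (fun t => cross (a t) (b t)) (cross a' (b t) + cross (a t) b') t :=
  (crossL.hasFDerivAt.comp_hasDerivAt t ha).clm_apply hb

theorem contDiff_cross {n : WithTop ℕ∞} {a b : ℝ → E3} (ha : ContDiff ℝ n a)
    (hb : ContDiff ℝ n b) : ContDiff ℝ n fun t => cross (a t) (b t) :=
  (crossL.contDiff.comp ha).clm_apply hb

theorem hasDerivAt_inv_norm {a : ℝ → E3} {a' : E3} {t : ℝ} (ha : HasDerivAt a a' t)
    (h0 : a t ≠ 0) :
    HasDerivAt (fun t => ‖a t‖⁻¹) (-(inner ℝ (a t) a' / ‖a t‖ ^ 3)) t := by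
  have h1 : ‖a t‖ ≠ 0 := norm_ne_zero_iff.2 h0
  have h2 : HasDerivAt (fun t => ‖a t‖) (inner ℝ (a t) a' / ‖a t‖) t := by
    have h3 := ha.norm_sq.sqrt (by positivity)
    simp only [Real.sqrt_sq (norm_nonneg _)] at h3
    exact h3.congr_deriv (by field_simp)
  exact (h2.inv h1).congr_deriv (by field_simp)

/-! ### Moving frames -/

/-- A smooth positive orthonormal frame with the Frenet type equations
`T' = ω₁ N`, `N' = -ω₁ T + ω₂ B`, `B' = -ω₂ N`. -/
structure IsMovingFrame (T N B : ℝ → E3) (ω₁ ω₂ : ℝ → ℝ) : Prop where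
  smooth_T : ContDiff ℝ ∞ T
  smooth_N : ContDiff ℝ ∞ N
  smooth_B : ContDiff ℝ ∞ B
  deriv_T : ∀ t, HasDerivAt T (ω₁ t • N t) t
  deriv_N : ∀ t, HasDerivAt N (-ω₁ t • T t + ω₂ t • B t) t
  deriv_B : ∀ t, HasDerivAt B (-ω₂ t • N t) t
  inner_TT : ∀ t, inner ℝ (T t) (T t) = 1
  inner_BB : ∀ t, inner ℝ (B t) (B t) = 1
  inner_BT : ∀ t, inner ℝ (B t) (T t) = 0
  cross_BT : ∀ t, cross (B t) (T t) = N t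

/-- The angular speed `ṡ k` of the tangent. -/
noncomputable def bending (c : ℝ → E3) (t : ℝ) : ℝ :=
  ‖cross (deriv c t) (deriv (deriv c) t)‖ / speed c t ^ 2

/-- The angular speed `ṡ τ` of the binormal. -/
noncomputable def twisting (c : ℝ → E3) (t : ℝ) : ℝ :=
  speed c t * inner ℝ (cross (deriv c t) (deriv (deriv c) t)) (deriv (deriv (deriv c)) t) /
    ‖cross (deriv c t) (deriv (deriv c) t)‖ ^ 2

theorem contDiff_deriv {F : Type*} [NormedAddCommGroup F] [NormedSpace ℝ F] {f : ℝ → F}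
    (hf : ContDiff ℝ ∞ f) : ContDiff ℝ ∞ (deriv f) :=
  (contDiff_infty_iff_deriv.1 hf).2

theorem hasDerivAt_deriv {F : Type*} [NormedAddCommGroup F] [NormedSpace ℝ F] {f : ℝ → F}
    (hf : ContDiff ℝ ∞ f) (t : ℝ) : HasDerivAt f (deriv f t) t :=
  ((contDiff_infty_iff_deriv.1 hf).1 t).hasDerivAt

/-- The Frenet equations in the parameter `t`, whence the factor `ṡ` inside `bending` and
`twisting`. The equation for the principal normal follows from the other two, since it is the cross
product of binormal and tangent. -/
theorem isMovingFrame_frenet {c : ℝ → E3} (hc : ContDiff ℝ ∞ c)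
    (hW : ∀ t, cross (deriv c t) (deriv (deriv c) t) ≠ 0) :
    IsMovingFrame (frenetT c) (frenetN c) (frenetB c) (bending c) (twisting c) := by
  have h1 := contDiff_deriv hc
  have h2 := contDiff_deriv h1
  have hWs := contDiff_cross h1 h2
  have ha : ∀ t, deriv c t ≠ 0 := fun t h0 => hW t (by
    rw [h0, ← crossL_apply]; simp)
  have hT : ContDiff ℝ ∞ (frenetT c) := ((h1.norm ℝ ha).inv fun t => by
    simpa using ha t).smul h1
  have hB : ContDiff ℝ ∞ (frenetB c) := ((hWs.norm ℝ hW).inv fun t => by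
    simpa using hW t).smul hWs
  have hv : ∀ t, ‖deriv c t‖ ≠ 0 := fun t => norm_ne_zero_iff.2 (ha t)
  have hw : ∀ t, ‖cross (deriv c t) (deriv (deriv c) t)‖ ≠ 0 := fun t => norm_ne_zero_iff.2 (hW t)
  have hTT : ∀ t, inner ℝ (frenetT c t) (frenetT c t) = 1 := fun t => by
    rw [frenetT, speed, real_inner_self_eq_norm_sq, norm_smul, norm_inv, norm_norm,
      inv_mul_cancel₀ (hv t), one_pow]
  have hBB : ∀ t, inner ℝ (frenetB c t) (frenetB c t) = 1 := fun t => by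
    rw [frenetB, real_inner_self_eq_norm_sq, norm_smul, norm_inv, norm_norm,
      inv_mul_cancel₀ (hw t), one_pow]
  have hBT : ∀ t, inner ℝ (frenetB c t) (frenetT c t) = 0 := fun t => by
    rw [frenetB, frenetT, real_inner_smul_left, real_inner_smul_right, inner_cross_self_left]
    simp
  have hN : ∀ t, frenetN c t = (‖cross (deriv c t) (deriv (deriv c) t)‖⁻¹ * (speed c t)⁻¹) •
      cross (cross (deriv c t) (deriv (deriv c) t)) (deriv c t) := fun t => by
    rw [frenetN, frenetB, frenetT, cross_smul_left, cross_smul_right, smul_smul]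
  have dT : ∀ t, HasDerivAt (frenetT c) (bending c t • frenetN c t) t := fun t => by
    refine ((hasDerivAt_inv_norm (hasDerivAt_deriv h1 t) (ha t)).smul
      (hasDerivAt_deriv h1 t)).congr_deriv ?_
    rw [hN, cross_cross_left, bending, real_inner_self_eq_norm_sq,
      real_inner_comm (deriv c t) (deriv (deriv c) t)]
    have := hv t
    have := hw t
    simp only [speed]
    match_scalars <;> field_simp
  have dB : ∀ t, HasDerivAt (frenetB c) (-twisting c t • frenetN c t) t := fun t => by
    have dW := HasDerivAt.cross (hasDerivAt_deriv h1 t) (hasDerivAt_deriv h2 t)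
    rw [cross_self_eq_zero, zero_add] at dW
    refine ((hasDerivAt_inv_norm dW (hW t)).smul dW).congr_deriv ?_
    rw [hN, twisting]
    have key := cross_projection (deriv c t) (deriv (deriv c) t) (deriv (deriv (deriv c)) t)
    have h3 := hv t
    have h4 := hw t
    simp only [speed]
    rw [real_inner_self_eq_norm_sq] at key
    linear_combination (norm := skip)
      (‖Canal.cross (deriv c t) (deriv (deriv c) t)‖ ^ 3)⁻¹ • key
    match_scalars <;> field_simp <;> ring
  have hNT : ∀ t, cross (frenetN c t) (frenetT c t) = -frenetB c t := fun t => by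
    rw [frenetN, cross_cross_left, hBT, hTT]; simp
  have hBN : ∀ t, cross (frenetB c t) (frenetN c t) = -frenetT c t := fun t => by
    rw [cross_anticomm', frenetN, cross_cross_left,
      real_inner_comm (frenetB c t) (frenetT c t), hBT, hBB]; simp
  refine ⟨hT, contDiff_cross hB hT, hB, dT, fun t => ?_, dB, hTT, hBB, hBT, fun t => rfl⟩
  refine (HasDerivAt.cross (dB t) (dT t)).congr_deriv ?_
  rw [cross_smul_left, cross_smul_right, hNT, hBN]
  module

/-! ### Canal surfaces -/

/-- The outward normal of a canal surface. -/
noncomputable def sphereNormal (c : ℝ → E3) (r : ℝ → ℝ) (p : ℝ × ℝ) : E3 :=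
  canalCos c r p.1 • frenetT c p.1
    + canalSin c r p.1 • (Real.cos p.2 • frenetN c p.1 + Real.sin p.2 • frenetB c p.1)

/-- The unit tangent of the characteristic circle. -/
noncomputable def circleTangent (c : ℝ → E3) (p : ℝ × ℝ) : E3 :=
  -Real.sin p.2 • frenetN c p.1 + Real.cos p.2 • frenetB c p.1

/-- The unit tangent orthogonal to the characteristic circle. -/
noncomputable def meridianTangent (c : ℝ → E3) (r : ℝ → ℝ) (p : ℝ × ℝ) : E3 :=
  -canalSin c r p.1 • frenetT c p.1
    + canalCos c r p.1 • (Real.cos p.2 • frenetN c p.1 + Real.sin p.2 • frenetB c p.1)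

/-- The rotation of the normal along the meridian. -/
noncomputable def normalTurning (c : ℝ → E3) (r : ℝ → ℝ) (p : ℝ × ℝ) : ℝ :=
  -deriv (canalCos c r) p.1 / canalSin c r p.1 + bending c p.1 * Real.cos p.2

/-- The rotation of the normal along the circle. -/
noncomputable def circleTurning (c : ℝ → E3) (r : ℝ → ℝ) (p : ℝ × ℝ) : ℝ :=
  canalSin c r p.1 * twisting c p.1 - canalCos c r p.1 * bending c p.1 * Real.sin p.2

/-- The rate of the canal surface along the meridian. -/
noncomputable def meridianSpeed (c : ℝ → E3) (r : ℝ → ℝ) (p : ℝ × ℝ) : ℝ :=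
  -speed c p.1 * canalSin c r p.1 + r p.1 * normalTurning c r p

theorem canalSurface_eq (c : ℝ → E3) (r : ℝ → ℝ) :
    canalSurface c r = fun p => c p.1 + r p.1 • sphereNormal c r p := by
  funext p
  simp only [canalSurface, sphereNormal]
  module

/-- The standing assumptions on the center curve and on the radius. -/
structure IsRegularCanal (c : ℝ → E3) (r : ℝ → ℝ) : Prop where
  smooth_c : ContDiff ℝ ∞ c
  smooth_r : ContDiff ℝ ∞ r
  curved : ∀ t, cross (deriv c t) (deriv (deriv c) t) ≠ 0
  cos_sq_lt : ∀ t, canalCos c r t ^ 2 < 1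
  r_pos : ∀ t, 0 < r t
  meridianSpeed_neg : ∀ p, meridianSpeed c r p < 0

section

variable {c : ℝ → E3} {r : ℝ → ℝ}

theorem orthonormal_of_isMovingFrame {T N B : ℝ → E3} {ω₁ ω₂ : ℝ → ℝ}
    (h : IsMovingFrame T N B ω₁ ω₂) (t : ℝ) :
    cross (B t) (T t) = N t ∧ cross (N t) (B t) = T t ∧ cross (T t) (N t) = B t ∧
      inner ℝ (N t) (N t) = 1 ∧ inner ℝ (N t) (T t) = 0 ∧ inner ℝ (N t) (B t) = 0 := by
  have hBT := h.inner_BT t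
  have hTB := h.inner_BT t
  rw [real_inner_comm] at hTB
  have hTT := h.inner_TT t
  have hBB := h.inner_BB t
  refine ⟨h.cross_BT t, ?_, ?_, ?_, ?_, ?_⟩
  · rw [← h.cross_BT, cross_cross_left, hBB, hTB]; simp
  · rw [cross_anticomm', ← h.cross_BT, cross_cross_left, hBT, hTT]; simp
  · rw [← h.cross_BT, inner_cross_cross, hBT, hTT, hBB]; ring
  · rw [← h.cross_BT, inner_cross_self_right]
  · rw [← h.cross_BT, inner_cross_self_left]

theorem IsRegularCanal.deriv_ne_zero (h : IsRegularCanal c r) (t : ℝ) : deriv c t ≠ 0 :=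
  fun h0 => h.curved t (by rw [h0, ← crossL_apply]; simp)

theorem IsRegularCanal.speed_pos (h : IsRegularCanal c r) (t : ℝ) : 0 < speed c t :=
  norm_pos_iff.2 (h.deriv_ne_zero t)

theorem IsRegularCanal.contDiff_canalCos (h : IsRegularCanal c r) :
    ContDiff ℝ ∞ (canalCos c r) :=
  ((contDiff_deriv h.smooth_r).div ((contDiff_deriv h.smooth_c).norm ℝ h.deriv_ne_zero)
    fun t => (h.speed_pos t).ne').neg

theorem IsRegularCanal.contDiff_canalSin (h : IsRegularCanal c r) :
    ContDiff ℝ ∞ (canalSin c r) :=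
  (contDiff_const.sub (h.contDiff_canalCos.pow 2)).sqrt fun t => by
    have := h.cos_sq_lt t; linarith

theorem IsRegularCanal.canalSin_pos (h : IsRegularCanal c r) (t : ℝ) : 0 < canalSin c r t :=
  Real.sqrt_pos.2 (by linarith [h.cos_sq_lt t])

theorem IsRegularCanal.canalSin_sq (h : IsRegularCanal c r) (t : ℝ) :
    canalSin c r t ^ 2 = 1 - canalCos c r t ^ 2 :=
  Real.sq_sqrt (by linarith [h.cos_sq_lt t])

theorem IsRegularCanal.hasDerivAt_canalCos (h : IsRegularCanal c r) (t : ℝ) :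
    HasDerivAt (canalCos c r) (deriv (canalCos c r) t) t :=
  hasDerivAt_deriv h.contDiff_canalCos t

theorem IsRegularCanal.hasDerivAt_canalSin (h : IsRegularCanal c r) (t : ℝ) :
    HasDerivAt (canalSin c r) (-canalCos c r t * deriv (canalCos c r) t / canalSin c r t) t := by
  refine ((((h.hasDerivAt_canalCos t).pow 2).const_sub 1).sqrt
    (by simp only [Pi.pow_apply]; linarith [h.cos_sq_lt t])).congr_deriv ?_
  have h1 := (h.canalSin_pos t).ne'
  simp only [canalSin, Pi.pow_apply] at h1 ⊢
  field_simp
  norm_num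
  ring

theorem IsRegularCanal.isMovingFrame (h : IsRegularCanal c r) :
    IsMovingFrame (frenetT c) (frenetN c) (frenetB c) (bending c) (twisting c) :=
  isMovingFrame_frenet h.smooth_c h.curved

theorem IsRegularCanal.contDiff_sphereNormal (h : IsRegularCanal c r) :
    ContDiff ℝ ∞ (sphereNormal c r) := by
  have hF := h.isMovingFrame
  have hC := h.contDiff_canalCos
  have hS := h.contDiff_canalSin
  exact ((hC.comp contDiff_fst).smul (hF.smooth_T.comp contDiff_fst)).add
    ((hS.comp contDiff_fst).smul (((Real.contDiff_cos.comp contDiff_snd).smul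
      (hF.smooth_N.comp contDiff_fst)).add ((Real.contDiff_sin.comp contDiff_snd).smul
        (hF.smooth_B.comp contDiff_fst))))

theorem fderiv_apply_of_partial {F : Type*} [NormedAddCommGroup F] [NormedSpace ℝ F]
    {f : ℝ × ℝ → F} {p : ℝ × ℝ} {a b : F} (hf : DifferentiableAt ℝ f p)
    (h1 : HasDerivAt (fun t => f (t, p.2)) a p.1) (h2 : HasDerivAt (fun s => f (p.1, s)) b p.2)
    (v : ℝ × ℝ) : fderiv ℝ f p v = v.1 • a + v.2 • b := by
  have e1 := (hf.hasFDerivAt.comp_hasDerivAt p.1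
    ((hasDerivAt_id p.1).prodMk (hasDerivAt_const p.1 p.2))).unique h1
  have e2 := (hf.hasFDerivAt.comp_hasDerivAt p.2
    ((hasDerivAt_const p.2 p.1).prodMk (hasDerivAt_id p.2))).unique h2
  rw [← e1, ← e2, ← map_smul, ← map_smul, ← map_add]
  simp

theorem IsRegularCanal.hasDerivAt_sphereNormal_fst (h : IsRegularCanal c r) (p : ℝ × ℝ) :
    HasDerivAt (fun t => sphereNormal c r (t, p.2))
      (normalTurning c r p • meridianTangent c r p
        + circleTurning c r p • circleTangent c p) p.1 := by
  have hF := h.isMovingFrame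
  refine (((h.hasDerivAt_canalCos p.1).smul (hF.deriv_T p.1)).add
    ((h.hasDerivAt_canalSin p.1).smul (((hF.deriv_N p.1).const_smul (Real.cos p.2)).add
      ((hF.deriv_B p.1).const_smul (Real.sin p.2))))).congr_deriv ?_
  simp only [normalTurning, meridianTangent, circleTurning, circleTangent, Pi.add_apply,
    Pi.smul_apply]
  have h1 := (h.canalSin_pos p.1).ne'
  have h2 := Real.sin_sq_add_cos_sq p.2
  have h3 : Real.sin p.2 ^ 2 = 1 - Real.cos p.2 ^ 2 := by linarith
  match_scalars <;> field_simp <;> ring_nf <;> (try rw [h3]) <;> ring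

theorem IsRegularCanal.hasDerivAt_sphereNormal_snd (p : ℝ × ℝ) :
    HasDerivAt (fun s => sphereNormal c r (p.1, s))
      (canalSin c r p.1 • circleTangent c p) p.2 :=
  (((((Real.hasDerivAt_cos p.2).smul_const (frenetN c p.1)).add
    ((Real.hasDerivAt_sin p.2).smul_const (frenetB c p.1))).const_smul
      (canalSin c r p.1)).const_add (canalCos c r p.1 • frenetT c p.1))

theorem IsRegularCanal.fderiv_sphereNormal (h : IsRegularCanal c r) (p v : ℝ × ℝ) :
    fderiv ℝ (sphereNormal c r) p v = (v.1 * normalTurning c r p) • meridianTangent c r p +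
      (v.1 * circleTurning c r p + v.2 * canalSin c r p.1) • circleTangent c p := by
  rw [fderiv_apply_of_partial ((h.contDiff_sphereNormal.differentiable (by simp)) p)
    (h.hasDerivAt_sphereNormal_fst p) (IsRegularCanal.hasDerivAt_sphereNormal_snd p)]
  module

theorem IsRegularCanal.contDiff_canalSurface (h : IsRegularCanal c r) :
    ContDiff ℝ ∞ (canalSurface c r) := by
  rw [canalSurface_eq]
  exact (h.smooth_c.comp contDiff_fst).add
    ((h.smooth_r.comp contDiff_fst).smul h.contDiff_sphereNormal)

theorem IsRegularCanal.fderiv_canalSurface (h : IsRegularCanal c r) (p v : ℝ × ℝ) :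
    fderiv ℝ (canalSurface c r) p v = (v.1 * meridianSpeed c r p) • meridianTangent c r p +
      (r p.1 * (v.1 * circleTurning c r p + v.2 * canalSin c r p.1)) • circleTangent c p := by
  have h1 := (h.speed_pos p.1).ne'
  have e1 : HasDerivAt (fun t => canalSurface c r (t, p.2))
      (meridianSpeed c r p • meridianTangent c r p +
        (r p.1 * circleTurning c r p) • circleTangent c p) p.1 := by
    rw [canalSurface_eq]
    refine ((hasDerivAt_deriv h.smooth_c p.1).add ((hasDerivAt_deriv h.smooth_r p.1).smul
      (h.hasDerivAt_sphereNormal_fst p))).congr_deriv ?_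
    have e2 : deriv c p.1 = speed c p.1 • frenetT c p.1 := by
      rw [frenetT, smul_smul, mul_inv_cancel₀ h1, one_smul]
    -- The envelope condition: this choice of `cos θ` cancels the component of the derivative along
    -- the sphere normal.
    have e3 : deriv r p.1 = -speed c p.1 * canalCos c r p.1 := by
      rw [canalCos]; field_simp
    have e4 := h.canalSin_sq p.1
    rw [e2, e3]
    simp only [meridianSpeed, sphereNormal, meridianTangent]
    match_scalars <;> ring_nf <;> (try rw [e4]) <;> ring
  have e2 : HasDerivAt (fun s => canalSurface c r (p.1, s))
      ((r p.1 * canalSin c r p.1) • circleTangent c p) p.2 := by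
    rw [canalSurface_eq]
    refine (((IsRegularCanal.hasDerivAt_sphereNormal_snd p).const_smul (r p.1)).const_add
      (c p.1)).congr_deriv ?_
    module
  rw [fderiv_apply_of_partial ((h.contDiff_canalSurface.differentiable (by simp)) p) e1 e2]
  module

theorem IsRegularCanal.tangent_frame (h : IsRegularCanal c r) (p : ℝ × ℝ) :
    cross (meridianTangent c r p) (circleTangent c p) = sphereNormal c r p ∧
    inner ℝ (meridianTangent c r p) (meridianTangent c r p) = 1 ∧
    inner ℝ (circleTangent c p) (circleTangent c p) = 1 ∧
    inner ℝ (meridianTangent c r p) (circleTangent c p) = 0 := by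
  have hF := h.isMovingFrame
  obtain ⟨hBT, hNB, hTN, iNN, iNT, iNB⟩ := orthonormal_of_isMovingFrame hF p.1
  have iTT := hF.inner_TT p.1
  have iBB := hF.inner_BB p.1
  have iBT := hF.inner_BT p.1
  have iTN := iNT
  have iBN := iNB
  have iTB := iBT
  rw [real_inner_comm] at iTN iBN iTB
  have hS := h.canalSin_sq p.1
  have hs := Real.sin_sq_add_cos_sq p.2
  have hs' : Real.sin p.2 ^ 2 = 1 - Real.cos p.2 ^ 2 := by linarith
  have hTB := cross_anticomm' (frenetT c p.1) (frenetB c p.1)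
  have hBN := cross_anticomm' (frenetB c p.1) (frenetN c p.1)
  rw [hBT] at hTB
  rw [hNB] at hBN
  refine ⟨?_, ?_, ?_, ?_⟩
  · simp only [meridianTangent, circleTangent, sphereNormal, cross_add_left, cross_add_right,
      cross_smul_left, cross_smul_right, cross_self_eq_zero, hTN, hTB, hBN, hNB]
    match_scalars
    · ring
    · linear_combination canalCos c r p.1 * hs
    · ring
  · simp only [meridianTangent, inner_add_left, inner_add_right, real_inner_smul_left,
      real_inner_smul_right, iNN, iTT, iBB, iBT, iTB, iNT, iTN, iNB, iBN]
    linear_combination hS + canalCos c r p.1 ^ 2 * hs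
  · simp only [circleTangent, inner_add_left, inner_add_right, real_inner_smul_left,
      real_inner_smul_right, iNN, iBB, iNB, iBN]
    linear_combination hs
  · simp only [meridianTangent, circleTangent, inner_add_left, inner_add_right,
      real_inner_smul_left, real_inner_smul_right, iNN, iBB, iTB, iTN, iNB, iBN]
    ring

theorem IsRegularCanal.smul_add_smul_eq_zero (h : IsRegularCanal c r) {p : ℝ × ℝ} {a b : ℝ} :
    a • meridianTangent c r p + b • circleTangent c p = 0 ↔ a = 0 ∧ b = 0 := by
  obtain ⟨-, h1, h2, h3⟩ := h.tangent_frame p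
  refine ⟨fun h0 => ⟨?_, ?_⟩, fun ⟨ha, hb⟩ => by simp [ha, hb]⟩
  · have := congrArg (fun z => inner ℝ (meridianTangent c r p) z) h0
    simpa [inner_add_right, real_inner_smul_right, h1, h3, -inner_self_eq_norm_sq_to_K] using this
  · have := congrArg (fun z => inner ℝ z (circleTangent c p)) h0
    simpa [inner_add_left, real_inner_smul_left, h2, h3, -inner_self_eq_norm_sq_to_K] using this

/-- The wedge of the partial derivatives is `meridianSpeed` times a positive factor times the
outward normal, and `meridianSpeed` is negative: the positive normal points inwards. -/
theorem IsRegularCanal.unitNormal_eq (h : IsRegularCanal c r) :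
    unitNormal (canalSurface c r) = fun p => -sphereNormal c r p := by
  funext p
  obtain ⟨h0, h1, h2, h3⟩ := h.tangent_frame p
  have hE := h.meridianSpeed_neg p
  have hr := h.r_pos p.1
  have hS := h.canalSin_pos p.1
  have hn : ‖sphereNormal c r p‖ = 1 := by
    have h4 : inner ℝ (sphereNormal c r p) (sphereNormal c r p) = 1 := by
      rw [← h0, inner_cross_cross, h1, h2, h3]; norm_num
    rw [real_inner_self_eq_norm_sq] at h4
    nlinarith [norm_nonneg (sphereNormal c r p)]
  have hX : cross (fderiv ℝ (canalSurface c r) p (1, 0)) (fderiv ℝ (canalSurface c r) p (0, 1))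
      = (meridianSpeed c r p * (r p.1 * canalSin c r p.1)) • sphereNormal c r p := by
    rw [h.fderiv_canalSurface, h.fderiv_canalSurface, ← h0]
    simp only [cross_add_left, cross_add_right, cross_smul_left, cross_smul_right,
      cross_self_eq_zero]
    module
  have hneg : meridianSpeed c r p * (r p.1 * canalSin c r p.1) < 0 :=
    mul_neg_of_neg_of_pos hE (mul_pos hr hS)
  rw [unitNormal, hX, norm_smul, hn, mul_one, smul_smul, Real.norm_eq_abs, abs_of_neg hneg,
    inv_neg, neg_mul, inv_mul_cancel₀ hneg.ne, neg_one_smul]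

/-- The differentials of the normal and of the surface have proportional components along the
circle, with factor `r`, and along the meridian they involve only `v.1`. Comparing components in the
orthonormal frame decouples the equation. -/
theorem IsRegularCanal.isPrincipalDirection_iff (h : IsRegularCanal c r) (p v : ℝ × ℝ) (k : ℝ) :
    IsPrincipalDirection (canalSurface c r) p v k ↔ v ≠ 0 ∧
      v.1 * (k * meridianSpeed c r p - normalTurning c r p) = 0 ∧
      (v.1 * circleTurning c r p + v.2 * canalSin c r p.1) * (k * r p.1 - 1) = 0 := by
  rw [IsPrincipalDirection, h.unitNormal_eq, fderiv_fun_neg, neg_apply,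
    h.fderiv_sphereNormal, h.fderiv_canalSurface, ← h.smul_add_smul_eq_zero (p := p)]
  refine and_congr_right fun _ => Eq.congr ?_ rfl
  module

theorem IsRegularCanal.isSmoothImmersion (h : IsRegularCanal c r) :
    IsSmoothImmersion (canalSurface c r) := by
  refine ⟨h.contDiff_canalSurface, fun p => ?_⟩
  rw [injective_iff_map_eq_zero]
  intro v hv
  rw [h.fderiv_canalSurface, h.smul_add_smul_eq_zero] at hv
  have h1 : v.1 = 0 := (mul_eq_zero.1 hv.1).resolve_right (h.meridianSpeed_neg p).ne
  have h2 := hv.2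
  rw [h1, zero_mul, zero_add] at h2
  have h3 := (mul_eq_zero.1 ((mul_eq_zero.1 h2).resolve_left (h.r_pos p.1).ne')).resolve_right
    (h.canalSin_pos p.1).ne'
  exact Prod.ext h1 h3

/-- The reason is `r · normalTurning - meridianSpeed = ṡ sin θ > 0`, divided by the negative
`meridianSpeed`. The meridian curvature is therefore below `1/r`, which excludes umbilics and
identifies the minimal foliation. -/
theorem IsRegularCanal.meridianCurvature_lt (h : IsRegularCanal c r) (p : ℝ × ℝ) :
    normalTurning c r p / meridianSpeed c r p * r p.1 < 1 := by
  have hE := h.meridianSpeed_neg p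
  rw [div_mul_eq_mul_div, div_lt_one_of_neg hE, meridianSpeed]
  have := mul_pos (h.speed_pos p.1) (h.canalSin_pos p.1)
  linarith

theorem IsRegularCanal.not_isUmbilic (h : IsRegularCanal c r) (p : ℝ × ℝ) :
    ¬ IsUmbilic (canalSurface c r) p := by
  rintro ⟨k, hk⟩
  have h1 := ((h.isPrincipalDirection_iff p _ k).1 (hk (0, 1) (by simp))).2.2
  have h2 := ((h.isPrincipalDirection_iff p _ k).1 (hk (1, 0) (by simp))).2.1
  have hE := h.meridianSpeed_neg p
  have hS := (h.canalSin_pos p.1).ne'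
  have h3 := h.meridianCurvature_lt p
  simp only [one_mul, zero_mul, zero_add] at h1 h2
  have h4 : k = normalTurning c r p / meridianSpeed c r p := by
    rw [eq_div_iff hE.ne]; linarith
  rw [← h4] at h3
  have := (mul_eq_zero.1 h1).resolve_left hS
  linarith

/-- Minimal directions are those whose image has no component along the circle. Solving this for
`v.2` gives the coefficients `-ṡτ` and `ṡ k cot θ`. -/
theorem IsRegularCanal.hasMinimalFoliation (h : IsRegularCanal c r) :
    HasMinimalFoliation (canalSurface c r) (fun t => -twisting c t)
      (fun t => bending c t * (canalCos c r t / canalSin c r t)) := by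
  intro p v
  have hE := h.meridianSpeed_neg p
  have hS := (h.canalSin_pos p.1).ne'
  have h3 := h.meridianCurvature_lt p
  have hr := h.r_pos p.1
  have e0 : ∀ v : ℝ × ℝ, v.1 * circleTurning c r p + v.2 * canalSin c r p.1 = 0 ↔
      v.2 = (-twisting c p.1 + bending c p.1 * (canalCos c r p.1 / canalSin c r p.1)
        * Real.sin p.2) * v.1 := fun v => by
    have : (-twisting c p.1 + bending c p.1 * (canalCos c r p.1 / canalSin c r p.1)
        * Real.sin p.2) * v.1 = -(v.1 * circleTurning c r p) / canalSin c r p.1 := by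
      rw [circleTurning]; field_simp; ring
    rw [this, eq_div_iff hS]
    constructor <;> intro h <;> linarith
  have hk : ∀ (v : ℝ × ℝ) (k : ℝ), IsPrincipalDirection (canalSurface c r) p v k → v.1 ≠ 0 →
      k = normalTurning c r p / meridianSpeed c r p ∧
      v.1 * circleTurning c r p + v.2 * canalSin c r p.1 = 0 := fun v k hv hv1 => by
    obtain ⟨-, h1, h2⟩ := (h.isPrincipalDirection_iff p v k).1 hv
    have h4 : k = normalTurning c r p / meridianSpeed c r p := by
      rw [eq_div_iff hE.ne]; linarith [(mul_eq_zero.1 h1).resolve_left hv1]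
    refine ⟨h4, (mul_eq_zero.1 h2).resolve_right ?_⟩
    rw [h4]; linarith
  have hk0 : ∀ (v : ℝ × ℝ) (k : ℝ), IsPrincipalDirection (canalSurface c r) p v k → v.1 = 0 →
      k * r p.1 = 1 := fun v k hv hv1 => by
    obtain ⟨h0, h1, h2⟩ := (h.isPrincipalDirection_iff p v k).1 hv
    have hv2 : v.2 ≠ 0 := fun h => h0 (Prod.ext hv1 h)
    rw [hv1, zero_mul, zero_add] at h2
    linarith [(mul_eq_zero.1 h2).resolve_left (mul_ne_zero hv2 hS)]
  have hpr : ∀ v : ℝ × ℝ, v.1 ≠ 0 → v.1 * circleTurning c r p + v.2 * canalSin c r p.1 = 0 →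
      IsPrincipalDirection (canalSurface c r) p v
        (normalTurning c r p / meridianSpeed c r p) := fun v hv1 hv => by
    refine (h.isPrincipalDirection_iff p v _).2 ⟨fun h => hv1 (by rw [h]; rfl), ?_, ?_⟩
    · rw [div_mul_cancel₀ _ hE.ne]; ring
    · rw [hv]; ring
  have hlt : ∀ k : ℝ, k * r p.1 = 1 → normalTurning c r p / meridianSpeed c r p < k := fun k hk =>
    lt_of_mul_lt_mul_right (by rw [hk]; exact h3) hr.le
  rw [← e0]
  constructor
  · rintro ⟨k, hv, hmin⟩
    -- A direction along the circle has curvature `1/r`, and the meridian direction exhibited here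
    -- has a smaller one.
    have hv1 : v.1 ≠ 0 := fun hv1 => by
      have h5 := hmin _ ⟨(1, -twisting c p.1 + bending c p.1 *
        (canalCos c r p.1 / canalSin c r p.1) * Real.sin p.2), hpr _ one_ne_zero ((e0 _).2 (by simp))⟩
      exact absurd (hlt k (hk0 v k hv hv1)) (not_lt.2 h5)
    exact ⟨hv1, (hk v k hv hv1).2⟩
  · rintro ⟨hv1, hv⟩
    refine ⟨_, hpr v hv1 hv, ?_⟩
    rintro k' ⟨w, hw⟩
    by_cases hw1 : w.1 = 0
    · exact (hlt k' (hk0 w k' hw hw1)).le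
    · exact (hk w k' hw hw1).1.ge

end

/-! ### Smooth dependence on parameters in spaces of continuous functions -/

section Curry

variable {E F : Type} [NormedAddCommGroup E] [NormedSpace ℝ E] [NormedAddCommGroup F]
  [NormedSpace ℝ F] {l u : ℝ}

/-- The section `t ↦ f (p, t)` over a compact interval. -/
def curryIcc (l u : ℝ) (f : E × ℝ → F) (hf : Continuous f) (p : E) : C(Icc l u, F) :=
  ⟨fun t => f (p, t), by fun_prop⟩

/-- A continuous family of linear maps as a linear map to continuous families. -/
noncomputable def familyToLinear (l u : ℝ) :
    C(Icc l u, E →L[ℝ] F) →L[ℝ] E →L[ℝ] C(Icc l u, F) :=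
  LinearMap.mkContinuous₂ (LinearMap.mk₂ ℝ
    (fun (g : C(Icc l u, E →L[ℝ] F)) (v : E) => (⟨fun t => g t v, by fun_prop⟩ : C(Icc l u, F)))
    (fun _ _ _ => by ext; simp) (fun _ _ _ => by ext; simp) (fun _ _ _ => by ext; simp)
    (fun _ _ _ => by ext; simp)) 1 (fun g v => by
      rw [one_mul, LinearMap.mk₂_apply, ContinuousMap.norm_le _ (by positivity)]
      exact fun t => (g t).le_of_opNorm_le (g.norm_coe_le_norm t) v)

/-- Compactness of the interval makes the partial derivative continuous in `p` uniformly in `t`; the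
mean value inequality on a ball then gives a remainder uniform in `t`. -/
theorem hasFDerivAt_curryIcc {f : E × ℝ → F} (hf : ContDiff ℝ ∞ f)
    (hf' : Continuous fun z => (fderiv ℝ f z).comp (ContinuousLinearMap.inl ℝ E ℝ)) (p : E) :
    HasFDerivAt (curryIcc l u f hf.continuous) (familyToLinear l u (curryIcc l u
      (fun z => (fderiv ℝ f z).comp (ContinuousLinearMap.inl ℝ E ℝ)) hf' p)) p := by
  refine HasFDerivAt.of_isLittleO (isLittleO_iff.2 fun ε hε => ?_)
  have h1 := (isCompact_Icc (a := l) (b := u)).eventually_forall_of_forall_eventually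
    (x₀ := p) (P := fun q t => ‖(fderiv ℝ f (q, t)).comp (ContinuousLinearMap.inl ℝ E ℝ)
      - (fderiv ℝ f (p, t)).comp (ContinuousLinearMap.inl ℝ E ℝ)‖ < ε) (fun t _ => by
        have hc : Continuous fun z : E × ℝ =>
            ‖(fderiv ℝ f (z.1, z.2)).comp (ContinuousLinearMap.inl ℝ E ℝ)
              - (fderiv ℝ f (p, z.2)).comp (ContinuousLinearMap.inl ℝ E ℝ)‖ :=
          (hf'.sub (hf'.comp (by fun_prop : Continuous fun z : E × ℝ => (p, z.2)))).norm
        exact hc.continuousAt.eventually_lt continuousAt_const (by simpa using hε))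
  obtain ⟨δ, hδ, hball⟩ := Metric.eventually_nhds_iff_ball.1 h1
  filter_upwards [Metric.ball_mem_nhds p hδ] with q hq
  rw [ContinuousMap.norm_le _ (by positivity)]
  intro t
  have hd : ∀ x ∈ Metric.ball p δ, HasFDerivWithinAt (fun x => f (x, (t : ℝ)))
      ((fderiv ℝ f (x, t)).comp (ContinuousLinearMap.inl ℝ E ℝ)) (Metric.ball p δ) x := fun x _ =>
    (((hf.differentiable (by simp)) (x, (t : ℝ))).hasFDerivAt.comp x
      (hasFDerivAt_prodMk_left x (t : ℝ))).hasFDerivWithinAt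
  exact (convex_ball p δ).norm_image_sub_le_of_norm_hasFDerivWithin_le' hd
    (fun x hx => (hball x hx t t.2).le) (Metric.mem_ball_self hδ) hq

end Curry

/-- The target `F` is quantified inside the induction because the derivative is again a curried
family, with values in `E →L[ℝ] F`. -/
theorem contDiff_curryIcc_nat {E : Type} [NormedAddCommGroup E] [NormedSpace ℝ E] (l u : ℝ)
    (n : ℕ) : ∀ {F : Type} [NormedAddCommGroup F] [NormedSpace ℝ F] {f : E × ℝ → F}
    (hf : ContDiff ℝ ∞ f), ContDiff ℝ n (curryIcc l u f hf.continuous) := by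
  induction n with
  | zero =>
    intro F _ _ f hf
    have hf1 : ContDiff ℝ ∞ fun z => (fderiv ℝ f z).comp (ContinuousLinearMap.inl ℝ E ℝ) :=
      (hf.fderiv_right (m := ∞) (by simp)).clm_comp contDiff_const
    exact contDiff_zero.2 (continuous_iff_continuousAt.2 fun p =>
      (hasFDerivAt_curryIcc hf hf1.continuous p).continuousAt)
  | succ n ih =>
    intro F _ _ f hf
    have hf1 : ContDiff ℝ ∞ fun z => (fderiv ℝ f z).comp (ContinuousLinearMap.inl ℝ E ℝ) :=
      (hf.fderiv_right (m := ∞) (by simp)).clm_comp contDiff_const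
    push_cast
    refine (contDiff_succ_iff_hasFDerivAt (n := n)).2 ⟨_, ?_,
      fun p => hasFDerivAt_curryIcc hf hf1.continuous p⟩
    have h : ContDiff ℝ n fun g => familyToLinear (E := E) (F := F) l u g := by fun_prop
    exact h.comp (ih hf1)

theorem contDiff_curryIcc {E F : Type} [NormedAddCommGroup E] [NormedSpace ℝ E]
    [NormedAddCommGroup F] [NormedSpace ℝ F] (l u : ℝ) {f : E × ℝ → F} (hf : ContDiff ℝ ∞ f) :
    ContDiff ℝ ∞ (curryIcc l u f hf.continuous) :=
  contDiff_infty.2 fun n => contDiff_curryIcc_nat l u n hf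

/-! ### Planar linear systems with small coefficients -/

section Resolvent

variable {E X : Type} [NormedAddCommGroup E] [NormedSpace ℝ E] [NormedRing X] [NormedAlgebra ℝ X]

/-- The linear equation `y = e + m V (a y - b (cj y))` has a solution that depends smoothly on
the parameters as long as `m` is small. -/
theorem exists_resolvent [CompleteSpace X] (V cj : X →L[ℝ] X) {a b : E → X} {m : E → ℝ}
    (ha : ContDiff ℝ ∞ a) (hb : ContDiff ℝ ∞ b) (hm : ContDiff ℝ ∞ m) :
    ∃ (D : Set E) (y : X → E → X), IsOpen D ∧ (∀ p, m p = 0 → p ∈ D) ∧ ∀ e,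
      ContDiffOn ℝ ∞ (y e) D ∧ (∀ p, m p = 0 → y e p = e) ∧
      ∀ p ∈ D, y e p = e + m p • V (a p * y e p - b p * cj (y e p)) := by
  let T : E → X →L[ℝ] X := fun p => V.comp
    (ContinuousLinearMap.mul ℝ X (a p) - (ContinuousLinearMap.mul ℝ X (b p)).comp cj)
  have hT : ContDiff ℝ ∞ T := contDiff_const.clm_comp
    (((ContinuousLinearMap.mul ℝ X).contDiff.comp ha).sub
      (((ContinuousLinearMap.mul ℝ X).contDiff.comp hb).clm_comp contDiff_const))
  let S : E → X →L[ℝ] X := fun p => 1 - m p • T p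
  have hS : ContDiff ℝ ∞ S := contDiff_const.sub (hm.smul hT)
  have hS0 : ∀ p, m p = 0 → S p = 1 := fun p hp => ContinuousLinearMap.ext fun z => by
    change z - m p • T p z = z
    rw [hp, zero_smul, sub_zero]
  have hR : ∀ e, ContDiffOn ℝ ∞ (fun p => Ring.inverse (S p) e) {p | IsUnit (S p)} :=
    fun e p hp => by
      have h1 : ContDiffAt ℝ ∞ (fun p => Ring.inverse (S p)) p := by
        obtain ⟨w, hw⟩ : IsUnit (S p) := hp
        have := contDiffAt_ringInverse (n := ∞) ℝ w
        rw [hw] at this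
        exact this.comp p hS.contDiffAt
      exact (h1.clm_apply contDiffAt_const).contDiffWithinAt
  -- The equation is `S y = e` with `S = 1 - m T`. Units form an open set on which inversion is
  -- smooth, and where `m = 0` the operator is the identity.
  refine ⟨{p | IsUnit (S p)}, fun e p => Ring.inverse (S p) e, Units.isOpen.preimage hS.continuous,
    fun p hp => by simp [hS0 p hp], fun e => ⟨hR e, fun p hp => by simp [hS0 p hp],
      fun p hp => ?_⟩⟩
  have h1 : S p (Ring.inverse (S p) e) = e :=
    congrArg (fun L : X →L[ℝ] X => L e) (Ring.mul_inverse_cancel (S p) hp)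
  exact sub_eq_iff_eq_add.1 h1

end Resolvent

/-- Complex valued continuous functions on one period. -/
abbrev PeriodFun : Type := C(Icc (0 : ℝ) (2 * Real.pi), ℂ)

/-- Extension of a function on one period by constants. -/
noncomputable def extendPeriod (g : PeriodFun) : ℝ → ℂ := IccExtend Real.two_pi_pos.le g

theorem continuous_extendPeriod (g : PeriodFun) : Continuous (extendPeriod g) :=
  g.continuous.Icc_extend'

theorem extendPeriod_of_mem (g : PeriodFun) {t : ℝ} (ht : t ∈ Icc 0 (2 * Real.pi)) :
    extendPeriod g t = g ⟨t, ht⟩ := IccExtend_of_mem _ _ ht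

theorem hasDerivAt_integral_extendPeriod (g : PeriodFun) (t : ℝ) :
    HasDerivAt (fun t => ∫ s in (0 : ℝ)..t, extendPeriod g s) (extendPeriod g t) t :=
  intervalIntegral.integral_hasDerivAt_right ((continuous_extendPeriod g).intervalIntegrable _ _)
    (continuous_extendPeriod g).stronglyMeasurable.stronglyMeasurableAtFilter
    (continuous_extendPeriod g).continuousAt

/-- The primitive vanishing at `0`, on one period. -/
noncomputable def volterra : PeriodFun →L[ℝ] PeriodFun :=
  LinearMap.mkContinuous
    { toFun := fun g => ⟨fun t => ∫ s in (0 : ℝ)..t, extendPeriod g s,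
        (continuous_iff_continuousAt.2 fun t =>
          (hasDerivAt_integral_extendPeriod g t).continuousAt).comp continuous_subtype_val⟩
      map_add' := fun f g => by
        ext t
        exact intervalIntegral.integral_add ((continuous_extendPeriod f).intervalIntegrable _ _)
          ((continuous_extendPeriod g).intervalIntegrable _ _)
      map_smul' := fun k f => by
        ext t
        exact intervalIntegral.integral_smul (μ := MeasureTheory.volume) k (extendPeriod f) } (2 * Real.pi) (fun g => by
    have := Real.two_pi_pos
    rw [ContinuousMap.norm_le _ (by positivity)]
    intro t
    have h1 : ‖∫ s in (0 : ℝ)..t, extendPeriod g s‖ ≤ ‖g‖ * |(t : ℝ) - 0| :=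
      intervalIntegral.norm_integral_le_of_norm_le_const fun s _ => g.norm_coe_le_norm _
    refine h1.trans ?_
    rw [mul_comm, sub_zero, abs_of_nonneg t.2.1]
    exact mul_le_mul_of_nonneg_right t.2.2 (norm_nonneg _))

/-- Complex conjugation. -/
noncomputable def conjPeriod : PeriodFun →L[ℝ] PeriodFun :=
  LinearMap.mkContinuous
    { toFun := fun g => ⟨fun t => (starRingEnd ℂ) (g t), by fun_prop⟩
      map_add' := fun f g => by ext t; simp
      map_smul' := fun k f => by ext t; simp } 1 (fun g => by
    rw [one_mul, ContinuousMap.norm_le _ (norm_nonneg _)]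
    intro t
    exact (Complex.norm_conj (g t)).trans_le (g.norm_coe_le_norm t))

theorem conjPeriod_apply (g : PeriodFun) (t : Icc (0 : ℝ) (2 * Real.pi)) :
    conjPeriod g t = (starRingEnd ℂ) (g t) := rfl

/-- The end of the period. -/
noncomputable def periodEnd : Icc (0 : ℝ) (2 * Real.pi) := ⟨2 * Real.pi, Real.two_pi_pos.le, le_rfl⟩

theorem volterra_periodEnd_re (g : PeriodFun) {f : ℝ → ℝ} (h : ∀ t, (g t).re = f t) :
    (volterra g periodEnd).re = ∫ t in (0 : ℝ)..(2 * Real.pi), f t := by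
  have h1 := Complex.reCLM.intervalIntegral_comp_comm
    ((continuous_extendPeriod g).intervalIntegrable (μ := MeasureTheory.volume) 0 (2 * Real.pi))
  refine h1.symm.trans (intervalIntegral.integral_congr fun t ht => ?_)
  rw [uIcc_of_le Real.two_pi_pos.le] at ht
  simp only [extendPeriod_of_mem _ ht, Complex.reCLM_apply, h]

theorem volterra_periodEnd_im (g : PeriodFun) {f : ℝ → ℝ} (h : ∀ t, (g t).im = f t) :
    (volterra g periodEnd).im = ∫ t in (0 : ℝ)..(2 * Real.pi), f t := by
  have h1 := Complex.imCLM.intervalIntegral_comp_comm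
    ((continuous_extendPeriod g).intervalIntegrable (μ := MeasureTheory.volume) 0 (2 * Real.pi))
  refine h1.symm.trans (intervalIntegral.integral_congr fun t ht => ?_)
  rw [uIcc_of_le Real.two_pi_pos.le] at ht
  simp only [extendPeriod_of_mem _ ht, Complex.imCLM_apply, h]

/-- Solutions on one period of `y₁' = μ (-b y₁ - a y₂) / 2`, `y₂' = μ (a y₁ + b y₂) / 2`. -/
structure IsSystemSolution (μ : ℝ) (a b y₁ y₂ : ℝ → ℝ) : Prop where
  deriv_fst : ∀ t ∈ Icc 0 (2 * Real.pi), HasDerivAt y₁ (μ / 2 * (-b t * y₁ t - a t * y₂ t)) t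
  deriv_snd : ∀ t ∈ Icc 0 (2 * Real.pi), HasDerivAt y₂ (μ / 2 * (a t * y₁ t + b t * y₂ t)) t

/-- With `y = y₁ + i y₂` the system is `y' = μ(i a y - b ȳ)/2`; its integral form is the Volterra
equation. The constant extension beyond the period provides two-sided derivatives at the end points.
-/
theorem exists_isSystemSolution {a b : ℝ → ℝ} {a' b' y : PeriodFun}
    (ha : ∀ t, a' t = Complex.I * (a t / 2 : ℝ)) (hb : ∀ t, b' t = (b t / 2 : ℝ)) {μ : ℝ} {e : ℂ}
    (hy : y = ContinuousMap.const _ e + μ • volterra (a' * y - b' * conjPeriod y)) :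
    ∃ y₁ y₂, IsSystemSolution μ a b y₁ y₂ ∧ y₁ 0 = e.re ∧ y₂ 0 = e.im ∧
      y₁ (2 * Real.pi) = e.re + μ * (volterra (a' * y - b' * conjPeriod y) periodEnd).re ∧
      y₂ (2 * Real.pi) = e.im + μ * (volterra (a' * y - b' * conjPeriod y) periodEnd).im := by
  obtain ⟨g, hg⟩ : ∃ g, g = a' * y - b' * conjPeriod y := ⟨_, rfl⟩
  rw [← hg] at hy ⊢
  have h1 : ∀ t, y t = e + μ • ∫ s in (0 : ℝ)..t, extendPeriod g s := fun t =>
    congrArg (fun f : PeriodFun => f t) hy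
  have hd := hasDerivAt_integral_extendPeriod g
  have hre : ∀ t, HasDerivAt (fun t => e.re + μ * (∫ s in (0 : ℝ)..t, extendPeriod g s).re)
      (μ * (extendPeriod g t).re) t := fun t =>
    ((Complex.reCLM.hasFDerivAt.comp_hasDerivAt t (hd t)).const_mul μ).const_add e.re
  have him : ∀ t, HasDerivAt (fun t => e.im + μ * (∫ s in (0 : ℝ)..t, extendPeriod g s).im)
      (μ * (extendPeriod g t).im) t := fun t =>
    ((Complex.imCLM.hasFDerivAt.comp_hasDerivAt t (hd t)).const_mul μ).const_add e.im
  have hgt : ∀ t (ht : t ∈ Icc 0 (2 * Real.pi)), extendPeriod g t =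
      Complex.I * (a t / 2 : ℝ) * y ⟨t, ht⟩ - (b t / 2 : ℝ) * (starRingEnd ℂ) (y ⟨t, ht⟩) :=
    fun t ht => by
      rw [extendPeriod_of_mem _ ht, hg, ← ha ⟨t, ht⟩, ← hb ⟨t, ht⟩]; rfl
  have hyre : ∀ t (ht : t ∈ Icc 0 (2 * Real.pi)), (y ⟨t, ht⟩).re =
      e.re + μ * (∫ s in (0 : ℝ)..t, extendPeriod g s).re := fun t ht => by rw [h1]; simp
  have hyim : ∀ t (ht : t ∈ Icc 0 (2 * Real.pi)), (y ⟨t, ht⟩).im =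
      e.im + μ * (∫ s in (0 : ℝ)..t, extendPeriod g s).im := fun t ht => by rw [h1]; simp
  refine ⟨_, _, ⟨fun t ht => (hre t).congr_deriv ?_, fun t ht => (him t).congr_deriv ?_⟩,
    by simp, by simp, rfl, rfl⟩
  · rw [← hyre t ht, ← hyim t ht, hgt t ht]
    simp only [Complex.sub_re, Complex.mul_re, Complex.mul_im, Complex.I_re, Complex.I_im,
      Complex.ofReal_re, Complex.ofReal_im, Complex.conj_re, Complex.conj_im]
    ring
  · rw [← hyre t ht, ← hyim t ht, hgt t ht]
    simp only [Complex.sub_im, Complex.mul_re, Complex.mul_im, Complex.I_re, Complex.I_im,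
      Complex.ofReal_re, Complex.ofReal_im, Complex.conj_re, Complex.conj_im]
    ring

/-- The monodromy of a system with coefficients of size `μ` is `1 + μ Q` with `Q` smooth. -/
theorem exists_monodromy {a b : (ℝ × ℝ) × ℝ → ℝ} (ha : ContDiff ℝ ∞ a) (hb : ContDiff ℝ ∞ b) :
    ∃ (D : Set (ℝ × ℝ)) (q₁₁ q₁₂ q₂₁ q₂₂ : ℝ × ℝ → ℝ), IsOpen D ∧ (∀ η, (0, η) ∈ D) ∧
      ContDiffOn ℝ ∞ q₁₁ D ∧ ContDiffOn ℝ ∞ q₁₂ D ∧ ContDiffOn ℝ ∞ q₂₁ D ∧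
      ContDiffOn ℝ ∞ q₂₂ D ∧
      (∀ η, q₁₁ (0, η) = -(∫ t in (0 : ℝ)..(2 * Real.pi), b ((0, η), t)) / 2 ∧
        q₁₂ (0, η) = -(∫ t in (0 : ℝ)..(2 * Real.pi), a ((0, η), t)) / 2 ∧
        q₂₁ (0, η) = (∫ t in (0 : ℝ)..(2 * Real.pi), a ((0, η), t)) / 2 ∧
        q₂₂ (0, η) = (∫ t in (0 : ℝ)..(2 * Real.pi), b ((0, η), t)) / 2) ∧
      ∀ p ∈ D, ∃ y₁ y₂ z₁ z₂ : ℝ → ℝ,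
        IsSystemSolution p.1 (fun t => a (p, t)) (fun t => b (p, t)) y₁ y₂ ∧
        IsSystemSolution p.1 (fun t => a (p, t)) (fun t => b (p, t)) z₁ z₂ ∧
        y₁ 0 = 1 ∧ y₂ 0 = 0 ∧ z₁ 0 = 0 ∧ z₂ 0 = 1 ∧
        y₁ (2 * Real.pi) = 1 + p.1 * q₁₁ p ∧ y₂ (2 * Real.pi) = p.1 * q₂₁ p ∧
        z₁ (2 * Real.pi) = p.1 * q₁₂ p ∧ z₂ (2 * Real.pi) = 1 + p.1 * q₂₂ p := by
  have has0 : ContDiff ℝ ∞ fun z => Complex.I * ((a z / 2 : ℝ) : ℂ) :=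
    contDiff_const.mul (Complex.ofRealCLM.contDiff.comp (ha.div_const 2))
  have hbs0 : ContDiff ℝ ∞ fun z => ((b z / 2 : ℝ) : ℂ) :=
    Complex.ofRealCLM.contDiff.comp (hb.div_const 2)
  obtain ⟨a', ha'⟩ : ∃ a', a' = curryIcc 0 (2 * Real.pi) _ has0.continuous := ⟨_, rfl⟩
  obtain ⟨b', hb'⟩ : ∃ b', b' = curryIcc 0 (2 * Real.pi) _ hbs0.continuous := ⟨_, rfl⟩
  have has : ContDiff ℝ ∞ a' := ha' ▸ contDiff_curryIcc _ _ has0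
  have hbs : ContDiff ℝ ∞ b' := hb' ▸ contDiff_curryIcc _ _ hbs0
  have haa : ∀ p t, a' p t = Complex.I * (a (p, t) / 2 : ℝ) := fun p t => by rw [ha']; rfl
  have hbb : ∀ p t, b' p t = (b (p, t) / 2 : ℝ) := fun p t => by rw [hb']; rfl
  obtain ⟨D, y, hD, hD0, hy⟩ := exists_resolvent volterra conjPeriod has hbs (m := Prod.fst)
    contDiff_fst
  have hev : ContDiff ℝ ∞ fun f : PeriodFun => volterra f periodEnd := by
    have h1 : ContDiff ℝ ∞ fun f => ContinuousMap.evalCLM ℝ periodEnd (volterra f) := by fun_prop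
    exact h1
  have hQ : ∀ e, ContDiffOn ℝ ∞
      (fun p => volterra (a' p * y e p - b' p * conjPeriod (y e p)) periodEnd) D := fun e =>
    hev.comp_contDiffOn ((has.contDiffOn.mul (hy e).1).sub
      (hbs.contDiffOn.mul (conjPeriod.contDiff.comp_contDiffOn (hy e).1)))
  have hre := fun e => Complex.reCLM.contDiff.comp_contDiffOn (hQ e)
  have him := fun e => Complex.imCLM.contDiff.comp_contDiffOn (hQ e)
  let c : ℂ → PeriodFun := fun e => ContinuousMap.const _ e
  -- The initial values `1` and `i` give the two columns of `Q`. At `μ = 0` the solutions are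
  -- constant, so the entries are plain integrals of the coefficients.
  refine ⟨D, _, _, _, _, hD, fun η => hD0 _ rfl, hre (c 1), hre (c Complex.I),
    him (c 1), him (c Complex.I), fun η => ?_, fun p hp => ?_⟩
  · simp only [Function.comp_apply, Complex.reCLM_apply, Complex.imCLM_apply]
    rw [(hy (c 1)).2.1 (0, η) rfl, (hy (c Complex.I)).2.1 (0, η) rfl,
      volterra_periodEnd_re _ (f := fun t => b ((0, η), t) * (-1 / 2)),
      volterra_periodEnd_re _ (f := fun t => a ((0, η), t) * (-1 / 2)),
      volterra_periodEnd_im _ (f := fun t => a ((0, η), t) * (1 / 2)),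
      volterra_periodEnd_im _ (f := fun t => b ((0, η), t) * (1 / 2))]
    · simp only [intervalIntegral.integral_mul_const]
      refine ⟨by ring, by ring, by ring, by ring⟩
    all_goals
      intro t
      rw [ContinuousMap.sub_apply, ContinuousMap.mul_apply, ContinuousMap.mul_apply,
        conjPeriod_apply, haa, hbb]
      simp [c]
      try ring
  · obtain ⟨y₁, y₂, hy', i1, i2, f1, f2⟩ := exists_isSystemSolution (a := fun t => a (p, t))
      (b := fun t => b (p, t)) (haa p) (hbb p) ((hy (c 1)).2.2 p hp)
    obtain ⟨z₁, z₂, hz, j1, j2, g1, g2⟩ := exists_isSystemSolution (a := fun t => a (p, t))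
      (b := fun t => b (p, t)) (haa p) (hbb p) ((hy (c Complex.I)).2.2 p hp)
    simp only [Complex.one_re, Complex.one_im, Complex.I_re, Complex.I_im, zero_add] at *
    exact ⟨y₁, y₂, z₁, z₂, hy', hz, i1, i2, j1, j2, f1, f2, g1, g2⟩

/-! ### Closed solutions from eigenvectors of the monodromy -/

theorem eq_left_of_hasDerivAt_zero {f : ℝ → ℝ} {l u : ℝ}
    (h : ∀ t ∈ Icc l u, HasDerivAt f 0 t) : ∀ t ∈ Icc l u, f t = f l :=
  constant_of_has_deriv_right_zero (fun t ht => (h t ht).continuousAt.continuousWithinAt)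
    fun t ht => (h t (Ico_subset_Icc_self ht)).hasDerivWithinAt

/-- Continuous periodic extension of a function from one period. -/
theorem exists_periodic_extension {f : ℝ → ℝ} (hf : ContinuousOn f (Icc 0 (2 * Real.pi)))
    (h : f 0 = f (2 * Real.pi)) : ∃ g : ℝ → ℝ, Continuous g ∧
      (∀ t, g (t + 2 * Real.pi) = g t) ∧ ∀ t ∈ Icc 0 (2 * Real.pi), g t = f t := by
  have : Fact (0 < 2 * Real.pi) := ⟨Real.two_pi_pos⟩
  have hper : ∀ t : ℝ, ((t + 2 * Real.pi : ℝ) : AddCircle (2 * Real.pi)) = t := fun t => by simp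
  have hIco : ∀ t ∈ Ico 0 (2 * Real.pi),
      AddCircle.liftIco (2 * Real.pi) 0 f (t : AddCircle (2 * Real.pi)) = f t := fun t ht =>
    AddCircle.liftIco_coe_apply (by rwa [zero_add])
  refine ⟨fun t => AddCircle.liftIco (2 * Real.pi) 0 f (t : AddCircle (2 * Real.pi)),
    (AddCircle.liftIco_continuous (by rwa [zero_add]) (by rwa [zero_add])).comp
      (AddCircle.continuous_mk' _), fun t => by simp only [hper], fun t ht => ?_⟩
  rcases ht.2.lt_or_eq with h1 | h1
  · exact hIco t ⟨ht.1, h1⟩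
  · have := hper 0
    rw [zero_add] at this
    simp only [h1, this]
    rw [hIco 0 ⟨le_rfl, Real.two_pi_pos⟩, h]

/-- A solution `(y₁, y₂)` over one period of the linear system that projects to
`φ' = A + B sin φ`, `φ = 2 arg y`. -/
structure IsLift (A B y₁ y₂ : ℝ → ℝ) : Prop where
  deriv_fst : ∀ t ∈ Icc 0 (2 * Real.pi), HasDerivAt y₁ ((-B t * y₁ t - A t * y₂ t) / 2) t
  deriv_snd : ∀ t ∈ Icc 0 (2 * Real.pi), HasDerivAt y₂ ((A t * y₁ t + B t * y₂ t) / 2) t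

section

variable {A B y₁ y₂ z₁ z₂ : ℝ → ℝ}

theorem IsSystemSolution.isLift {μ : ℝ} {a b : ℝ → ℝ} (h : IsSystemSolution μ a b y₁ y₂)
    (hA : ∀ t, A t = μ * a t) (hB : ∀ t, B t = μ * b t) : IsLift A B y₁ y₂ :=
  ⟨fun t ht => (h.deriv_fst t ht).congr_deriv (by rw [hA, hB]; ring),
    fun t ht => (h.deriv_snd t ht).congr_deriv (by rw [hA, hB]; ring)⟩

theorem IsLift.combination (hy : IsLift A B y₁ y₂) (hz : IsLift A B z₁ z₂) (p q : ℝ) :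
    IsLift A B (fun t => p * y₁ t + q * z₁ t) (fun t => p * y₂ t + q * z₂ t) :=
  ⟨fun t ht => (((hy.deriv_fst t ht).const_mul p).add
      ((hz.deriv_fst t ht).const_mul q)).congr_deriv (by ring),
    fun t ht => (((hy.deriv_snd t ht).const_mul p).add
      ((hz.deriv_snd t ht).const_mul q)).congr_deriv (by ring)⟩

theorem IsLift.det_eq (hy : IsLift A B y₁ y₂) (hz : IsLift A B z₁ z₂) :
    ∀ t ∈ Icc 0 (2 * Real.pi), y₁ t * z₂ t - y₂ t * z₁ t = y₁ 0 * z₂ 0 - y₂ 0 * z₁ 0 :=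
  eq_left_of_hasDerivAt_zero (f := fun t => y₁ t * z₂ t - y₂ t * z₁ t) fun t ht =>
    (((hy.deriv_fst t ht).mul (hz.deriv_snd t ht)).sub
      ((hy.deriv_snd t ht).mul (hz.deriv_fst t ht))).congr_deriv (by ring)

theorem exists_half_angle {p q : ℝ} (h : p ^ 2 + q ^ 2 ≠ 0) :
    ∃ θ : ℝ, p * Real.sin θ - q * Real.cos θ = 0 := by
  have h0 : (⟨p, q⟩ : ℂ) ≠ 0 := fun h0 => h (by
    have h1 := congrArg Complex.re h0
    have h2 := congrArg Complex.im h0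
    simp only [Complex.zero_re, Complex.zero_im] at h1 h2
    rw [h1, h2]; norm_num)
  refine ⟨Complex.arg ⟨p, q⟩, ?_⟩
  rw [Complex.sin_arg, Complex.cos_arg h0]
  ring

/-- An eigenvector of the monodromy projects to a closed solution. -/
theorem IsLift.exists_isClosedSolution (hy : IsLift A B y₁ y₂) (hA : ContDiff ℝ ∞ A)
    (hB : ContDiff ℝ ∞ B) (hAp : ∀ t, A (t + 2 * Real.pi) = A t)
    (hBp : ∀ t, B (t + 2 * Real.pi) = B t)
    (h0 : ∀ t ∈ Icc 0 (2 * Real.pi), y₁ t ^ 2 + y₂ t ^ 2 ≠ 0) {ν : ℝ} (hν : ν ≠ 0)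
    (h1 : y₁ (2 * Real.pi) = ν * y₁ 0) (h2 : y₂ (2 * Real.pi) = ν * y₂ 0) :
    ∃ φ, IsClosedSolution A B φ ∧ ∀ t ∈ Icc 0 (2 * Real.pi),
      y₁ t ^ 2 - y₂ t ^ 2 = (y₁ t ^ 2 + y₂ t ^ 2) * Real.cos (φ t) ∧
      2 * y₁ t * y₂ t = (y₁ t ^ 2 + y₂ t ^ 2) * Real.sin (φ t) := by
  have hm0 : (0 : ℝ) ∈ Icc 0 (2 * Real.pi) := ⟨le_rfl, Real.two_pi_pos.le⟩
  have hm1 : 2 * Real.pi ∈ Icc 0 (2 * Real.pi) := ⟨Real.two_pi_pos.le, le_rfl⟩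
  have c1 : ContinuousOn y₁ (Icc 0 (2 * Real.pi)) := fun t ht =>
    (hy.deriv_fst t ht).continuousAt.continuousWithinAt
  have c2 : ContinuousOn y₂ (Icc 0 (2 * Real.pi)) := fun t ht =>
    (hy.deriv_snd t ht).continuousAt.continuousWithinAt
  -- `S` is `sin(2 arg y)`. It closes up because an eigenvector only gets rescaled over a period;
  -- `φ` is then a primitive, and no continuous branch of the argument has to be chosen.
  obtain ⟨S, hSc, hSp, hS⟩ := exists_periodic_extension
    (f := fun t => 2 * y₁ t * y₂ t / (y₁ t ^ 2 + y₂ t ^ 2))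
    (((continuousOn_const.mul c1).mul c2).div ((c1.pow 2).add (c2.pow 2)) h0) (by
      have := h0 0 hm0
      simp only [h1, h2]
      have h3 : (ν * y₁ 0) ^ 2 + (ν * y₂ 0) ^ 2 ≠ 0 := by
        rw [mul_pow, mul_pow, ← mul_add]; exact mul_ne_zero (pow_ne_zero 2 hν) this
      field_simp)
  obtain ⟨θ, hθ⟩ := exists_half_angle (h0 0 hm0)
  have hFc : Continuous fun t => A t + B t * S t := hA.continuous.add (hB.continuous.mul hSc)
  obtain ⟨φ, hφ⟩ : ∃ φ : ℝ → ℝ, φ = fun t => 2 * θ + ∫ s in (0 : ℝ)..t, A s + B s * S s := ⟨_, rfl⟩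
  have hφd : ∀ t, HasDerivAt φ (A t + B t * S t) t := fun t => by
    rw [hφ]; exact (hasDerivAt_primitive hFc 0 t).const_add _
  have hφ0 : φ 0 = 2 * θ := by rw [hφ]; simp
  have hper : ∀ t, φ (t + 2 * Real.pi) = φ t + (φ (2 * Real.pi) - φ 0) := fun t => by
    rw [hφ]; simp only
    rw [primitive_add_period hFc (fun t => by rw [hAp, hBp, hSp])]
    simp; ring
  -- The expression vanishes when `y` points in the direction `φ/2`. Its square divided by `|y|²` is
  -- constant along the flow and is zero initially by the choice of `θ`.
  have hw : ∀ t ∈ Icc 0 (2 * Real.pi),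
      y₁ t * Real.sin (φ t / 2) - y₂ t * Real.cos (φ t / 2) = 0 := by
    have hconst := eq_left_of_hasDerivAt_zero (l := 0) (u := 2 * Real.pi)
      (f := fun t => (y₁ t * Real.sin (φ t / 2) - y₂ t * Real.cos (φ t / 2)) ^ 2 /
        (y₁ t ^ 2 + y₂ t ^ 2)) fun t ht => by
        have d1 := hy.deriv_fst t ht
        have d2 := hy.deriv_snd t ht
        have d3 := (hφd t).div_const 2
        have h3 := h0 t ht
        have hnum := ((d1.mul d3.sin).sub (d2.mul d3.cos)).pow 2
        have hden := (d1.pow 2).add (d2.pow 2)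
        refine (hnum.div hden h3).congr_deriv ?_
        rw [hS t ht]
        simp only [Pi.sub_apply, Pi.mul_apply, Pi.add_apply, Pi.pow_apply]
        field_simp
        push_cast
        ring
    intro t ht
    have h3 := hconst t ht
    simp only [hφ0, mul_div_cancel_left₀ θ (two_ne_zero' ℝ), hθ] at h3
    have h4 := (div_eq_zero_iff.1 (h3.trans (by simp))).resolve_right (h0 t ht)
    exact pow_eq_zero_iff two_ne_zero |>.1 h4
  have hcs : ∀ t ∈ Icc 0 (2 * Real.pi),
      y₁ t ^ 2 - y₂ t ^ 2 = (y₁ t ^ 2 + y₂ t ^ 2) * Real.cos (φ t) ∧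
      2 * y₁ t * y₂ t = (y₁ t ^ 2 + y₂ t ^ 2) * Real.sin (φ t) := fun t ht => by
    have h3 := hw t ht
    have h4 := Real.sin_sq_add_cos_sq (φ t / 2)
    rw [show φ t = 2 * (φ t / 2) by ring, Real.cos_two_mul, Real.sin_two_mul]
    generalize Real.sin (φ t / 2) = s at *
    generalize Real.cos (φ t / 2) = c at *
    have e1 : y₁ t = (y₁ t * c + y₂ t * s) * c := by linear_combination s * h3 - y₁ t * h4
    have e2 : y₂ t = (y₁ t * c + y₂ t * s) * s := by linear_combination -c * h3 - y₂ t * h4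
    generalize y₁ t * c + y₂ t * s = p at *
    rw [e1, e2]
    have h5 : s ^ 2 = 1 - c ^ 2 := by linarith
    constructor
    · linear_combination (-p ^ 2 * (2 * c ^ 2)) * h5
    · linear_combination (-2 * p ^ 2 * s * c) * h4
  have hsinS : ∀ t ∈ Icc 0 (2 * Real.pi), S t = Real.sin (φ t) := fun t ht => by
    rw [hS t ht, (hcs t ht).2, mul_div_cancel_left₀ _ (h0 t ht)]
  obtain ⟨k, hk⟩ : ∃ k : ℤ, φ (2 * Real.pi) - φ 0 = 2 * Real.pi * k := by
    refine Real.Angle.angle_eq_iff_two_pi_dvd_sub.1 (Real.Angle.cos_sin_inj ?_ ?_)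
    · have e0 := (hcs 0 hm0).1
      have e1 := (hcs _ hm1).1
      rw [h1, h2] at e1
      have h3 : ν ^ 2 * (y₁ 0 ^ 2 + y₂ 0 ^ 2) ≠ 0 := mul_ne_zero (pow_ne_zero 2 hν) (h0 0 hm0)
      refine mul_left_cancel₀ h3 ?_
      linear_combination ν ^ 2 * e0 - e1
    · rw [← hsinS _ hm1, ← hsinS _ hm0, ← zero_add (2 * Real.pi), hSp]
  rw [hk] at hper
  have hall : ∀ t, S t = Real.sin (φ t) := fun t => by
    obtain ⟨j, hj, -⟩ := existsUnique_add_zsmul_mem_Ico Real.two_pi_pos t 0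
    rw [zero_add, zsmul_eq_mul, mul_comm (j : ℝ)] at hj
    have e1 := add_int_mul_period (f := S) (c := 0) (p := 2 * Real.pi)
      (fun t => by rw [hSp, add_zero]) j t
    have e2 := add_int_mul_period hper j t
    rw [zero_mul, add_zero] at e1
    rw [← e1, hsinS _ (Ico_subset_Icc_self hj), e2]
    have := Real.sin_add_int_mul_two_pi (φ t) (k * j)
    rw [← this]; congr 1; push_cast; ring
  refine ⟨φ, ⟨contDiff_infty_of_hasDerivAt
    (f' := fun t => A t + B t * Real.sin (φ t)) (fun t => by rw [← hall]; exact hφd t) fun n hn =>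
    (hA.of_le (by exact_mod_cast le_top)).add ((hB.of_le (by exact_mod_cast le_top)).mul
      (Real.contDiff_sin.comp hn)), fun t => by rw [← hall]; exact hφd t, k, hper⟩, hcs⟩

theorem IsLift.hasDerivAt_norm_sq (hy : IsLift A B y₁ y₂) {t : ℝ} (ht : t ∈ Icc 0 (2 * Real.pi)) :
    HasDerivAt (fun t => y₁ t ^ 2 + y₂ t ^ 2) (-B t * (y₁ t ^ 2 - y₂ t ^ 2)) t :=
  (((hy.deriv_fst t ht).pow 2).add ((hy.deriv_snd t ht).pow 2)).congr_deriv (by push_cast; ring)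

/-- Since `(|y|²)' = -B cos φ |y|²`, the linearized flow along `φ` is the inverse of the growth of
`|y|²`. -/
theorem IsLift.exp_logDer (hy : IsLift A B y₁ y₂) (hB : ContDiff ℝ ∞ B) {φ : ℝ → ℝ}
    (hφ : IsClosedSolution A B φ) (hc : ∀ t ∈ Icc 0 (2 * Real.pi),
      y₁ t ^ 2 - y₂ t ^ 2 = (y₁ t ^ 2 + y₂ t ^ 2) * Real.cos (φ t)) :
    ∀ t ∈ Icc 0 (2 * Real.pi),
      Real.exp (logDer B φ t) * (y₁ t ^ 2 + y₂ t ^ 2) = y₁ 0 ^ 2 + y₂ 0 ^ 2 := by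
  have := eq_left_of_hasDerivAt_zero (l := 0) (u := 2 * Real.pi)
    (f := fun t => Real.exp (logDer B φ t) * (y₁ t ^ 2 + y₂ t ^ 2)) fun t ht =>
      ((hφ.hasDerivAt_logDer hB t).exp.mul (hy.hasDerivAt_norm_sq ht)).congr_deriv (by
        rw [hc t ht]; ring)
  intro t ht
  rw [this t ht, logDer_zero, Real.exp_zero, one_mul]

/-- The derivative of `(y · z)/|y|²` is `det(y, z) B sin φ / |y|²`, with constant determinant; up to
constants this is the integrand of `quadTerm`. The latter thereby becomes readable from the
monodromy. -/
theorem IsLift.quadTerm_eq (hy : IsLift A B y₁ y₂) (hz : IsLift A B z₁ z₂) (hB : ContDiff ℝ ∞ B)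
    {φ : ℝ → ℝ} (hφ : IsClosedSolution A B φ)
    (h0 : ∀ t ∈ Icc 0 (2 * Real.pi), y₁ t ^ 2 + y₂ t ^ 2 ≠ 0)
    (hc : ∀ t ∈ Icc 0 (2 * Real.pi),
      y₁ t ^ 2 - y₂ t ^ 2 = (y₁ t ^ 2 + y₂ t ^ 2) * Real.cos (φ t) ∧
      2 * y₁ t * y₂ t = (y₁ t ^ 2 + y₂ t ^ 2) * Real.sin (φ t)) :
    ∀ t ∈ Icc 0 (2 * Real.pi),
      (y₁ 0 * z₂ 0 - y₂ 0 * z₁ 0) * quadTerm B φ t = (y₁ 0 ^ 2 + y₂ 0 ^ 2) *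
        ((y₁ t * z₁ t + y₂ t * z₂ t) / (y₁ t ^ 2 + y₂ t ^ 2)
          - (y₁ 0 * z₁ 0 + y₂ 0 * z₂ 0) / (y₁ 0 ^ 2 + y₂ 0 ^ 2)) := by
  have hexp := hy.exp_logDer hB hφ fun t ht => (hc t ht).1
  have hdet := hy.det_eq hz
  have := eq_left_of_hasDerivAt_zero (l := 0) (u := 2 * Real.pi)
    (f := fun t => (y₁ 0 ^ 2 + y₂ 0 ^ 2) * ((y₁ t * z₁ t + y₂ t * z₂ t) / (y₁ t ^ 2 + y₂ t ^ 2))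
      - (y₁ 0 * z₂ 0 - y₂ 0 * z₁ 0) * quadTerm B φ t) fun t ht => by
      refine ((((((hy.deriv_fst t ht).mul (hz.deriv_fst t ht)).add ((hy.deriv_snd t ht).mul
        (hz.deriv_snd t ht))).div (hy.hasDerivAt_norm_sq ht) (h0 t ht)).const_mul _).sub
        ((hφ.hasDerivAt_quadTerm hB t).const_mul _)).congr_deriv ?_
      have h3 := h0 t ht
      have hs : Real.sin (φ t) = 2 * y₁ t * y₂ t / (y₁ t ^ 2 + y₂ t ^ 2) := by
        rw [(hc t ht).2, mul_div_cancel_left₀ _ h3]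
      rw [← hdet t ht, hs, ← hexp t ht]
      simp only [Pi.add_apply, Pi.mul_apply]
      field_simp
      ring
  intro t ht
  have h3 := this t ht
  simp only [quadTerm_zero] at h3
  linear_combination -h3

end

/-- The vector is taken orthogonal to a nonzero row of the matrix minus `k`; if both rows vanish,
any vector serves. -/
theorem exists_eigenvector {a b c d k : ℝ} (h : k ^ 2 - (a + d) * k + (a * d - b * c) = 0) :
    ∃ v w : ℝ, v ^ 2 + w ^ 2 ≠ 0 ∧ a * v + b * w = k * v ∧ c * v + d * w = k * w := by
  by_cases h1 : b ^ 2 + (k - a) ^ 2 = 0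
  · have hb : b = 0 := by nlinarith [sq_nonneg b, sq_nonneg (k - a)]
    have ha : k - a = 0 := by nlinarith [sq_nonneg b, sq_nonneg (k - a)]
    by_cases h2 : (k - d) ^ 2 + c ^ 2 = 0
    · have hc : c = 0 := by nlinarith [sq_nonneg c, sq_nonneg (k - d)]
      exact ⟨1, 0, by norm_num, by linarith, by rw [hc]; ring⟩
    · exact ⟨k - d, c, h2, by rw [hb]; linear_combination -(k - d) * ha, by ring⟩
  · exact ⟨b, k - a, h1, by ring, by linear_combination -h⟩

section

variable {A B y₁ y₂ z₁ z₂ : ℝ → ℝ} {μ q₁₁ q₁₂ q₂₁ q₂₂ : ℝ}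

/-- Closed solutions from the monodromy `1 + μ Q`, when `det Q ≤ 0`. -/
theorem exists_isClosedSolution_of_det_nonpos (hy : IsLift A B y₁ y₂) (hz : IsLift A B z₁ z₂)
    (hA : ContDiff ℝ ∞ A) (hB : ContDiff ℝ ∞ B) (hAp : ∀ t, A (t + 2 * Real.pi) = A t)
    (hBp : ∀ t, B (t + 2 * Real.pi) = B t) (hμ : μ ≠ 0)
    (i1 : y₁ 0 = 1) (i2 : y₂ 0 = 0) (i3 : z₁ 0 = 0) (i4 : z₂ 0 = 1)
    (f1 : y₁ (2 * Real.pi) = 1 + μ * q₁₁) (f2 : y₂ (2 * Real.pi) = μ * q₂₁)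
    (f3 : z₁ (2 * Real.pi) = μ * q₁₂) (f4 : z₂ (2 * Real.pi) = 1 + μ * q₂₂)
    (hdet : q₁₁ * q₂₂ - q₁₂ * q₂₁ ≤ 0) (hq : q₂₂ ≠ 0) :
    ∃ φ, IsClosedSolution A B φ ∧
      (q₁₁ * q₂₂ - q₁₂ * q₂₁ < 0 → logDer B φ (2 * Real.pi) ≠ 0) ∧
      (q₁₁ * q₂₂ - q₁₂ * q₂₁ = 0 →
        logDer B φ (2 * Real.pi) = 0 ∧ quadTerm B φ (2 * Real.pi) ≠ 0) := by
  have hm0 : (0 : ℝ) ∈ Icc 0 (2 * Real.pi) := ⟨le_rfl, Real.two_pi_pos.le⟩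
  have hm1 : 2 * Real.pi ∈ Icc 0 (2 * Real.pi) := ⟨Real.two_pi_pos.le, le_rfl⟩
  have hd := hy.det_eq hz _ hm1
  rw [f1, f2, f3, f4, i1, i2, i3, i4] at hd
  -- This is `det(1 + μQ) = 1` divided by `μ`.
  have htr : q₁₁ + q₂₂ = -μ * (q₁₁ * q₂₂ - q₁₂ * q₂₁) := by
    refine mul_left_cancel₀ hμ ?_
    linear_combination hd
  obtain ⟨k, hk⟩ : ∃ k, k ^ 2 - (q₁₁ + q₂₂) * k + (q₁₁ * q₂₂ - q₁₂ * q₂₁) = 0 := by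
    have hdisc : 0 ≤ (q₁₁ + q₂₂) ^ 2 - 4 * (q₁₁ * q₂₂ - q₁₂ * q₂₁) := by
      nlinarith [sq_nonneg (q₁₁ + q₂₂)]
    refine ⟨((q₁₁ + q₂₂) + Real.sqrt ((q₁₁ + q₂₂) ^ 2 - 4 * (q₁₁ * q₂₂ - q₁₂ * q₂₁))) / 2, ?_⟩
    have := Real.sq_sqrt hdisc
    linear_combination this / 4
  obtain ⟨v, w, hvw, e1, e2⟩ := exists_eigenvector hk
  have hY := hy.combination hz v w
  -- The second solution starts from the eigenvector turned by a right angle, so that initially `y ·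
  -- z = 0` and `det(y, z) = |y|²`.
  have hZ := hy.combination hz (-w) v
  have hdet2 : ∀ t ∈ Icc 0 (2 * Real.pi), y₁ t * z₂ t - y₂ t * z₁ t = 1 := fun t ht => by
    rw [hy.det_eq hz t ht, i1, i2, i3, i4]; norm_num
  have hne : ∀ t ∈ Icc 0 (2 * Real.pi),
      (v * y₁ t + w * z₁ t) ^ 2 + (v * y₂ t + w * z₂ t) ^ 2 ≠ 0 := fun t ht h0 => by
    have g1 : v * y₁ t + w * z₁ t = 0 := by
      nlinarith [sq_nonneg (v * y₁ t + w * z₁ t), sq_nonneg (v * y₂ t + w * z₂ t)]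
    have g2 : v * y₂ t + w * z₂ t = 0 := by
      nlinarith [sq_nonneg (v * y₁ t + w * z₁ t), sq_nonneg (v * y₂ t + w * z₂ t)]
    have g3 := hdet2 t ht
    have hv : v = 0 := by linear_combination z₂ t * g1 - z₁ t * g2 - v * g3
    have hw : w = 0 := by linear_combination y₁ t * g2 - y₂ t * g1 - w * g3
    exact hvw (by rw [hv, hw]; norm_num)
  have hν : (1 + μ * k) ^ 2 - (2 + μ * (q₁₁ + q₂₂)) * (1 + μ * k) + 1 = 0 := by
    linear_combination μ ^ 2 * hk - hd
  have hν0 : 1 + μ * k ≠ 0 := fun h => by rw [h] at hν; norm_num at hν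
  have e3 : v * y₁ (2 * Real.pi) + w * z₁ (2 * Real.pi) = (1 + μ * k) * (v * y₁ 0 + w * z₁ 0) := by
    rw [f1, f3, i1, i3]; linear_combination μ * e1
  have e4 : v * y₂ (2 * Real.pi) + w * z₂ (2 * Real.pi) = (1 + μ * k) * (v * y₂ 0 + w * z₂ 0) := by
    rw [f2, f4, i2, i4]; linear_combination μ * e2
  obtain ⟨φ, hφ, hcs⟩ := hY.exists_isClosedSolution hA hB hAp hBp hne hν0 e3 e4
  have hexp := hY.exp_logDer hB hφ (fun t ht => (hcs t ht).1) _ hm1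
  simp only [e3, e4] at hexp
  have hexp2 : Real.exp (logDer B φ (2 * Real.pi)) * (1 + μ * k) ^ 2 = 1 := by
    refine mul_right_cancel₀ (hne 0 hm0) ?_
    linear_combination hexp
  refine ⟨φ, hφ, fun hneg hI => ?_, fun h0 => ?_⟩
  -- A trivial multiplier means that the eigenvalue `1 + μk` is `±1`, so the monodromy has trace
  -- `±2`; but its trace is `2 - μ² det Q > 2`.
  · rw [hI, Real.exp_zero, one_mul] at hexp2
    have hμ2 : 0 < μ ^ 2 := by positivity
    have h3 : (2 + μ * (q₁₁ + q₂₂)) * (1 + μ * k) = 2 := by linarith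
    have h4 : (2 + μ * (q₁₁ + q₂₂)) ^ 2 = 4 := by
      have : ((2 + μ * (q₁₁ + q₂₂)) * (1 + μ * k)) ^ 2 = 4 := by rw [h3]; norm_num
      rw [mul_pow, hexp2, mul_one] at this
      exact this
    rw [htr] at h4
    have h5 : 0 < μ ^ 2 * -(q₁₁ * q₂₂ - q₁₂ * q₂₁) := mul_pos hμ2 (by linarith)
    have h6 : (μ ^ 2 * -(q₁₁ * q₂₂ - q₁₂ * q₂₁)) * (μ ^ 2 * -(q₁₁ * q₂₂ - q₁₂ * q₂₁) + 4) = 0 := by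
      linear_combination h4
    exact (mul_pos h5 (by linarith)).ne' h6
  · have htr0 : q₁₁ + q₂₂ = 0 := by rw [htr, h0, mul_zero]
    have hk0 : k = 0 := by
      rw [h0, htr0] at hk
      exact pow_eq_zero_iff two_ne_zero |>.1 (by linarith)
    subst hk0
    constructor
    · simpa using hexp2
    -- Let `Y`, `Z` be the two orthogonal initial vectors, so `QY = 0`. If `J = 0` then also `Y · QZ
    -- = 0`, and `tr Q = 0` gives `Z · QZ = 0`. So `Q` would vanish, against `q₂₂ ≠ 0`.
    · intro hJ
      have h3 := hY.quadTerm_eq hZ hB hφ hne hcs _ hm1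
      rw [hJ, mul_zero, i1, i2, i3, i4, f1, f2, f3, f4] at h3
      have h4 := (mul_eq_zero.1 h3.symm).resolve_left (by
        simpa using hvw)
      have g1 : v * (1 + μ * q₁₁) + w * (μ * q₁₂) = v := by linear_combination μ * e1
      have g2 : v * (μ * q₂₁) + w * (1 + μ * q₂₂) = w := by linear_combination μ * e2
      rw [g1, g2] at h4
      have h5 : v * (-w * (1 + μ * q₁₁) + v * (μ * q₁₂)) +
          w * (-w * (μ * q₂₁) + v * (1 + μ * q₂₂)) = 0 := by
        have : (v * (-w * (1 + μ * q₁₁) + v * (μ * q₁₂)) +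
          w * (-w * (μ * q₂₁) + v * (1 + μ * q₂₂))) / (v ^ 2 + w ^ 2) = 0 := by
          rw [← h4]; ring
        exact (div_eq_zero_iff.1 this).resolve_right hvw
      have h6 : (μ * q₂₂) * (v ^ 2 + w ^ 2) = 0 := by
        have h7 : (μ * (-w * q₂₁ + v * q₂₂)) * (v ^ 2 + w ^ 2) = 0 := by
          linear_combination w * h5 - μ * v * w * e2 - μ * v ^ 2 * e1 + μ * v * (v ^ 2 + w ^ 2) * htr0
        have h8 := (mul_eq_zero.1 h7).resolve_right hvw
        linear_combination v * h8 + μ * w * e2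
      exact (mul_ne_zero (mul_ne_zero hμ hq) hvw) h6

end

/-! ### Zeros of the determinant and the bifurcation -/

theorem isInvertible_smulRight_one {k : ℝ} (hk : k ≠ 0) {L : ℝ →L[ℝ] ℝ} (hL : L 1 = k) :
    L.IsInvertible := by
  refine ⟨ContinuousLinearEquiv.unitsEquivAut ℝ (Units.mk0 k hk), ?_⟩
  ext
  simp [hL]

/-- At `μ = 0` the function has the simple zero `η = 1`. Global uniqueness on `(1/2, 2)` comes from
monotonicity, and smoothness from the implicit function theorem. The sign on the whole of `[0, e μ)`
is what excludes further bifurcations in between. -/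
theorem exists_smooth_root {D : Set (ℝ × ℝ)} {g : ℝ × ℝ → ℝ} (hD : IsOpen D)
    (h0 : ∀ η, ((0 : ℝ), η) ∈ D) (hg : ContDiffOn ℝ ∞ g D) {K : ℝ} (hK : 0 < K)
    (hg0 : ∀ η, g (0, η) = K * (1 - η ^ 2)) :
    ∃ (e : ℝ → ℝ) (δ : ℝ), 0 < δ ∧ ContDiffOn ℝ ∞ e (Ioo (-δ) δ) ∧ e 0 = 1 ∧
      ∀ μ ∈ Ioo (-δ) δ, e μ ∈ Ioo (1 / 2) 2 ∧ g (μ, e μ) = 0 ∧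
        ∀ η ∈ Ico 0 (e μ), 0 < g (μ, η) := by
  have hga : ∀ p ∈ D, ContDiffAt ℝ ∞ g p := fun p hp => hg.contDiffAt (hD.mem_nhds hp)
  have hgd : ∀ p ∈ D, HasDerivAt (fun η => g (p.1, η)) (fderiv ℝ g p (0, 1)) p.2 := by
    intro p hp
    have h1 := ((hga p hp).differentiableAt (by simp)).hasFDerivAt
    have h2 : HasDerivAt (fun η : ℝ => (p.1, η)) ((0 : ℝ), (1 : ℝ)) p.2 :=
      (hasDerivAt_const _ _).prodMk (hasDerivAt_id _)
    exact HasFDerivAt.comp_hasDerivAt p.2 h1 h2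
  have hd0 : ∀ η, fderiv ℝ g (0, η) (0, 1) = -(2 * K * η) := by
    intro η
    have h1 := hgd (0, η) (h0 η)
    simp only [hg0] at h1
    have h2 : HasDerivAt (fun η : ℝ => K * (1 - η ^ 2)) (-(2 * K * η)) η := by
      refine ((((hasDerivAt_id η).pow 2).const_sub 1).const_mul K).congr_deriv ?_
      simp; ring
    exact h1.unique h2
  -- The `η`-derivative `-2Kη` degenerates at `0`, so monotonicity is used only from `1/4` on, and
  -- on `[0, 1/2]` positivity is used directly. Compactness makes each condition persist for small
  -- `μ`.
  have hev : ∀ᶠ μ in 𝓝 (0 : ℝ), (∀ η ∈ Icc (0 : ℝ) (1 / 2), 0 < g (μ, η)) ∧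
      (∀ η ∈ Icc (1 / 4 : ℝ) 2, (μ, η) ∈ D ∧ fderiv ℝ g (μ, η) (0, 1) < 0) ∧ g (μ, 2) < 0 := by
    refine Eventually.and ?_ (Eventually.and ?_ ?_)
    · refine isCompact_Icc.eventually_forall_of_forall_eventually fun η hη => ?_
      refine (hga _ (h0 η)).continuousAt.eventually (lt_mem_nhds ?_)
      rw [hg0]
      have := hη.1; have := hη.2
      exact mul_pos hK (by nlinarith)
    · refine isCompact_Icc.eventually_forall_of_forall_eventually fun η hη => ?_
      refine Eventually.and (hD.mem_nhds (h0 η)) ?_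
      have h1 : ContinuousAt (fun p => fderiv ℝ g p (0, 1)) ((0 : ℝ), η) :=
        ((hga _ (h0 η)).continuousAt_fderiv (by simp)).clm_apply continuousAt_const
      refine h1.eventually (gt_mem_nhds ?_)
      simp only [hd0]
      have := mul_pos hK (show 0 < η by linarith [hη.1])
      linarith
    · have h1 : ContinuousAt (fun μ : ℝ => g (μ, 2)) 0 :=
        ContinuousAt.comp (f := fun μ : ℝ => (μ, (2 : ℝ))) (hga _ (h0 2)).continuousAt
          (by fun_prop)
      refine h1.eventually (gt_mem_nhds ?_)
      simp only [hg0]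
      nlinarith
  obtain ⟨δ, hδ, hev⟩ := Metric.eventually_nhds_iff_ball.1 hev
  rw [Real.ball_eq_Ioo, zero_sub, zero_add] at hev
  have hanti : ∀ μ ∈ Ioo (-δ) δ, StrictAntiOn (fun η => g (μ, η)) (Icc (1 / 4) 2) := by
    intro μ hμ
    refine strictAntiOn_of_deriv_neg (convex_Icc _ _) ?_ ?_
    · exact fun η hη => (hgd (μ, η) ((hev μ hμ).2.1 η hη).1).continuousAt.continuousWithinAt
    · intro η hη
      have h1 := (hev μ hμ).2.1 η (interior_subset hη)
      rw [(hgd (μ, η) h1.1).deriv]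
      exact h1.2
  have hroot : ∀ μ ∈ Ioo (-δ) δ, ∃ η ∈ Ioo (1 / 2 : ℝ) 2, g (μ, η) = 0 := by
    intro μ hμ
    have h1 : ContinuousOn (fun η => g (μ, η)) (Icc (1 / 2) 2) := fun η hη =>
      (hgd (μ, η) ((hev μ hμ).2.1 η ⟨by linarith [hη.1], hη.2⟩).1).continuousAt.continuousWithinAt
    exact intermediate_value_Ioo' (by norm_num) h1
      ⟨(hev μ hμ).2.2, (hev μ hμ).1 _ ⟨by norm_num, le_rfl⟩⟩
  choose! e he using hroot
  have huniq : ∀ μ ∈ Ioo (-δ) δ, ∀ η ∈ Ioo (1 / 2 : ℝ) 2, g (μ, η) = 0 → η = e μ := by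
    intro μ hμ η hη h
    have h1 := (he μ hμ).1
    exact (hanti μ hμ).injOn ⟨by linarith [hη.1], hη.2.le⟩ ⟨by linarith [h1.1], h1.2.le⟩
      (h.trans (he μ hμ).2.symm)
  have hsub : ∀ η ∈ Ioo (1 / 2 : ℝ) 2, η ∈ Icc (1 / 4 : ℝ) 2 := fun η hη =>
    ⟨by linarith [hη.1], hη.2.le⟩
  refine ⟨e, δ, hδ, ?_, ?_, ?_⟩
  · intro μ hμ
    refine ContDiffAt.contDiffWithinAt ?_
    have h1 := (hev μ hμ).2.1 _ (hsub _ (he μ hμ).1)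
    have h2 := hga _ h1.1
    have h3 : (fderiv ℝ g (μ, e μ) ∘L .inr ℝ ℝ ℝ).IsInvertible :=
      isInvertible_smulRight_one h1.2.ne (by simp)
    have h4 := h2.contDiffAt_implicitFunction (by simp) h3
    -- Near each point the local implicit function takes values in `(1/2, 2)`, so it agrees with `e`
    -- by uniqueness of the zero.
    refine h4.congr_of_eventuallyEq ?_
    have h5 := h2.eventually_apply_implicitFunction (by simp) h3
    have h6 := h4.continuousAt.eventually (p := fun η => η ∈ Ioo (1 / 2 : ℝ) 2) (by
      rw [h2.implicitFunction_apply_self (by simp) h3]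
      exact Ioo_mem_nhds (he μ hμ).1.1 (he μ hμ).1.2)
    filter_upwards [h5, h6, Ioo_mem_nhds hμ.1 hμ.2] with x hx1 hx2 hx3
    exact (huniq x hx3 _ hx2 (hx1.trans (he μ hμ).2)).symm
  · exact (huniq 0 ⟨by linarith, hδ⟩ 1 (by norm_num) (by simp [hg0])).symm
  · intro μ hμ
    refine ⟨(he μ hμ).1, (he μ hμ).2, fun η hη => ?_⟩
    rcases le_or_gt η (1 / 2) with h | h
    · exact (hev μ hμ).1 η ⟨hη.1, h⟩
    · have h1 := (he μ hμ).1
      have := hanti μ hμ ⟨by linarith, by linarith [hη.2, h1.2]⟩ (hsub _ h1) hη.2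
      simpa [(he μ hμ).2] using this

/-- The difference is `μ(e(μ) - e(0))`, and `e` is differentiable at `0`. -/
theorem isBigO_mul_sub_self {e : ℝ → ℝ} {δ : ℝ} (hδ : 0 < δ) (he : ContDiffOn ℝ ∞ e (Ioo (-δ) δ))
    (h0 : e 0 = 1) : (fun μ => μ * e μ - μ) =O[𝓝 0] fun μ => μ ^ 2 := by
  have h1 : DifferentiableAt ℝ e 0 :=
    ((he.contDiffAt (Ioo_mem_nhds (by linarith) hδ)).differentiableAt (by simp))
  have h2 := h1.isBigO_sub
  rw [h0] at h2
  have h3 := (isBigO_refl (fun μ : ℝ => μ) (𝓝 0)).mul h2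
  refine (h3.congr_left fun μ => by ring).congr_right fun μ => by ring

theorem exists_bifurcation {a b : (ℝ × ℝ) × ℝ → ℝ} (ha : ContDiff ℝ ∞ a) (hb : ContDiff ℝ ∞ b)
    (hap : ∀ p t, a (p, t + 2 * Real.pi) = a (p, t))
    (hbp : ∀ p t, b (p, t + 2 * Real.pi) = b (p, t)) {k : ℝ} (hk : 0 < k)
    (ha0 : ∀ η, ∫ t in (0 : ℝ)..(2 * Real.pi), a ((0, η), t) = η * k)
    (hb0 : ∀ η, ∫ t in (0 : ℝ)..(2 * Real.pi), b ((0, η), t) = k) :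
    ∃ (e₁ e₂ : ℝ → ℝ) (δ : ℝ), 0 < δ ∧ ContDiffOn ℝ ∞ e₁ (Ioo (-δ) δ) ∧
      ContDiffOn ℝ ∞ e₂ (Ioo (-δ) δ) ∧ e₁ 0 = 1 ∧ e₂ 0 = 1 ∧
      ∀ μ ∈ Ioo 0 δ, e₁ μ ∈ Ioo 0 2 ∧ e₂ μ ∈ Ioo 0 2 ∧ ∀ η ∈ Icc (-e₁ μ) (e₂ μ),
        ∃ φ, IsClosedSolution (fun t => μ * a ((μ, η), t)) (fun t => μ * b ((μ, η), t)) φ ∧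
          (η ∈ Ioo (-e₁ μ) (e₂ μ) → logDer (fun t => μ * b ((μ, η), t)) φ (2 * Real.pi) ≠ 0) ∧
          (η = -e₁ μ ∨ η = e₂ μ → logDer (fun t => μ * b ((μ, η), t)) φ (2 * Real.pi) = 0 ∧
            quadTerm (fun t => μ * b ((μ, η), t)) φ (2 * Real.pi) ≠ 0) := by
  obtain ⟨D, q₁₁, q₁₂, q₂₁, q₂₂, hD, hD0, h11, h12, h21, h22, h0, hsol⟩ := exists_monodromy ha hb
  set g : ℝ × ℝ → ℝ := fun p => -(q₁₁ p * q₂₂ p - q₁₂ p * q₂₁ p) with hgdef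
  have hg : ContDiffOn ℝ ∞ g D := ((h11.mul h22).sub (h12.mul h21)).neg
  have hg0 : ∀ η, g (0, η) = k ^ 2 / 4 * (1 - η ^ 2) := by
    intro η
    obtain ⟨e1, e2, e3, e4⟩ := h0 η
    simp only [hgdef, e1, e2, e3, e4, ha0, hb0]
    ring
  have hK : 0 < k ^ 2 / 4 := by positivity
  obtain ⟨e₂, δ₂, hδ₂, hs₂, h20, hr₂⟩ := exists_smooth_root hD hD0 hg hK hg0
  -- The root near `η = -1` is obtained from the other case by reflecting `η`.
  have hσ : ContDiff ℝ ∞ fun p : ℝ × ℝ => (p.1, -p.2) := by fun_prop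
  obtain ⟨e₁, δ₁, hδ₁, hs₁, h10, hr₁⟩ := exists_smooth_root (g := fun p => g (p.1, -p.2))
    (hD.preimage hσ.continuous) (fun η => hD0 (-η)) (hg.comp hσ.contDiffOn fun p hp => hp) hK
    (fun η => by simp [hg0])
  -- At `μ = 0` this entry is `k/2`. The interval `[-2, 2]` contains every `η` that occurs, because
  -- both roots stay below `2`.
  have hq : ∀ᶠ μ in 𝓝 (0 : ℝ), ∀ η ∈ Icc (-2 : ℝ) 2, (μ, η) ∈ D ∧ 0 < q₂₂ (μ, η) := by
    refine isCompact_Icc.eventually_forall_of_forall_eventually fun η _ => ?_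
    have h1 := hD.mem_nhds (hD0 η)
    refine Eventually.and h1 ((h22.continuousOn.continuousAt h1).eventually (lt_mem_nhds ?_))
    simp only [(h0 η).2.2.2, hb0]
    positivity
  obtain ⟨δ₃, hδ₃, hq⟩ := Metric.eventually_nhds_iff_ball.1 hq
  rw [Real.ball_eq_Ioo, zero_sub, zero_add] at hq
  have l1 : min δ₁ (min δ₂ δ₃) ≤ δ₁ := min_le_left _ _
  have l2 : min δ₁ (min δ₂ δ₃) ≤ δ₂ := (min_le_right _ _).trans (min_le_left _ _)
  have l3 : min δ₁ (min δ₂ δ₃) ≤ δ₃ := (min_le_right _ _).trans (min_le_right _ _)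
  refine ⟨e₁, e₂, min δ₁ (min δ₂ δ₃), lt_min hδ₁ (lt_min hδ₂ hδ₃),
    hs₁.mono (Ioo_subset_Ioo (neg_le_neg l1) l1), hs₂.mono (Ioo_subset_Ioo (neg_le_neg l2) l2),
    h10, h20, fun μ hμ => ?_⟩
  obtain ⟨a1, a2, a3⟩ := hr₁ μ ⟨by linarith [hμ.1], hμ.2.trans_le l1⟩
  obtain ⟨b1, b2, b3⟩ := hr₂ μ ⟨by linarith [hμ.1], hμ.2.trans_le l2⟩
  refine ⟨⟨by linarith [a1.1], a1.2⟩, ⟨by linarith [b1.1], b1.2⟩, fun η hη => ?_⟩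
  have hin : η ∈ Ioo (-e₁ μ) (e₂ μ) → 0 < g (μ, η) := by
    intro h
    rcases le_total 0 η with h' | h'
    · exact b3 η ⟨h', h.2⟩
    · have := a3 (-η) ⟨by linarith, by linarith [h.1]⟩
      simpa using this
  have hend : η = -e₁ μ ∨ η = e₂ μ → g (μ, η) = 0 := by
    rintro (rfl | rfl)
    · exact a2
    · exact b2
  have hnn : 0 ≤ g (μ, η) := by
    rcases eq_or_lt_of_le hη.1 with h | h
    · exact (hend (Or.inl h.symm)).ge
    · rcases eq_or_lt_of_le hη.2 with h' | h'
      · exact (hend (Or.inr h')).ge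
      · exact (hin ⟨h, h'⟩).le
  obtain ⟨hmem, hpos⟩ := hq μ ⟨by linarith [hμ.1], hμ.2.trans_le l3⟩ η
    ⟨by linarith [hη.1, a1.2], by linarith [hη.2, b1.2]⟩
  obtain ⟨y₁, y₂, z₁, z₂, hy, hz, i1, i2, i3, i4, f1, f2, f3, f4⟩ := hsol (μ, η) hmem
  have hslice : ContDiff ℝ ∞ fun t : ℝ => ((μ, η), t) := by fun_prop
  obtain ⟨φ, c1, c2, c3⟩ := exists_isClosedSolution_of_det_nonpos
    (hy.isLift (A := fun t => μ * a ((μ, η), t)) (B := fun t => μ * b ((μ, η), t))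
      (fun _ => rfl) fun _ => rfl)
    (hz.isLift (fun _ => rfl) fun _ => rfl) (contDiff_const.mul (ha.comp hslice))
    (contDiff_const.mul (hb.comp hslice)) (fun t => by simp only [hap]) (fun t => by simp only [hbp])
    hμ.1.ne' i1 i2 i3 i4 f1 f2 f3 f4 (neg_nonneg.1 hnn) hpos.ne'
  exact ⟨φ, c1, fun h => c2 (neg_pos.1 (hin h)), fun h => c3 (neg_eq_zero.1 (hend h))⟩

/-! ### The ellipse and its perturbed center curve -/

theorem hasDerivAt_vec {x y w : ℝ → ℝ} {x' y' w' t : ℝ} (hx : HasDerivAt x x' t)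
    (hy : HasDerivAt y y' t) (hw : HasDerivAt w w' t) :
    HasDerivAt (fun t => (!₂[x t, y t, w t] : E3)) !₂[x', y', w'] t := by
  have h : HasDerivAt (fun t => ![x t, y t, w t]) ![x', y', w'] t := by
    rw [hasDerivAt_pi]
    intro i
    fin_cases i <;> simpa
  exact (PiLp.continuousLinearEquiv 2 ℝ (fun _ : Fin 3 => ℝ)).symm.hasFDerivAt.comp_hasDerivAt t h

theorem ellipse_speed_sq_pos (t : ℝ) : 0 < 4 - 3 * Real.cos t ^ 2 := by
  nlinarith [Real.cos_sq_le_one t]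

section

local notation "ζ" => ellipseCurvatureDot
local notation "ζ₁" => deriv ellipseCurvatureDot
local notation "ζ₂" => deriv (deriv ellipseCurvatureDot)
local notation "ζ₃" => deriv (deriv (deriv ellipseCurvatureDot))

theorem contDiff_ellipseCurvatureDot : ContDiff ℝ ∞ ζ := by
  have h1 : ContDiff ℝ ∞ fun t => 4 - 3 * Real.cos t ^ 2 := by fun_prop
  refine ContDiff.div (by fun_prop) (h1.rpow_const_of_ne fun t => (ellipse_speed_sq_pos t).ne') ?_
  exact fun t => (Real.rpow_pos_of_pos (ellipse_speed_sq_pos t) _).ne'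

theorem ellipseCurvatureDot_periodic : Function.Periodic ζ (2 * Real.pi) := fun t => by
  simp [ellipseCurvatureDot]

theorem ellipseCurvatureDot_neg (t : ℝ) : ζ (-t) = -ζ t := by
  simp [ellipseCurvatureDot, neg_div]

theorem Function.Periodic.deriv {f : ℝ → ℝ} {T : ℝ} (h : Function.Periodic f T) :
    Function.Periodic (deriv f) T := fun t => by
  rw [← deriv_comp_add_const, h.funext]

theorem contDiff_centerCurve (ε : ℝ) : ContDiff ℝ ∞ (centerCurve ε) := by
  have := contDiff_ellipseCurvatureDot
  rw [contDiff_euclidean]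
  intro i
  fin_cases i <;> simp [centerCurve] <;> fun_prop

theorem deriv_centerCurve (ε : ℝ) :
    deriv (centerCurve ε) = fun t => !₂[-(2 * Real.sin t), Real.cos t, ε * ζ₁ t] := by
  funext t
  refine HasDerivAt.deriv (hasDerivAt_vec ?_ (Real.hasDerivAt_sin t)
    ((hasDerivAt_deriv contDiff_ellipseCurvatureDot t).const_mul ε))
  exact ((Real.hasDerivAt_cos t).const_mul 2).congr_deriv (by ring)

theorem deriv_deriv_centerCurve (ε : ℝ) :
    deriv (deriv (centerCurve ε)) =
      fun t => !₂[-(2 * Real.cos t), -Real.sin t, ε * ζ₂ t] := by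
  funext t
  rw [deriv_centerCurve]
  exact HasDerivAt.deriv (hasDerivAt_vec ((Real.hasDerivAt_sin t).const_mul 2).neg
    (Real.hasDerivAt_cos t)
    ((hasDerivAt_deriv (contDiff_deriv contDiff_ellipseCurvatureDot) t).const_mul ε))

theorem deriv_deriv_deriv_centerCurve (ε : ℝ) :
    deriv (deriv (deriv (centerCurve ε))) =
      fun t => !₂[2 * Real.sin t, -Real.cos t, ε * ζ₃ t] := by
  funext t
  rw [deriv_deriv_centerCurve]
  refine HasDerivAt.deriv (hasDerivAt_vec ?_ (Real.hasDerivAt_sin t).neg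
    ((hasDerivAt_deriv (contDiff_deriv (contDiff_deriv contDiff_ellipseCurvatureDot)) t).const_mul
      ε))
  exact ((Real.hasDerivAt_cos t).const_mul 2).neg.congr_deriv (by ring)

/-- `|ċ|²` as a function of `ε` and `t`. -/
noncomputable def speedSq (ε t : ℝ) : ℝ := 4 - 3 * Real.cos t ^ 2 + ε ^ 2 * ζ₁ t ^ 2

/-- `|ċ ∧ c̈|²` as a function of `ε` and `t`. -/
noncomputable def bendSq (ε t : ℝ) : ℝ :=
  4 + ε ^ 2 * ((Real.cos t * ζ₂ t + Real.sin t * ζ₁ t) ^ 2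
    + 4 * (Real.sin t * ζ₂ t - Real.cos t * ζ₁ t) ^ 2)

theorem one_le_speedSq (ε t : ℝ) : 1 ≤ speedSq ε t := by
  have := mul_nonneg (sq_nonneg ε) (sq_nonneg (ζ₁ t))
  rw [speedSq]
  nlinarith [Real.cos_sq_le_one t]

theorem four_le_bendSq (ε t : ℝ) : 4 ≤ bendSq ε t := by
  rw [bendSq]
  exact le_add_of_nonneg_right (by positivity)

theorem contDiff_speedSq : ContDiff ℝ ∞ fun p : ℝ × ℝ => speedSq p.1 p.2 := by
  have h1 := (contDiff_deriv contDiff_ellipseCurvatureDot).comp (contDiff_snd (E := ℝ) (F := ℝ))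
  exact (contDiff_const.sub (contDiff_const.mul ((Real.contDiff_cos.comp contDiff_snd).pow 2))).add
    ((contDiff_fst.pow 2).mul (h1.pow 2))

theorem contDiff_bendSq : ContDiff ℝ ∞ fun p : ℝ × ℝ => bendSq p.1 p.2 := by
  have h0 := contDiff_deriv contDiff_ellipseCurvatureDot
  have h1 := h0.comp (contDiff_snd (E := ℝ) (F := ℝ))
  have h2 := (contDiff_deriv h0).comp (contDiff_snd (E := ℝ) (F := ℝ))
  have hc := Real.contDiff_cos.comp (n := ∞) (contDiff_snd (E := ℝ) (F := ℝ))
  have hs := Real.contDiff_sin.comp (n := ∞) (contDiff_snd (E := ℝ) (F := ℝ))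
  exact contDiff_const.add ((contDiff_fst.pow 2).mul
    ((((hc.mul h2).add (hs.mul h1)).pow 2).add
      (contDiff_const.mul (((hs.mul h2).sub (hc.mul h1)).pow 2))))

theorem speed_centerCurve (ε t : ℝ) : speed (centerCurve ε) t = √(speedSq ε t) := by
  rw [speed, ← Real.sqrt_sq (norm_nonneg _), ← real_inner_self_eq_norm_sq, deriv_centerCurve,
    inner_eq]
  congr 1
  simp [speedSq]
  linear_combination 4 * Real.sin_sq_add_cos_sq t

/-- The last component is `2` for every `ε`, so the curvature never vanishes and the Frenet frame is
always defined. -/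
theorem cross_centerCurve (ε t : ℝ) :
    cross (deriv (centerCurve ε) t) (deriv (deriv (centerCurve ε)) t) =
      !₂[ε * (Real.cos t * ζ₂ t + Real.sin t * ζ₁ t),
        ε * (2 * (Real.sin t * ζ₂ t - Real.cos t * ζ₁ t)), 2] := by
  rw [deriv_deriv_centerCurve, deriv_centerCurve]
  refine ext_three ?_ ?_ ?_
  · simp [cross_zero_apply]; ring
  · simp [cross_one_apply]; ring
  · simp [cross_two_apply]; linear_combination 2 * Real.sin_sq_add_cos_sq t

theorem norm_sq_cross_centerCurve (ε t : ℝ) :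
    ‖cross (deriv (centerCurve ε) t) (deriv (deriv (centerCurve ε)) t)‖ ^ 2 = bendSq ε t := by
  rw [← real_inner_self_eq_norm_sq, cross_centerCurve, inner_eq]
  simp [bendSq]
  ring

theorem cross_centerCurve_ne_zero (ε t : ℝ) :
    cross (deriv (centerCurve ε) t) (deriv (deriv (centerCurve ε)) t) ≠ 0 := fun h => by
  have h1 := norm_sq_cross_centerCurve ε t
  have h2 := four_le_bendSq ε t
  rw [h] at h1
  simp at h1
  linarith

theorem bending_centerCurve (ε t : ℝ) :
    bending (centerCurve ε) t = √(bendSq ε t) / speedSq ε t := by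
  rw [bending, speed_centerCurve, Real.sq_sqrt (by linarith [one_le_speedSq ε t]),
    ← norm_sq_cross_centerCurve, Real.sqrt_sq (norm_nonneg _)]

theorem twisting_centerCurve (ε t : ℝ) :
    twisting (centerCurve ε) t =
      √(speedSq ε t) * (2 * ε * (ζ₁ t + ζ₃ t)) / bendSq ε t := by
  rw [twisting, speed_centerCurve, norm_sq_cross_centerCurve, cross_centerCurve,
    deriv_deriv_deriv_centerCurve, inner_eq]
  congr 2
  simp
  linear_combination 2 * ε * ζ₁ t * Real.sin_sq_add_cos_sq t

theorem contDiff_radius (ρ μ : ℝ) : ContDiff ℝ ∞ (radius ρ μ) :=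
  contDiff_const.add (contDiff_const.mul contDiff_ellipseCurvatureDot)

theorem deriv_radius (ρ μ t : ℝ) : deriv (radius ρ μ) t = μ * ζ₁ t :=
  (((hasDerivAt_deriv contDiff_ellipseCurvatureDot t).const_mul μ).const_add ρ).deriv

theorem canalCos_centerCurve (ε ρ μ t : ℝ) :
    canalCos (centerCurve ε) (radius ρ μ) t = -(μ * ζ₁ t / √(speedSq ε t)) := by
  rw [canalCos, speed_centerCurve, deriv_radius]

theorem canalCos_div_canalSin {ε μ t : ℝ} (ρ : ℝ) :
    canalCos (centerCurve ε) (radius ρ μ) t / canalSin (centerCurve ε) (radius ρ μ) t =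
      -(μ * ζ₁ t) / √(speedSq ε t - μ ^ 2 * ζ₁ t ^ 2) := by
  have hV : 0 < speedSq ε t := by linarith [one_le_speedSq ε t]
  have hS := Real.sqrt_pos.2 hV
  have h1 : 1 - (-(μ * ζ₁ t / √(speedSq ε t))) ^ 2 =
      (speedSq ε t - μ ^ 2 * ζ₁ t ^ 2) / speedSq ε t := by
    rw [neg_sq, div_pow, Real.sq_sqrt hV.le]
    field_simp
  rw [canalSin, canalCos_centerCurve, h1, Real.sqrt_div' _ hV.le, ← neg_div,
    div_div_div_cancel_right₀ hS.ne']

theorem Function.Periodic.exists_abs_le {f : ℝ → ℝ} {T : ℝ} (h : Function.Periodic f T)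
    (hT : T ≠ 0) (hf : Continuous f) : ∃ M, 0 < M ∧ ∀ t, |f t| ≤ M := by
  obtain ⟨M, hM⟩ := (h.isBounded_of_continuous hT hf).exists_norm_le
  exact ⟨max M 1, by positivity, fun t => (hM _ (mem_range_self t)).trans (le_max_left _ _)⟩

/-- Replacing `μ` by `χ μ` under the square root of `cot θ` makes the coefficient smooth for all
parameter values without changing it for small `μ`. -/
theorem exists_smooth_cutoff {r : ℝ} (hr : 0 < r) : ∃ χ : ℝ → ℝ, ContDiff ℝ ∞ χ ∧
    (∀ μ, |χ μ| ≤ 2 * r) ∧ ∀ μ, |μ| ≤ r → χ μ = μ := by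
  let f : ContDiffBump (0 : ℝ) := ⟨r, 2 * r, hr, by linarith⟩
  refine ⟨fun μ => f μ * μ, f.contDiff.mul contDiff_id, fun μ => ?_, fun μ hμ => ?_⟩
  · rcases le_or_gt |μ| (2 * r) with h | h
    · rw [abs_mul, abs_of_nonneg f.nonneg]
      exact (mul_le_of_le_one_left (abs_nonneg _) f.le_one).trans h
    · simp only [f.zero_of_le_dist (show f.rOut ≤ dist μ 0 by simpa using h.le), zero_mul,
        abs_zero]
      positivity
  · simp only
    rw [f.one_of_mem_closedBall (by simpa using hμ), one_mul]

/-! ### Averages of the coefficients at `μ = 0` -/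

theorem hasDerivAt_sqrt_ellipse (t : ℝ) : HasDerivAt (fun t => √(4 - 3 * Real.cos t ^ 2))
    (3 * Real.cos t * Real.sin t / √(4 - 3 * Real.cos t ^ 2)) t := by
  have h1 : HasDerivAt (fun t => 4 - 3 * Real.cos t ^ 2) (6 * Real.cos t * Real.sin t) t := by
    refine ((((Real.hasDerivAt_cos t).pow 2).const_mul 3).const_sub 4).congr_deriv ?_
    norm_num
    ring
  refine (h1.sqrt (ellipse_speed_sq_pos t).ne').congr_deriv ?_
  have := (Real.sqrt_pos.2 (ellipse_speed_sq_pos t)).ne'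
  field_simp
  ring

theorem ellipseCurvature_eq (t : ℝ) :
    ellipseCurvature t = 2 / √(4 - 3 * Real.cos t ^ 2) ^ 3 := by
  have h := Real.rpow_mul_natCast (ellipse_speed_sq_pos t).le (1 / 2) 3
  rw [ellipseCurvature, Real.sqrt_eq_rpow, ← h]
  norm_num

/-- The speed `σ` of the ellipse satisfies `σ̈ + σ = 2κ`. -/
theorem hasDerivAt_deriv_sqrt_ellipse (t : ℝ) :
    HasDerivAt (fun t => 3 * Real.cos t * Real.sin t / √(4 - 3 * Real.cos t ^ 2))
      (2 * ellipseCurvature t - √(4 - 3 * Real.cos t ^ 2)) t := by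
  have h0 := Real.sqrt_pos.2 (ellipse_speed_sq_pos t)
  have h1 := ((((Real.hasDerivAt_cos t).const_mul 3).mul (Real.hasDerivAt_sin t)).div
    (hasDerivAt_sqrt_ellipse t) h0.ne')
  refine h1.congr_deriv ?_
  have h2 := Real.sq_sqrt (ellipse_speed_sq_pos t).le
  rw [ellipseCurvature_eq]
  have h3 := Real.sin_sq t
  simp only [Pi.mul_apply]
  generalize √(4 - 3 * Real.cos t ^ 2) = s at *
  generalize Real.cos t = c at *
  generalize Real.sin t = d at *
  field_simp
  have h4 : s ^ 4 = (4 - 3 * c ^ 2) ^ 2 := by rw [← h2]; ring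
  linear_combination (3 * (c ^ 2 - d ^ 2)) * h2 + h4 - (9 * c ^ 2 + 3 * (4 - 3 * c ^ 2)) * h3

theorem hasDerivAt_ellipseCurvatureDot (t : ℝ) : HasDerivAt ζ (ζ₁ t) t :=
  hasDerivAt_deriv contDiff_ellipseCurvatureDot t

theorem continuous_ellipseCurvatureDot : Continuous ζ := contDiff_ellipseCurvatureDot.continuous

theorem integral_deriv_eq_zero_of_periodic {f f' : ℝ → ℝ} (h : ∀ t, HasDerivAt f (f' t) t)
    (hf' : Continuous f') (hp : Function.Periodic f (2 * Real.pi)) :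
    ∫ t in (0 : ℝ)..(2 * Real.pi), f' t = 0 := by
  rw [intervalIntegral.integral_eq_sub_of_hasDerivAt (fun t _ => h t)
    (hf'.intervalIntegrable _ _), sub_eq_zero]
  simpa using hp 0

theorem continuous_ellipseCurvature : Continuous ellipseCurvature :=
  continuous_iff_continuousAt.2 fun t => (hasDerivAt_ellipseCurvature t).continuousAt

theorem ellipseCurvature_periodic : Function.Periodic ellipseCurvature (2 * Real.pi) := fun t => by
  simp [ellipseCurvature]

theorem integral_ellipseCurvature_mul :
    ∫ t in (0 : ℝ)..(2 * Real.pi), -(ellipseCurvature t * ζ₁ t) =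
      ∫ t in (0 : ℝ)..(2 * Real.pi), ζ t ^ 2 := by
  have hk := continuous_ellipseCurvature
  have hz := continuous_ellipseCurvatureDot
  have hz1 := (contDiff_deriv contDiff_ellipseCurvatureDot).continuous
  rw [← sub_eq_zero, ← intervalIntegral.integral_sub
    (by apply Continuous.intervalIntegrable; fun_prop)
    (by apply Continuous.intervalIntegrable; fun_prop)]
  refine integral_deriv_eq_zero_of_periodic (f := fun t => -(ellipseCurvature t * ζ t))
    (fun t => ?_) (by fun_prop) fun t => ?_
  · refine ((hasDerivAt_ellipseCurvature t).mul (hasDerivAt_ellipseCurvatureDot t)).neg.congr_deriv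
      ?_
    ring
  · simp only [ellipseCurvature_periodic t, ellipseCurvatureDot_periodic t]

/-- Two integrations by parts move the derivatives to `σ`, `σ̈ + σ = 2κ` turns the integrand into
`-κ κ̈`, and a third gives `κ̇²`. All boundary terms are gathered in one explicit periodic
primitive. -/
theorem integral_sqrt_ellipse_mul :
    ∫ t in (0 : ℝ)..(2 * Real.pi), -((ζ₁ t + ζ₃ t) * √(4 - 3 * Real.cos t ^ 2) / 2) =
      ∫ t in (0 : ℝ)..(2 * Real.pi), ζ t ^ 2 := by
  have c0 := contDiff_ellipseCurvatureDot
  have c1 := contDiff_deriv c0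
  have c2 := contDiff_deriv c1
  have hz := c0.continuous
  have hz1 := c1.continuous
  have hz3 := (contDiff_deriv c2).continuous
  have p1 := Function.Periodic.deriv ellipseCurvatureDot_periodic
  have p2 := Function.Periodic.deriv p1
  rw [← sub_eq_zero, ← intervalIntegral.integral_sub
    (by apply Continuous.intervalIntegrable; fun_prop)
    (by apply Continuous.intervalIntegrable; fun_prop)]
  refine integral_deriv_eq_zero_of_periodic (f := fun t => -((√(4 - 3 * Real.cos t ^ 2) * ζ₂ t
      - 3 * Real.cos t * Real.sin t / √(4 - 3 * Real.cos t ^ 2) * ζ₁ t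
      + 2 * ellipseCurvature t * ζ t) / 2))
    (fun t => ?_) (by fun_prop) fun t => ?_
  · refine ((((hasDerivAt_sqrt_ellipse t).mul (hasDerivAt_deriv c2 t)).sub
      ((hasDerivAt_deriv_sqrt_ellipse t).mul (hasDerivAt_deriv c1 t))).add
      (((hasDerivAt_ellipseCurvature t).const_mul 2).mul
        (hasDerivAt_ellipseCurvatureDot t))).div_const 2 |>.neg.congr_deriv ?_
    ring
  · simp only [ellipseCurvature_periodic t, ellipseCurvatureDot_periodic t, p1 t, p2 t,
      Real.cos_add_two_pi, Real.sin_add_two_pi]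

theorem integral_sq_ellipseCurvatureDot_pos :
    0 < ∫ t in (0 : ℝ)..(2 * Real.pi), ζ t ^ 2 := by
  have hz := continuous_ellipseCurvatureDot
  have hpi := Real.pi_pos
  refine intervalIntegral.integral_pos (by positivity) (by fun_prop) (fun t _ => sq_nonneg _)
    ⟨Real.pi / 4, ⟨by positivity, by linarith⟩, ?_⟩
  have h : ζ (Real.pi / 4) ≠ 0 := by
    have h1 := Real.cos_pi_div_four
    have h2 := Real.sin_pi_div_four
    have h3 := (Real.rpow_pos_of_pos (ellipse_speed_sq_pos (Real.pi / 4)) (5 / 2)).ne'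
    have h4 : Real.cos (Real.pi / 4) ≠ 0 := by rw [h1]; positivity
    have h5 : Real.sin (Real.pi / 4) ≠ 0 := by rw [h2]; positivity
    exact div_ne_zero (mul_ne_zero (mul_ne_zero (by norm_num) h4) h5) h3
  positivity

/-! ### The rescaled coefficients of the principal line equation -/

/-- The coefficient of `1` in the equation of the principal lines, divided by `μ`, as a function
of `μ`, `η = ε / μ` and `t`. -/
noncomputable def constCoeff (q : (ℝ × ℝ) × ℝ) : ℝ :=
  q.1.2 * -(√(speedSq (q.1.2 * q.1.1) q.2) * (2 * (ζ₁ q.2 + ζ₃ q.2)) /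
    bendSq (q.1.2 * q.1.1) q.2)

/-- The coefficient of `sin φ` in the equation of the principal lines, divided by `μ`, as a
function of `μ`, `η = ε / μ` and `t`; a cutoff `χ μ` replaces `μ` in the denominator. -/
noncomputable def sinCoeff (χ : ℝ → ℝ) (q : (ℝ × ℝ) × ℝ) : ℝ :=
  -(√(bendSq (q.1.2 * q.1.1) q.2) * ζ₁ q.2 / (speedSq (q.1.2 * q.1.1) q.2 *
    √(speedSq (q.1.2 * q.1.1) q.2 - χ q.1.1 ^ 2 * ζ₁ q.2 ^ 2)))

theorem speedSq_pos (ε t : ℝ) : 0 < speedSq ε t := by linarith [one_le_speedSq ε t]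

theorem bendSq_pos (ε t : ℝ) : 0 < bendSq ε t := by linarith [four_le_bendSq ε t]

theorem contDiff_deriv_ellipseCurvatureDot : ContDiff ℝ ∞ ζ₁ :=
  contDiff_deriv contDiff_ellipseCurvatureDot

theorem deriv_ellipseCurvatureDot_periodic : Function.Periodic ζ₁ (2 * Real.pi) :=
  Function.Periodic.deriv ellipseCurvatureDot_periodic

theorem speedSq_periodic (ε : ℝ) : Function.Periodic (speedSq ε) (2 * Real.pi) := fun t => by
  simp [speedSq, deriv_ellipseCurvatureDot_periodic t]

theorem bendSq_periodic (ε : ℝ) : Function.Periodic (bendSq ε) (2 * Real.pi) := fun t => by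
  simp [bendSq, deriv_ellipseCurvatureDot_periodic t,
    Function.Periodic.deriv deriv_ellipseCurvatureDot_periodic t]

theorem contDiff_speedSq_mul :
    ContDiff ℝ ∞ fun q : (ℝ × ℝ) × ℝ => speedSq (q.1.2 * q.1.1) q.2 :=
  ContDiff.comp (g := fun p : ℝ × ℝ => speedSq p.1 p.2)
    (f := fun q : (ℝ × ℝ) × ℝ => (q.1.2 * q.1.1, q.2)) contDiff_speedSq (by fun_prop)

theorem contDiff_bendSq_mul :
    ContDiff ℝ ∞ fun q : (ℝ × ℝ) × ℝ => bendSq (q.1.2 * q.1.1) q.2 :=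
  ContDiff.comp (g := fun p : ℝ × ℝ => bendSq p.1 p.2)
    (f := fun q : (ℝ × ℝ) × ℝ => (q.1.2 * q.1.1, q.2)) contDiff_bendSq (by fun_prop)

theorem contDiff_constCoeff : ContDiff ℝ ∞ constCoeff := by
  have sz1 : ContDiff ℝ ∞ fun q : (ℝ × ℝ) × ℝ => ζ₁ q.2 :=
    contDiff_deriv_ellipseCurvatureDot.comp contDiff_snd
  have sz3 : ContDiff ℝ ∞ fun q : (ℝ × ℝ) × ℝ => ζ₃ q.2 :=
    (contDiff_deriv (contDiff_deriv contDiff_deriv_ellipseCurvatureDot)).comp contDiff_snd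
  exact (contDiff_snd.comp contDiff_fst).mul
    (((contDiff_speedSq_mul.sqrt fun q => (speedSq_pos _ _).ne').mul
      (contDiff_const.mul (sz1.add sz3))).div contDiff_bendSq_mul fun q => (bendSq_pos _ _).ne').neg

theorem contDiff_sinCoeff {χ : ℝ → ℝ} (hχ : ContDiff ℝ ∞ χ)
    (h : ∀ ε μ t, 0 < speedSq ε t - χ μ ^ 2 * ζ₁ t ^ 2) : ContDiff ℝ ∞ (sinCoeff χ) := by
  have sz1 : ContDiff ℝ ∞ fun q : (ℝ × ℝ) × ℝ => ζ₁ q.2 :=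
    contDiff_deriv_ellipseCurvatureDot.comp contDiff_snd
  have sχ : ContDiff ℝ ∞ fun q : (ℝ × ℝ) × ℝ => χ q.1.1 :=
    hχ.comp (contDiff_fst.comp contDiff_fst)
  have sX := ((contDiff_speedSq_mul.sub ((sχ.pow 2).mul (sz1.pow 2))).sqrt
    fun q => (h _ _ _).ne')
  exact (((contDiff_bendSq_mul.sqrt fun q => (bendSq_pos _ _).ne').mul sz1).div
    (contDiff_speedSq_mul.mul sX)
    fun q => (mul_pos (speedSq_pos _ _) (Real.sqrt_pos.2 (h _ _ _))).ne').neg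

theorem constCoeff_add_two_pi (p : ℝ × ℝ) (t : ℝ) :
    constCoeff (p, t + 2 * Real.pi) = constCoeff (p, t) := by
  have p1 := deriv_ellipseCurvatureDot_periodic
  have p3 := Function.Periodic.deriv (Function.Periodic.deriv p1)
  simp only [constCoeff, speedSq_periodic _ t, bendSq_periodic _ t, p1 t, p3 t]

theorem sinCoeff_add_two_pi (χ : ℝ → ℝ) (p : ℝ × ℝ) (t : ℝ) :
    sinCoeff χ (p, t + 2 * Real.pi) = sinCoeff χ (p, t) := by
  simp only [sinCoeff, speedSq_periodic _ t, bendSq_periodic _ t,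
    deriv_ellipseCurvatureDot_periodic t]

theorem integral_constCoeff_zero (η : ℝ) :
    ∫ t in (0 : ℝ)..(2 * Real.pi), constCoeff ((0, η), t) =
      η * ∫ t in (0 : ℝ)..(2 * Real.pi), ζ t ^ 2 := by
  rw [← integral_sqrt_ellipse_mul, ← intervalIntegral.integral_const_mul]
  congr 1
  funext t
  simp only [constCoeff, speedSq, bendSq, mul_zero, ne_eq, OfNat.ofNat_ne_zero,
    not_false_eq_true, zero_pow, zero_mul, add_zero]
  ring

theorem integral_sinCoeff_zero {χ : ℝ → ℝ} (hχ : χ 0 = 0) (η : ℝ) :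
    ∫ t in (0 : ℝ)..(2 * Real.pi), sinCoeff χ ((0, η), t) =
      ∫ t in (0 : ℝ)..(2 * Real.pi), ζ t ^ 2 := by
  rw [← integral_ellipseCurvature_mul]
  congr 1
  funext t
  have h4 : √(4 : ℝ) = 2 := by
    rw [show (4 : ℝ) = 2 ^ 2 by norm_num]; exact Real.sqrt_sq (by norm_num)
  have h0 := Real.sqrt_pos.2 (ellipse_speed_sq_pos t)
  have h1 := Real.mul_self_sqrt (ellipse_speed_sq_pos t).le
  rw [ellipseCurvature_eq]
  simp only [sinCoeff, speedSq, bendSq, mul_zero, hχ, ne_eq, OfNat.ofNat_ne_zero,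
    not_false_eq_true, zero_pow, zero_mul, add_zero, sub_zero, h4]
  have h2 : (4 - 3 * Real.cos t ^ 2) * √(4 - 3 * Real.cos t ^ 2) =
      √(4 - 3 * Real.cos t ^ 2) ^ 3 := by
    nth_rewrite 1 [← h1]
    ring
  rw [h2]
  ring

theorem neg_twisting_eq_constCoeff (μ η t : ℝ) :
    -twisting (centerCurve (η * μ)) t = μ * constCoeff ((μ, η), t) := by
  rw [twisting_centerCurve, constCoeff]
  ring

theorem bending_mul_eq_sinCoeff {χ : ℝ → ℝ} {μ : ℝ} (hχ : χ μ = μ) (ρ η t : ℝ) :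
    bending (centerCurve (η * μ)) t * (canalCos (centerCurve (η * μ)) (radius ρ μ) t /
      canalSin (centerCurve (η * μ)) (radius ρ μ) t) = μ * sinCoeff χ ((μ, η), t) := by
  rw [bending_centerCurve, canalCos_div_canalSin, div_mul_div_comm, sinCoeff]
  simp only [hχ]
  ring

/-- The equation of the principal lines is `φ' = μ (a + b sin φ)`, where `a` and `b` are smooth
functions of `μ`, `η = ε / μ` and `t`. -/
theorem exists_coefficients : ∃ (a b : (ℝ × ℝ) × ℝ → ℝ) (δ : ℝ), 0 < δ ∧
    ContDiff ℝ ∞ a ∧ ContDiff ℝ ∞ b ∧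
    (∀ p t, a (p, t + 2 * Real.pi) = a (p, t)) ∧ (∀ p t, b (p, t + 2 * Real.pi) = b (p, t)) ∧
    (∀ η, ∫ t in (0 : ℝ)..(2 * Real.pi), a ((0, η), t) =
      η * ∫ t in (0 : ℝ)..(2 * Real.pi), ζ t ^ 2) ∧
    (∀ η, ∫ t in (0 : ℝ)..(2 * Real.pi), b ((0, η), t) =
      ∫ t in (0 : ℝ)..(2 * Real.pi), ζ t ^ 2) ∧
    ∀ μ, |μ| ≤ δ → ∀ ρ η t, -twisting (centerCurve (η * μ)) t = μ * a ((μ, η), t) ∧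
      bending (centerCurve (η * μ)) t * (canalCos (centerCurve (η * μ)) (radius ρ μ) t /
        canalSin (centerCurve (η * μ)) (radius ρ μ) t) = μ * b ((μ, η), t) := by
  obtain ⟨M, hM, hMb⟩ := Function.Periodic.exists_abs_le deriv_ellipseCurvatureDot_periodic
    (by positivity) contDiff_deriv_ellipseCurvatureDot.continuous
  obtain ⟨χ, hχ, hχb, hχe⟩ := exists_smooth_cutoff (r := 1 / (4 * M)) (by positivity)
  have hX : ∀ ε μ t, 0 < speedSq ε t - χ μ ^ 2 * ζ₁ t ^ 2 := by
    intro ε μ t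
    have h1 : |χ μ * ζ₁ t| ≤ 1 / 2 := by
      rw [abs_mul]
      calc |χ μ| * |ζ₁ t| ≤ (2 * (1 / (4 * M))) * M :=
            mul_le_mul (hχb μ) (hMb t) (abs_nonneg _) (by positivity)
        _ = 1 / 2 := by field_simp; norm_num
    have h2 := sq_le_sq' (abs_le.1 h1).1 (abs_le.1 h1).2
    rw [mul_pow] at h2
    linarith [one_le_speedSq ε t]
  exact ⟨constCoeff, sinCoeff χ, 1 / (4 * M), by positivity, contDiff_constCoeff,
    contDiff_sinCoeff hχ hX, constCoeff_add_two_pi, sinCoeff_add_two_pi χ,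
    integral_constCoeff_zero, integral_sinCoeff_zero (hχe 0 (by simp; positivity)),
    fun μ hμ ρ η t => ⟨neg_twisting_eq_constCoeff μ η t, bending_mul_eq_sinCoeff (hχe μ hμ) ρ η t⟩⟩

end

/-! ### Regularity of the surfaces for small parameters -/

theorem exists_abs_le_of_periodic_snd {G : ℝ → ℝ → ℝ} (hG : Continuous fun p : ℝ × ℝ => G p.1 p.2)
    {T : ℝ} (hT : 0 < T) (hp : ∀ ε, Function.Periodic (G ε) T) :
    ∃ N, ∀ ε, |ε| ≤ 1 → ∀ t, |G ε t| ≤ N := by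
  obtain ⟨N, hN⟩ := ((isCompact_Icc (a := (-1 : ℝ)) (b := 1)).prod
    (isCompact_Icc (a := (0 : ℝ)) (b := T))).exists_bound_of_continuousOn hG.continuousOn
  refine ⟨N, fun ε hε t => ?_⟩
  obtain ⟨s, hs, h⟩ := (hp ε).exists_mem_Ico₀ hT t
  rw [h]
  exact hN (ε, s) ⟨abs_le.1 hε, Ico_subset_Icc_self hs⟩

section

local notation "ζ₁" => deriv ellipseCurvatureDot

/-- Since `κ̇` is odd, `r(t) + r(-t) = 2ρ`, and both terms are positive. A small `ρ` thus forces a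
small radius, whatever `μ` is. -/
theorem radius_lt_two_mul {ρ μ : ℝ} (h : ∀ t, 0 < radius ρ μ t) (t : ℝ) :
    radius ρ μ t < 2 * ρ := by
  have := h (-t)
  simp only [radius, ellipseCurvatureDot_neg] at *
  linarith

/-- `cos θ` is `-μ` times a smooth function of `(ε, t)` that is periodic in `t`; `ρ` drops out,
which makes the bound uniform. -/
theorem exists_abs_deriv_canalCos_le : ∃ N, ∀ ε, |ε| ≤ 1 → ∀ ρ μ, |μ| ≤ 1 → ∀ t,
    |deriv (canalCos (centerCurve ε) (radius ρ μ)) t| ≤ N := by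
  have hF : ContDiff ℝ ∞ fun p : ℝ × ℝ => ζ₁ p.2 / √(speedSq p.1 p.2) :=
    (contDiff_deriv_ellipseCurvatureDot.comp contDiff_snd).div
      (contDiff_speedSq.sqrt fun p => (speedSq_pos p.1 p.2).ne')
      fun p => (Real.sqrt_pos.2 (speedSq_pos p.1 p.2)).ne'
  have hd : ∀ ε t, HasDerivAt (fun t => ζ₁ t / √(speedSq ε t))
      (fderiv ℝ (fun p : ℝ × ℝ => ζ₁ p.2 / √(speedSq p.1 p.2)) (ε, t) (0, 1)) t := fun ε t =>
    HasFDerivAt.comp_hasDerivAt t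
      (l := fun p : ℝ × ℝ => ζ₁ p.2 / √(speedSq p.1 p.2)) (f := fun t => (ε, t))
      ((hF.differentiable (by simp)) (ε, t)).hasFDerivAt
      ((hasDerivAt_const t ε).prodMk (hasDerivAt_id t))
  obtain ⟨N, hN⟩ := exists_abs_le_of_periodic_snd
    (G := fun ε t => deriv (fun t => ζ₁ t / √(speedSq ε t)) t) (T := 2 * Real.pi) (by
      simp only [fun ε t => (hd ε t).deriv]
      exact (hF.continuous_fderiv (by simp)).clm_apply continuous_const) (by positivity)
    fun ε => Function.Periodic.deriv fun t => by
      simp only [speedSq_periodic ε t, deriv_ellipseCurvatureDot_periodic t]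
  refine ⟨N, fun ε hε ρ μ hμ t => ?_⟩
  have h1 : canalCos (centerCurve ε) (radius ρ μ) = fun t => -μ * (ζ₁ t / √(speedSq ε t)) := by
    funext t
    rw [canalCos_centerCurve]
    ring
  rw [h1, ((hd ε t).const_mul (-μ)).deriv, ← (hd ε t).deriv, abs_mul, abs_neg]
  exact (mul_le_of_le_one_left (abs_nonneg _) hμ).trans (hN ε hε t)

theorem exists_bending_le : ∃ N, ∀ ε, |ε| ≤ 1 → ∀ t, |bending (centerCurve ε) t| ≤ N := by
  refine exists_abs_le_of_periodic_snd (T := 2 * Real.pi) ?_ (by positivity) fun ε t => ?_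
  · simp only [bending_centerCurve]
    exact contDiff_bendSq.continuous.sqrt.div contDiff_speedSq.continuous
      fun p => (speedSq_pos p.1 p.2).ne'
  · simp only [bending_centerCurve, speedSq_periodic ε t, bendSq_periodic ε t]

theorem exists_isRegularCanal : ∃ ρ₀ μ₀ : ℝ, 0 < ρ₀ ∧ 0 < μ₀ ∧ ∀ ρ < ρ₀, ∀ μ, |μ| ≤ μ₀ →
    (∀ t, 0 < radius ρ μ t) → ∀ ε, |ε| ≤ 1 → IsRegularCanal (centerCurve ε) (radius ρ μ) := by
  obtain ⟨M, hM, hMb⟩ := Function.Periodic.exists_abs_le deriv_ellipseCurvatureDot_periodic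
    (by positivity) contDiff_deriv_ellipseCurvatureDot.continuous
  obtain ⟨N₁, hN₁⟩ := exists_abs_deriv_canalCos_le
  obtain ⟨N₂, hN₂⟩ := exists_bending_le
  set N := max (max N₁ N₂) 1 with hN
  have hN0 : 0 < N := by positivity
  -- The bound on `μ` gives `|cos θ| ≤ 1/2`, hence `sin θ ≥ 1/2` and `ṡ sin θ ≥ 1/2`. The turning of
  -- the normal is at most `2N + N`, and `r < 2ρ < 1/(6N)`, so its product with `r` is below `1/2`
  -- and `meridianSpeed` is negative.
  refine ⟨1 / (12 * N), min 1 (1 / (2 * M)), by positivity, by positivity, ?_⟩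
  intro ρ hρ μ hμ hr ε hε
  have hspeed : ∀ t, 1 ≤ √(speedSq ε t) := fun t => Real.one_le_sqrt.2 (one_le_speedSq ε t)
  have hcos : ∀ t, canalCos (centerCurve ε) (radius ρ μ) t ^ 2 ≤ 1 / 4 := by
    intro t
    have h1 : |canalCos (centerCurve ε) (radius ρ μ) t| ≤ 1 / 2 := by
      rw [canalCos_centerCurve, abs_neg, abs_div, abs_of_nonneg (Real.sqrt_nonneg _), abs_mul]
      refine (div_le_self (by positivity) (hspeed t)).trans ?_
      calc |μ| * |ζ₁ t| ≤ (1 / (2 * M)) * M :=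
            mul_le_mul (hμ.trans (min_le_right _ _)) (hMb t) (abs_nonneg _) (by positivity)
        _ = 1 / 2 := by field_simp
    have h2 := sq_le_sq' (abs_le.1 h1).1 (abs_le.1 h1).2
    linarith
  refine ⟨contDiff_centerCurve ε, contDiff_radius ρ μ, cross_centerCurve_ne_zero ε,
    fun t => by linarith [hcos t], hr, fun p => ?_⟩
  have hsin : 1 / 2 ≤ canalSin (centerCurve ε) (radius ρ μ) p.1 :=
    Real.le_sqrt_of_sq_le (by linarith [hcos p.1])
  have e1 : -deriv (canalCos (centerCurve ε) (radius ρ μ)) p.1 /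
      canalSin (centerCurve ε) (radius ρ μ) p.1 ≤ 2 * N := by
    have h1 := neg_le_of_abs_le (hN₁ ε hε ρ μ (hμ.trans (min_le_left _ _)) p.1)
    have h2 : N₁ ≤ N := (le_max_left _ _).trans (le_max_left _ _)
    rw [div_le_iff₀ (by linarith)]
    nlinarith
  have e2 : bending (centerCurve ε) p.1 * Real.cos p.2 ≤ N := by
    refine (le_abs_self _).trans ?_
    rw [abs_mul]
    refine (mul_le_of_le_one_right (abs_nonneg _) (Real.abs_cos_le_one _)).trans ?_
    exact (hN₂ ε hε p.1).trans ((le_max_right _ _).trans (le_max_left _ _))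
  have e3 : radius ρ μ p.1 * normalTurning (centerCurve ε) (radius ρ μ) p < 1 / 2 := by
    have h1 : normalTurning (centerCurve ε) (radius ρ μ) p ≤ 3 * N := by
      rw [normalTurning]
      linarith
    calc _ ≤ radius ρ μ p.1 * (3 * N) := mul_le_mul_of_nonneg_left h1 (hr p.1).le
      _ < (2 * (1 / (12 * N))) * (3 * N) :=
          mul_lt_mul_of_pos_right (by linarith [radius_lt_two_mul hr p.1]) (by positivity)
      _ = 1 / 2 := by field_simp; norm_num
  have e4 : 1 / 2 ≤ speed (centerCurve ε) p.1 * canalSin (centerCurve ε) (radius ρ μ) p.1 := by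
    rw [speed_centerCurve]
    nlinarith [hspeed p.1]
  rw [meridianSpeed]
  linarith

end

end Canal

theorem mainTheorem3 :
    ∃ (ε₁ ε₂ : ℝ → ℝ) (ρ₀ μ₀ : ℝ), 0 < ρ₀ ∧ 0 < μ₀ ∧
      ContDiffOn ℝ ∞ ε₁ (Ioo (-μ₀) μ₀) ∧ ContDiffOn ℝ ∞ ε₂ (Ioo (-μ₀) μ₀) ∧
      (fun μ => ε₁ μ - (-μ)) =O[𝓝 0] (fun μ => μ ^ 2) ∧
      (fun μ => ε₂ μ - μ) =O[𝓝 0] (fun μ => μ ^ 2) ∧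
      ∀ ρ ∈ Ioo 0 ρ₀, ∀ μ ∈ Ioo 0 μ₀, (∀ t, 0 < Canal.radius ρ μ t) →
        ε₁ μ < ε₂ μ ∧
        (∀ ε ∈ Icc (ε₁ μ) (ε₂ μ), Canal.IsSmoothImmersion (Canal.surface ε ρ μ) ∧
          ∀ p, ¬ Canal.IsUmbilic (Canal.surface ε ρ μ) p) ∧
        (∀ ε ∈ Ioo (ε₁ μ) (ε₂ μ),
          {C | Canal.IsPrincipalCycle (Canal.surface ε ρ μ) C}.ncard = 2 ∧
          ∀ C, Canal.IsPrincipalCycle (Canal.surface ε ρ μ) C →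
            Canal.IsHyperbolicPrincipalCycle (Canal.surface ε ρ μ) C) ∧
        (∀ ε, ε = ε₁ μ ∨ ε = ε₂ μ →
          {C | Canal.IsPrincipalCycle (Canal.surface ε ρ μ) C}.ncard = 1 ∧
          ∀ C, Canal.IsPrincipalCycle (Canal.surface ε ρ μ) C →
            Canal.IsDoublePrincipalCycle (Canal.surface ε ρ μ) C) := by
  obtain ⟨a, b, δ₁, hδ₁, ha, hb, hap, hbp, ha0, hb0, hab⟩ := Canal.exists_coefficients
  obtain ⟨e₁, e₂, δ₂, hδ₂, hs₁, hs₂, h10, h20, hbif⟩ := Canal.exists_bifurcation ha hb hap hbp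
    Canal.integral_sq_ellipseCurvatureDot_pos ha0 hb0
  obtain ⟨ρ₀, μ₁, hρ₀, hμ₁, hreg⟩ := Canal.exists_isRegularCanal
  -- The bound `1/2`, together with `e₁, e₂ < 2`, keeps `|ε| ≤ 1`, the range in which regularity is
  -- uniform.
  set μ₀ := min (min δ₁ δ₂) (min μ₁ (1 / 2)) with hμ₀
  have l1 : μ₀ ≤ δ₁ := (min_le_left _ _).trans (min_le_left _ _)
  have l2 : μ₀ ≤ δ₂ := (min_le_left _ _).trans (min_le_right _ _)
  have l3 : μ₀ ≤ μ₁ := (min_le_right _ _).trans (min_le_left _ _)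
  have l4 : μ₀ ≤ 1 / 2 := (min_le_right _ _).trans (min_le_right _ _)
  have hsub : Ioo (-μ₀) μ₀ ⊆ Ioo (-δ₂) δ₂ := Ioo_subset_Ioo (neg_le_neg l2) l2
  refine ⟨fun μ => -(μ * e₁ μ), fun μ => μ * e₂ μ, ρ₀, μ₀, hρ₀, by positivity,
    (contDiffOn_id.mul (hs₁.mono hsub)).neg, contDiffOn_id.mul (hs₂.mono hsub), ?_,
    Canal.isBigO_mul_sub_self hδ₂ hs₂ h20, ?_⟩
  · exact (Canal.isBigO_mul_sub_self hδ₂ hs₁ h10).neg_left.congr_left fun μ => by ring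
  intro ρ hρ μ hμ hr
  obtain ⟨he₁, he₂, hφ⟩ := hbif μ ⟨hμ.1, hμ.2.trans_le l2⟩
  have hμ0 := hμ.1
  have habs : |μ| ≤ μ₀ := by rw [abs_of_pos hμ0]; exact hμ.2.le
  have hscale : ∀ ε ∈ Icc (-(μ * e₁ μ)) (μ * e₂ μ), ε / μ ∈ Icc (-e₁ μ) (e₂ μ) := by
    intro ε hε
    rw [mem_Icc, le_div_iff₀ hμ0, div_le_iff₀ hμ0]
    exact ⟨by linarith [hε.1], by linarith [hε.2]⟩
  have hcanal : ∀ ε ∈ Icc (-(μ * e₁ μ)) (μ * e₂ μ),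
      Canal.IsRegularCanal (Canal.centerCurve ε) (Canal.radius ρ μ) := by
    intro ε hε
    refine hreg ρ hρ.2 μ (habs.trans l3) hr ε (abs_le.2 ⟨?_, ?_⟩)
    · nlinarith [hε.1, he₁.1, he₁.2, hμ.2]
    · nlinarith [hε.2, he₂.1, he₂.2, hμ.2]
  have hfol : ∀ ε ∈ Icc (-(μ * e₁ μ)) (μ * e₂ μ),
      Canal.HasMinimalFoliation (Canal.surface ε ρ μ) (fun t => μ * a ((μ, ε / μ), t))
        (fun t => μ * b ((μ, ε / μ), t)) := by
    intro ε hε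
    have h1 := (hcanal ε hε).hasMinimalFoliation
    have h2 := hab μ (habs.trans l1) ρ (ε / μ)
    rw [div_mul_cancel₀ _ hμ0.ne'] at h2
    simp only [(h2 _).1, (h2 _).2] at h1
    exact h1
  have hsB : ∀ η, ContDiff ℝ ∞ fun t => μ * b ((μ, η), t) := fun η =>
    contDiff_const.mul (hb.comp (by fun_prop : ContDiff ℝ ∞ fun t : ℝ => ((μ, η), t)))
  have hpB : ∀ η t, μ * b ((μ, η), t + 2 * Real.pi) = μ * b ((μ, η), t) := fun η t => by
    rw [hbp]
  refine ⟨?_, fun ε hε => ⟨(hcanal ε hε).isSmoothImmersion, (hcanal ε hε).not_isUmbilic⟩,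
    fun ε hε => ?_, fun ε hε => ?_⟩
  · have := mul_pos hμ0 he₁.1
    have := mul_pos hμ0 he₂.1
    simp only
    linarith
  · have hε' := Ioo_subset_Icc_self hε
    obtain ⟨φ, h1, h2, -⟩ := hφ (ε / μ) (hscale ε hε')
    refine h1.two_hyperbolic_cycles (hsB _) (hpB _) (hfol ε hε') (h2 ?_)
    rw [mem_Ioo, lt_div_iff₀ hμ0, div_lt_iff₀ hμ0]
    exact ⟨by linarith [hε.1], by linarith [hε.2]⟩
  · have hε' : ε ∈ Icc (-(μ * e₁ μ)) (μ * e₂ μ) := by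
      have := mul_pos hμ0 he₁.1
      have := mul_pos hμ0 he₂.1
      rcases hε with rfl | rfl
      · exact ⟨le_rfl, by simp only; linarith⟩
      · exact ⟨by simp only; linarith, le_rfl⟩
    obtain ⟨φ, h1, -, h3⟩ := hφ (ε / μ) (hscale ε hε')
    obtain ⟨h4, h5⟩ := h3 <| hε.imp
      (fun h => by rw [h]; field_simp) (fun h => by rw [h]; field_simp)
    exact h1.one_double_cycle (hsB _) (hpB _) (hfol ε hε') h4 h5
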